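/- **Setting.** Let $K$ be an algebraically closed field of characteristic $0$, $p\ge 2$ an integer (not necessarily prime), $\lambda\in\mathbb Z$, and $f\in K(x)$. Let $\mathbb N=\{1,2,\dots\}$. Call $f$ *$\lambda$-Mahler summable* if $f(x)=p^\lambda g(x^p)-g(x)$ for some $g\in K(x)$. **Theorem.** $f$ is $\lambda$-Mahler summable if and only if $\mathrm{dres}_\lambda(f,\infty)=0$ and $\mathrm{dres}_\lambda(f,\tau,k)=0$ for every Mahler tree $\tau$ and every $k\in\mathbb N$. The terms are defined as follows. *Partial fractions.* Write $f=\sum_{j\in\mathbb Z}c_jx^j+\sum_{\alpha\in K^\times}\sum_{k\in\mathbb N}\frac{c_k(\alpha)}{(x-\alpha)^k}$ (finite sums). For $n\ge 0$, $1\le k\le m$ and $\alpha\in K^\times$, let $V^m_{k,n}(\alpha)$ be the coefficient of $(x-\alpha)^{-k}$ in the partial fraction decomposition of $(x^{p^n}-\alpha^{p^n})^{-m}$. Let $\mathbb V^m_{k,n}\in\mathbb Q$ be the coefficient of $(x-1)^{m-k}$ in the Taylor expansion of $(1+x+\dots+x^{p^n-1})^{-m}$ at $x=1$. *Residue at $\infty$.*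 Its components are indexed by the trajectories $\theta=\{0\}$ and $\theta=\{ip^n: n\ge 0\}$, $p\nmid i$. For $\theta=\{0\}$ the component is $c_0$ if $\lambda=0$, and $0$ if $\lambda\ne 0$. For $\theta\ni i$ with $p\nmid i$ it is $p^{\lambda h}\sum_{j=0}^{h}p^{-\lambda j}c_{ip^j}$, where $h$ is the largest integer $\ge 0$ with $c_{ip^h}\ne 0$ ($h=0$ if there is none). *Mahler trees.* These are the classes of the relation $\alpha\sim\gamma\iff\alpha^{p^r}=\gamma^{p^s}$ for some $r,s\ge 0$ on $K^\times$. For a tree $\tau$, the cycle $C(\tau)$ is the set of roots of unity in $\tau$ of order coprime to $p$, and $e=|C(\tau)|<\infty$. The tree is torsion if $e\geq 1$ and non-torsion if $e=0$. Let $\mathrm{sing}(f,\tau)$ be the set of poles of $f$ in $\tau$ and $m$ the maximal order of these poles. The residue $\mathrm{dres}_\lambda(f,\tau,k)$ is a vector with components indexed by $\alpha\in\tau$. It is $0$ if $\mathrm{sing}(f,\tau)=\emptyset$ or $k>m$. Otherwise it is defined as follows. *Non-torsion $\tau$.* Let $h\ge 0$ be the smallest integer for which there is $\gamma\in\tau$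 such that every $\alpha\in\mathrm{sing}(f,\tau)$ satisfies $\alpha^{p^n}=\gamma$ for some $0\le n\le h$. This $\gamma$ is then unique. If $\alpha^{p^h}=\gamma$, put $$\mathrm{dres}_\lambda(f,\tau,k)_\alpha=\sum_{s=k}^m\sum_{n=0}^h p^{\lambda n}V^s_{k,n}(\alpha)\,c_s(\alpha^{p^n}),$$ and put $\mathrm{dres}_\lambda(f,\tau,k)_\alpha=0$ for all other $\alpha\in\tau$. *Cycle maps, for torsion $\tau$.* Consider families $\mathbf d=(d_k(\gamma))_{k\in\mathbb N,\gamma\in C(\tau)}$ of elements of $K$ with finite support. Define $\mathcal D(\mathbf d)_k(\gamma)=-d_k(\gamma)+p^\lambda\sum_{s\ge k}V^s_{k,1}(\gamma)d_s(\gamma^p)$. Given $\mathbf c$, define $\mathbf d=\mathcal I^{(0)}(\mathbf c)$ by descending recursion on $k$: $d_k=0$ if $c_s(\gamma)=0$ for all $s\ge k$ and all $\gamma\in C(\tau)$. For any remaining $k$ put $b_k(\gamma)=c_k(\gamma)-p^\lambda\sum_{s\ge k+1}V^s_{k,1}(\gamma)d_s(\gamma^p)$ and $$d_k(\gamma)=\frac{\gamma^k}{p^{(\lambda-k)e}-1}\sum_{j=0}^{e-1}p^{(\lambda-k)j}\gamma^{-kp^j}b_k(\gamma^{p^j})\quad(k\ne\lambda),\qquad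 d_\lambda(\gamma)=\frac{\gamma^\lambda}{e}\sum_{j=0}^{e-1}(j+1-e)\gamma^{-\lambda p^j}b_\lambda(\gamma^{p^j})\quad(k=\lambda).$$ For $\lambda\ge 1$ define $\mathbf w$ recursively by $w_k=0$ for $k>\lambda$, $w_\lambda(\gamma)=\gamma^\lambda$, and for $k<\lambda$ $$w_k(\gamma)=\frac{p^\lambda\gamma^k}{1-p^{(\lambda-k)e}}\sum_{j=0}^{e-1}\sum_{s=k+1}^{\lambda}p^{(\lambda-k)j}\,\mathbb V^s_{k,1}\,\gamma^{-sp^{j+1}}w_s(\gamma^{p^{j+1}}).$$ For $\omega\in K$ let $\mathcal I^{(\omega)}(\mathbf c)=\mathcal I^{(0)}(\mathbf c)$ if $\lambda\le 0$, and $\mathcal I^{(\omega)}(\mathbf c)=\mathcal I^{(0)}(\mathbf c)+\omega\mathbf w$ if $\lambda\ge 1$. *Torsion $\tau$.* Let $\eta(\alpha)$ be the smallest $n\ge 0$ with $\alpha^{p^n}\in C(\tau)$, let $h=\max\{\eta(\alpha):\alpha\in\mathrm{sing}(f,\tau)\}$, $\tau_h=\{\alpha\in\tau:\eta(\alpha)=h\}$,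 and $\mathbf c=(c_k(\gamma))_{k\in\mathbb N,\gamma\in C(\tau)}$. If $h=0$, put $\mathrm{dres}_\lambda(f,\tau,k)_\alpha=c_k(\alpha)$ for $\alpha\in C(\tau)$ and $0$ for all other $\alpha\in\tau$. If $h\ge 1$, first define $\omega\in K$: it is $0$ if $\lambda\le 0$, and for $\lambda\ge 1$, with $\mathbf d^{(0)}=\mathcal I^{(0)}(\mathbf c)$ and $\tilde{\mathbf c}^{(0)}=\mathcal D(\mathbf d^{(0)})$, $$\omega=\frac{1}{(p^h-p^{h-1})e}\sum_{\alpha\in\tau_h}\sum_{s\ge\lambda}\sum_{n=0}^{h-1}p^{\lambda n}\,\mathbb V^s_{\lambda,n}\,\alpha^{-sp^n}c_s(\alpha^{p^n})-\frac{p^{\lambda(h-1)}}{e}\sum_{\gamma\in C(\tau)}\sum_{s\ge\lambda}\mathbb V^s_{\lambda,h-1}\,\gamma^{-s}\bigl(\tilde c^{(0)}_s(\gamma)+d^{(0)}_s(\gamma)\bigr).$$ Let $\mathbf d=\mathcal I^{(\omega)}(\mathbf c)$ and $\tilde{\mathbf c}=\mathcal D(\mathbf d)$. For $\eta(\alpha)=h$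 put $$\mathrm{dres}_\lambda(f,\tau,k)_\alpha=\sum_{s=k}^m\sum_{n=0}^{h-1}p^{\lambda n}V^s_{k,n}(\alpha)c_s(\alpha^{p^n})-p^{\lambda(h-1)}\sum_{s=k}^m\mathbb V^s_{k,h-1}\,\alpha^{k-sp^{h+e-1}}\Bigl(\tilde c_s\bigl(\alpha^{p^{h+e-1}}\bigr)+d_s\bigl(\alpha^{p^{h+e-1}}\bigr)\Bigr).$$ If $k=\lambda$ and $\gamma\in C(\tau)$, put $\mathrm{dres}_\lambda(f,\tau,\lambda)_\gamma=c_\lambda(\gamma)-\tilde c_\lambda(\gamma)$. All other components are $0$. -/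

import Mathlib

noncomputable section

namespace Mahler

/-! ### The Mahler operator and twisted Mahler summability -/

section Summability

variable {K : Type*} [Field K]

/-- The Mahler operator `σ : f(x) ↦ f(x ^ p)` on `K(x)`. -/
def mahlerOp (p : ℕ) (f : RatFunc K) : RatFunc K :=
  RatFunc.eval RatFunc.C (RatFunc.X ^ p) f

/-- `f` is `lam`-Mahler summable: `f(x) = p ^ lam * g(x ^ p) - g(x)` for some `g ∈ K(x)`. -/
def IsMahlerSummable (p : ℕ) (lam : ℤ) (f : RatFunc K) : Prop :=
  ∃ g : RatFunc K, f = (p : RatFunc K) ^ lam * mahlerOp p g - g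

end Summability

/-! ### Partial fraction coefficients -/

section PartialFractions

variable {K : Type*} [Field K]

/-- For `k ≥ 1`, the coefficient `c_k(α)` of `1 / (x - α) ^ k` in the partial fraction
decomposition of `f`, i.e. the coefficient of degree `-k` of the Laurent expansion of `f` at `α`
(`RatFunc.laurent α f` is `f(x + α)`). -/
def polarCoeff (f : RatFunc K) (k : ℕ) (α : K) : K :=
  ((RatFunc.laurent α f : RatFunc K) : LaurentSeries K).coeff (-(k : ℤ))

/-- The coefficient of `x ^ j` in the Laurent polynomial component of `f`. Here
`f = f_∞ + a / b` with `f_∞ ∈ K[x, x⁻¹]`, `deg a < deg b` and `gcd(x, b) = 1`: the terms of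
`f_∞` of degree `j ≥ 0` form the polynomial part (the quotient of numerator by denominator), and
those of degree `j < 0` form the polar part of `f` at `0`. -/
def laurentPolyCoeff (f : RatFunc K) (j : ℤ) : K :=
  if 0 ≤ j then (f.num / f.denom).coeff j.toNat else polarCoeff f (-j).toNat 0

/-- The order of `α` as a pole of `f` (it is `0` when `α` is not a pole). -/
def poleOrder (f : RatFunc K) (α : K) : ℕ :=
  f.denom.rootMultiplicity α

/-- The Mahler coefficient `V^m_{k,n}(α)`, for `1 ≤ k ≤ m`: the coefficient of `1 / (x - α) ^ k`
in the partial fraction decomposition of `1 / (x ^ (p ^ n) - α ^ (p ^ n)) ^ m`. -/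
def mahlerCoeff (p m k n : ℕ) (α : K) : K :=
  polarCoeff (1 / (RatFunc.X ^ (p ^ n) - RatFunc.C (α ^ (p ^ n))) ^ m : RatFunc K) k α

/-- The universal Mahler coefficient `𝕍^m_{k,n} ∈ ℚ`, for `1 ≤ k ≤ m`: the coefficient of
`(x - 1) ^ (m - k)` in the Taylor expansion of `(1 + x + ⋯ + x ^ (p ^ n - 1)) ^ (-m)` at `x = 1`
(the power series variable stands for `x - 1`). -/
def univMahlerCoeff (p m k n : ℕ) : ℚ :=
  PowerSeries.coeff (m - k)
    (((∑ i ∈ Finset.range (p ^ n), (1 + PowerSeries.X : PowerSeries ℚ) ^ i)⁻¹) ^ m)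

end PartialFractions

/-! ### The residue at infinity -/

section Infinity

variable {K : Type*} [Field K]

/-- The initial elements of the maximal trajectories of `ℤ` under multiplication by powers of `p`.
The trajectories are `{0}` and `{i * p ^ n | n ≥ 0}` for `p ∤ i`, and each of them contains
exactly one element of this type, which is used as its name. -/
abbrev Trajectory (p : ℕ) : Type :=
  {i : ℤ // i = 0 ∨ ¬ (p : ℤ) ∣ i}

/-- For the trajectory of `i`, the largest `h` such that `x ^ (i * p ^ h)` occurs in the Laurent
polynomial component of `f`, and `0` if there is none. -/
def trajHeight (p : ℕ) (f : RatFunc K) (i : ℤ) : ℕ :=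
  sSup {h : ℕ | laurentPolyCoeff f (i * (p : ℤ) ^ h) ≠ 0}

/-- The `lam`-Mahler discrete residue of `f` at `∞`, a vector indexed by the trajectories. -/
def residueInfty (p : ℕ) (lam : ℤ) (f : RatFunc K) : Trajectory p → K := fun i =>
  if (i : ℤ) = 0 then
    if lam = 0 then laurentPolyCoeff f 0 else 0
  else
    (p : K) ^ (lam * (trajHeight p f i : ℤ)) *
      ∑ j ∈ Finset.range (trajHeight p f i + 1),
        (p : K) ^ (-(lam * (j : ℤ))) * laurentPolyCoeff f ((i : ℤ) * (p : ℤ) ^ j)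

end Infinity

/-! ### Mahler trees -/

section Trees

variable {K : Type*} [Field K]

/-- The equivalence relation `α ∼ γ ↔ α ^ (p ^ r) = γ ^ (p ^ s)` for some `r, s ≥ 0`. -/
def treeSetoid (K : Type*) [Field K] (p : ℕ) : Setoid Kˣ where
  r α γ := ∃ r s : ℕ, α ^ (p ^ r) = γ ^ (p ^ s)
  iseqv :=
    { refl := fun _ => ⟨0, 0, rfl⟩
      symm := fun ⟨r, s, h⟩ => ⟨s, r, h.symm⟩
      trans := by
        rintro α β γ ⟨r, s, h⟩ ⟨t, u, h'⟩
        refine ⟨r + t, u + s, ?_⟩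
        rw [pow_add, pow_mul, h, ← pow_mul, mul_comm, pow_mul, h', ← pow_mul, ← pow_add] }

/-- The set of Mahler trees. -/
abbrev MahlerTree (K : Type*) [Field K] (p : ℕ) : Type _ :=
  Quotient (treeSetoid K p)

variable {p : ℕ}

/-- The set of elements of a Mahler tree. -/
def elems (τ : MahlerTree K p) : Set Kˣ :=
  {α | (Quotient.mk (treeSetoid K p) α) = τ}

/-- The Mahler cycle `C(τ)`: the roots of unity in `τ` whose order is coprime to `p`. -/
def cycle (τ : MahlerTree K p) : Set Kˣ :=
  {γ | γ ∈ elems τ ∧ IsOfFinOrder γ ∧ Nat.Coprime (orderOf γ) p}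

/-- The cycle length `|C(τ)|`. -/
def cycleLength (τ : MahlerTree K p) : ℕ :=
  (cycle τ).ncard

/-- The singular support of `f` in `τ`: the set of poles of `f` that lie in `τ`. -/
def sing (f : RatFunc K) (τ : MahlerTree K p) : Set Kˣ :=
  {α | α ∈ elems τ ∧ poleOrder f (α : K) ≠ 0}

/-- The order of `f` at `τ`: the largest order of a pole of `f` in `τ`, `0` if there is none. -/
def treeOrder (f : RatFunc K) (τ : MahlerTree K p) : ℕ :=
  sSup ((fun α : Kˣ => poleOrder f (α : K)) '' sing f τ)

end Trees

/-! ### Residues at non-torsion trees -/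

section NonTorsion

variable {K : Type*} [Field K] {p : ℕ}

/-- The bouquet of height `h` rooted at `γ` in `τ`. -/
def bouquet (τ : MahlerTree K p) (h : ℕ) (γ : Kˣ) : Set Kˣ :=
  {α | α ∈ elems τ ∧ ∃ n ≤ h, α ^ (p ^ n) = γ}

/-- The height of `f` at a non-torsion tree `τ`: the smallest `h` such that the poles of `f`
in `τ` lie in a bouquet of height `h`. -/
def bouquetHeight (f : RatFunc K) (τ : MahlerTree K p) : ℕ :=
  sInf {h : ℕ | ∃ γ ∈ elems τ, sing f τ ⊆ bouquet τ h γ}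

/-- `γ` is the root of the bouquet of `f` in `τ`. -/
def IsBouquetRoot (f : RatFunc K) (τ : MahlerTree K p) (γ : Kˣ) : Prop :=
  γ ∈ elems τ ∧ sing f τ ⊆ bouquet τ (bouquetHeight f τ) γ

open Classical in
/-- The `lam`-Mahler discrete residue of degree `k` of `f` at a non-torsion tree `τ`. It is
supported on the elements `α` of the bouquet of `f` whose height in `f` is maximal, that is, with
`α ^ (p ^ h)` equal to the root of the bouquet, where `h` is the height of `f` at `τ`. -/
def nonTorsionResidue (lam : ℤ) (f : RatFunc K) (τ : MahlerTree K p) (k : ℕ) : elems τ → K :=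
  fun α =>
    if sing f τ = ∅ ∨ treeOrder f τ < k then 0
    else if IsBouquetRoot f τ ((α : Kˣ) ^ (p ^ bouquetHeight f τ)) then
      ∑ s ∈ Finset.Icc k (treeOrder f τ), ∑ n ∈ Finset.range (bouquetHeight f τ + 1),
        (p : K) ^ (lam * (n : ℤ)) * mahlerCoeff p s k n ((α : Kˣ) : K) *
          polarCoeff f s (((α : Kˣ) : K) ^ (p ^ n))
    else 0

end NonTorsion

/-! ### Cycle maps and their sections

A vector `(d_k(γ))`, with `k ≥ 1` and `γ` in the cycle of a torsion tree, which vanishes for all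
large `k`, is represented by a function `d : ℕ → Kˣ → K`, of which only the values `d k γ` with
`1 ≤ k` and `γ` in the cycle matter. -/

section CycleMaps

variable {K : Type*} [Field K] {p : ℕ}

/-- The cycle map:
`D(d)_k(γ) = - d_k(γ) + p ^ lam * ∑_{s ≥ k} V^s_{k,1}(γ) * d_s(γ ^ p)`. -/
def cycleMap (p : ℕ) (lam : ℤ) (d : ℕ → Kˣ → K) : ℕ → Kˣ → K := fun k γ =>
  - d k γ + (p : K) ^ lam * ∑ᶠ (s : ℕ) (_ : k ≤ s), mahlerCoeff p s k 1 (γ : K) * d s (γ ^ p)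

/-- The vector `w` spanning the kernel of the cycle map for `lam ≥ 1`, where `e` is the cycle
length. The index `s` running over `k + 1, …, lam` is written `k + 1 + i`. -/
def kernelVec (p : ℕ) (lam : ℤ) (e : ℕ) (k : ℕ) (γ : Kˣ) : K :=
  if lam < (k : ℤ) then 0
  else if (k : ℤ) = lam then (γ : K) ^ lam
  else
    (p : K) ^ lam * (γ : K) ^ (k : ℤ) / (1 - (p : K) ^ ((lam - k) * (e : ℤ))) *
      ∑ j ∈ Finset.range e, ∑ i : Fin (lam.toNat - k),
        (p : K) ^ ((lam - k) * (j : ℤ)) * ((univMahlerCoeff p (k + 1 + i) k 1 : ℚ) : K) *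
          (γ : K) ^ (-(((k + 1 + i : ℕ) : ℤ) * (p : ℤ) ^ (j + 1))) *
          kernelVec p lam e (k + 1 + i) (γ ^ (p ^ (j + 1)))
termination_by lam.toNat - k
decreasing_by
  have := i.isLt
  omega

/-- The recursion defining the `0`-section, for a cycle of length `e` and a vector `c` with
`c_s = 0` on the cycle for all `s > M`. We have `d_k = 0` for `k > M`, and `d_k` is computed by
descending recursion for `k ≤ M`. The index `s` running over `k + 1, …, M` is written
`k + 1 + i`. -/
def zeroSectionAux (p : ℕ) (lam : ℤ) (e M : ℕ) (c : ℕ → Kˣ → K) (k : ℕ) (γ : Kˣ) : K :=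
  if M < k then 0
  else if (k : ℤ) ≠ lam then
    (γ : K) ^ (k : ℤ) / ((p : K) ^ ((lam - k) * (e : ℤ)) - 1) *
      ∑ j ∈ Finset.range e,
        (p : K) ^ ((lam - k) * (j : ℤ)) * (γ : K) ^ (-((k : ℤ) * (p : ℤ) ^ j)) *
          (c k (γ ^ (p ^ j)) - (p : K) ^ lam *
            ∑ i : Fin (M - k), mahlerCoeff p (k + 1 + i) k 1 ((γ : K) ^ (p ^ j)) *
              zeroSectionAux p lam e M c (k + 1 + i) (γ ^ (p ^ (j + 1))))
  else
    (γ : K) ^ lam / (e : K) *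
      ∑ j ∈ Finset.range e,
        ((j : K) + 1 - (e : K)) * (γ : K) ^ (-(lam * (p : ℤ) ^ j)) *
          (c k (γ ^ (p ^ j)) - (p : K) ^ lam *
            ∑ i : Fin (M - k), mahlerCoeff p (k + 1 + i) k 1 ((γ : K) ^ (p ^ j)) *
              zeroSectionAux p lam e M c (k + 1 + i) (γ ^ (p ^ (j + 1))))
termination_by M - k
decreasing_by
  all_goals
    have := i.isLt
    omega

/-- The `0`-section of the cycle map of `τ`: the recursion starts at the largest `k ≥ 1` for which
`c_k` does not vanish identically on the cycle. -/
def zeroSection (lam : ℤ) (τ : MahlerTree K p) (c : ℕ → Kˣ → K) : ℕ → Kˣ → K :=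
  zeroSectionAux p lam (cycleLength τ) (sSup {k : ℕ | 1 ≤ k ∧ ∃ γ ∈ cycle τ, c k γ ≠ 0}) c

/-- The `w`-section of the cycle map of `τ`, for a constant `w ∈ K`. -/
def omegaSection (lam : ℤ) (τ : MahlerTree K p) (w : K) (c : ℕ → Kˣ → K) : ℕ → Kˣ → K :=
  fun k γ =>
    if lam ≤ 0 then zeroSection lam τ c k γ
    else zeroSection lam τ c k γ + w * kernelVec p lam (cycleLength τ) k γ

end CycleMaps

/-! ### Residues at torsion trees -/

section Torsion

variable {K : Type*} [Field K] {p : ℕ}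

/-- The height of an element `α` of a torsion tree: the smallest `n` with `α ^ (p ^ n) ∈ C(τ)`. -/
def torsionHeight (τ : MahlerTree K p) (α : Kˣ) : ℕ :=
  sInf {n : ℕ | α ^ (p ^ n) ∈ cycle τ}

/-- The height of `f` at a torsion tree: the largest height of a pole of `f` in `τ`. -/
def funHeight (f : RatFunc K) (τ : MahlerTree K p) : ℕ :=
  sSup (torsionHeight τ '' sing f τ)

/-- The set of elements of height `h` of a torsion tree. -/
def level (τ : MahlerTree K p) (h : ℕ) : Set Kˣ :=
  {α | α ∈ elems τ ∧ torsionHeight τ α = h}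

/-- The vector `(c_k(γ))` of partial fraction coefficients of `f`. -/
def coeffVec (f : RatFunc K) : ℕ → Kˣ → K := fun k γ => polarCoeff f k (γ : K)

/-- The residual average of `f` relative to `lam` and a torsion tree `τ`. All the terms with
`s` larger than the order of `f` at `τ` vanish, so the sums over `s ≥ lam` stop there. -/
def residualAverage (lam : ℤ) (f : RatFunc K) (τ : MahlerTree K p) : K :=
  let h := funHeight f τ
  let m := treeOrder f τ
  let e := cycleLength τ
  let l := lam.toNat
  let d := zeroSection lam τ (coeffVec f)
  let c' := cycleMap p lam d
  if lam ≤ 0 ∨ h = 0 then 0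
  else
    1 / (((p : K) ^ h - (p : K) ^ (h - 1)) * (e : K)) *
      (∑ᶠ α ∈ level τ h, ∑ s ∈ Finset.Icc l m, ∑ n ∈ Finset.range h,
        (p : K) ^ (lam * (n : ℤ)) * ((univMahlerCoeff p s l n : ℚ) : K) *
          (α : K) ^ (-((s : ℤ) * (p : ℤ) ^ n)) * coeffVec f s (α ^ (p ^ n)))
    - (p : K) ^ (lam * ((h : ℤ) - 1)) / (e : K) *
      (∑ᶠ γ ∈ cycle τ, ∑ s ∈ Finset.Icc l m,
        ((univMahlerCoeff p s l (h - 1) : ℚ) : K) * (γ : K) ^ (-(s : ℤ)) * (c' s γ + d s γ))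

open Classical in
/-- The `lam`-Mahler discrete residue of degree `k` of `f` at a torsion tree `τ`. -/
def torsionResidue (lam : ℤ) (f : RatFunc K) (τ : MahlerTree K p) (k : ℕ) : elems τ → K :=
  fun α =>
    let h := funHeight f τ
    let m := treeOrder f τ
    let e := cycleLength τ
    let d := omegaSection lam τ (residualAverage lam f τ) (coeffVec f)
    let c' := cycleMap p lam d
    if sing f τ = ∅ ∨ m < k then 0
    else if h = 0 then
      if (α : Kˣ) ∈ cycle τ then coeffVec f k α else 0
    else if torsionHeight τ α = h then
      (∑ s ∈ Finset.Icc k m, ∑ n ∈ Finset.range h,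
        (p : K) ^ (lam * (n : ℤ)) * mahlerCoeff p s k n ((α : Kˣ) : K) *
          coeffVec f s ((α : Kˣ) ^ (p ^ n)))
      - (p : K) ^ (lam * ((h : ℤ) - 1)) *
        ∑ s ∈ Finset.Icc k m,
          ((univMahlerCoeff p s k (h - 1) : ℚ) : K) *
            ((α : Kˣ) : K) ^ ((k : ℤ) - (s : ℤ) * (p : ℤ) ^ (h + e - 1)) *
            (c' s ((α : Kˣ) ^ (p ^ (h + e - 1))) + d s ((α : Kˣ) ^ (p ^ (h + e - 1))))
    else if (k : ℤ) = lam ∧ (α : Kˣ) ∈ cycle τ then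
      coeffVec f k α - c' k α
    else 0

end Torsion

section Residue

variable {K : Type*} [Field K] {p : ℕ}

open Classical in
/-- The `lam`-Mahler discrete residue `dres(f, τ, k)` of degree `k ≥ 1` of `f` at the Mahler tree
`τ`, a vector indexed by the elements of `τ`. A tree is torsion if its cycle is non-empty. -/
def residueTree (lam : ℤ) (f : RatFunc K) (τ : MahlerTree K p) (k : ℕ) : elems τ → K :=
  if (cycle τ).Nonempty then torsionResidue lam f τ k else nonTorsionResidue lam f τ k

end Residue

end Mahler

end

noncomputable section

namespace Mahler

open Polynomial
open scoped RatFunc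

section

variable {K : Type*} [Field K]

/-! ### Principal parts of rational functions -/

/-! Compare coefficients in `f = p ^ lam * g(x ^ p) - g`. The substitution sends `x ^ j` to `x ^ (p
* j)`, and the principal part of `g(x ^ p)` at `α ≠ 0` depends only on that of `g` at `α ^ p`. The
equation therefore splits into independent systems, one for each trajectory of exponents and one for
each Mahler tree. By `exists_coeff` and `isMahlerSummable_of_coeff`, summability means that all of
them have solutions with finite support.

On a nonzero trajectory the equation is a recursion that starts at `i` with `p ∤ i`. Its solution is
unique, and far out it equals the residue up to a nonzero factor. On the trajectory `{0}` the
equation is `c_0 = (p ^ lam - 1) a_0`.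

On a tree the system reads `c = T d - d`, where `T` is `twist`. Let `S` be a set stable under `x ↦ x
^ p` which every element of the tree eventually enters. Values of `d` on `S` determine `d` at height
`n` above `S` as `T ^ n d - ∑_{j < n} T ^ j c`. If `c` vanishes above height `H ≥ 1`, a finitely
supported solution must vanish at height `H`: it vanishes far up, roots exist because `K` is
algebraically closed, and `T` is triangular with nonzero diagonal (`twist_injective`,
`solution_eq_zero`). Conversely, vanishing at height `H` propagates upwards and makes the support
finite (`exists_extension`). The residue at `α` of height `H` is `∑_{n < H} T ^ n c - T ^ H d`, and
it remains to identify `d` on `S`.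

For a non-torsion tree, `S` is the forward orbit strictly beyond the root of the bouquet. It is
infinite and free of poles, so `d = 0` on it. For a torsion tree, `S` is the cycle. There the system
is triangular in the degree `k`, and in degree `k` it is a cyclic equation `q v(γ ^ p) - v(γ) =
b(γ)` with `q = p ^ (lam - k)`. This is invertible unless `k = lam`, where constants span the kernel
and the average over the cycle is the obstruction. Hence `d` is the `0`-section plus a multiple of
the kernel vector (`exists_eq_zeroSection_add`). Averaging the condition at height `H` in degree
`lam` gives the multiple, which is `ω` (`residualAverage_eq`); the extra residue component on the
cycle in degree `lam` expresses the obstruction. -/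

theorem polarCoeff_add (f g : RatFunc K) (k : ℕ) (α : K) :
    polarCoeff (f + g) k α = polarCoeff f k α + polarCoeff g k α := by
  simp [polarCoeff]

theorem polarCoeff_sub (f g : RatFunc K) (k : ℕ) (α : K) :
    polarCoeff (f - g) k α = polarCoeff f k α - polarCoeff g k α := by
  simp [polarCoeff]

theorem polarCoeff_C_mul (a : K) (f : RatFunc K) (k : ℕ) (α : K) :
    polarCoeff (RatFunc.C a * f) k α = a * polarCoeff f k α := by
  have h : ((RatFunc.C a : RatFunc K) : LaurentSeries K) = HahnSeries.C a := by
    rw [← RatFunc.algebraMap_C, ← RatFunc.coePolynomial_eq_algebraMap]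
    erw [← RatFunc.coe_coe]
    simp
  simp only [polarCoeff, map_mul, RatFunc.laurent_C, h]
  rw [HahnSeries.C_mul_eq_smul]
  simp

theorem polarCoeff_sum {ι : Type*} (s : Finset ι) (f : ι → RatFunc K) (k : ℕ) (α : K) :
    polarCoeff (∑ i ∈ s, f i) k α = ∑ i ∈ s, polarCoeff (f i) k α := by
  classical
  induction s using Finset.induction_on with
  | empty => simp [polarCoeff]
  | insert i s hi ih => rw [Finset.sum_insert hi, Finset.sum_insert hi, polarCoeff_add, ih]

theorem algebraMap_laurentSeries (P : K[X]) :
    algebraMap (RatFunc K) (LaurentSeries K) (algebraMap K[X] (RatFunc K) P) =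
      HahnSeries.ofPowerSeries ℤ K (P : PowerSeries K) := by
  rw [← RatFunc.coePolynomial_eq_algebraMap]
  exact (RatFunc.coe_coe P).symm

/-- After the shift by `α` the denominator is `X ^ m` times a power series with nonzero constant
term, so the Laurent expansion is `X ^ (-m)` times a power series. The fraction need not be reduced,
so `m` may exceed the pole order. -/
theorem polarCoeff_div (a b : K[X]) (α : K) (hb : b.eval α ≠ 0) (m k : ℕ) :
    polarCoeff (algebraMap _ (RatFunc K) a / algebraMap _ (RatFunc K) ((X - C α) ^ m * b)) k α =
      if k ≤ m then PowerSeries.coeff (m - k)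
        ((taylor α a : PowerSeries K) * ((taylor α b : K[X]) : PowerSeries K)⁻¹) else 0 := by
  have hb0 : PowerSeries.constantCoeff ((taylor α b : K[X]) : PowerSeries K) ≠ 0 := by
    rw [Polynomial.constantCoeff_coe, taylor_coeff_zero]
    simpa using hb
  have ht : taylor α ((X - C α) ^ m * b) = X ^ m * taylor α b := by
    simp [taylor_mul, taylor_pow]
  have key : ((RatFunc.laurent α (algebraMap _ (RatFunc K) a /
      algebraMap _ (RatFunc K) ((X - C α) ^ m * b)) : RatFunc K) : LaurentSeries K) =
      HahnSeries.single (-(m : ℤ)) 1 * HahnSeries.ofPowerSeries ℤ K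
        ((taylor α a : PowerSeries K) * ((taylor α b : K[X]) : PowerSeries K)⁻¹) := by
    rw [RatFunc.laurent_div, ht, map_div₀, algebraMap_laurentSeries, algebraMap_laurentSeries]
    have hX : HahnSeries.ofPowerSeries ℤ K ((X ^ m * taylor α b : K[X]) : PowerSeries K) =
        HahnSeries.single (m : ℤ) 1 *
          HahnSeries.ofPowerSeries ℤ K ((taylor α b : K[X]) : PowerSeries K) := by
      simp
    have hne : HahnSeries.ofPowerSeries ℤ K ((taylor α b : K[X]) : PowerSeries K) ≠ 0 := by
      intro h
      have := (map_eq_zero_iff _ HahnSeries.ofPowerSeries_injective).1 h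
      rw [this] at hb0
      simp at hb0
    have hs : (HahnSeries.single (m : ℤ) (1 : K)) ≠ 0 := by simp
    rw [hX, div_eq_iff (mul_ne_zero hs hne)]
    have e1 : HahnSeries.single (-(m : ℤ)) (1 : K) * HahnSeries.single (m : ℤ) (1 : K) = 1 := by
      rw [HahnSeries.single_mul_single]; simp
    have e2 : HahnSeries.ofPowerSeries ℤ K (((taylor α b : K[X]) : PowerSeries K)⁻¹) *
        HahnSeries.ofPowerSeries ℤ K ((taylor α b : K[X]) : PowerSeries K) = 1 := by
      rw [← map_mul, PowerSeries.inv_mul_cancel _ hb0, map_one]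
    rw [map_mul]
    linear_combination
      (- HahnSeries.ofPowerSeries ℤ K ((taylor α a : K[X]) : PowerSeries K)) * e1
      - (HahnSeries.ofPowerSeries ℤ K ((taylor α a : K[X]) : PowerSeries K)) *
        (HahnSeries.single (-(m : ℤ)) (1 : K) * HahnSeries.single (m : ℤ) (1 : K)) * e2
  rw [polarCoeff, key]
  have : (-(k : ℤ)) = ((m : ℤ) - k) + (-(m : ℤ)) := by ring
  rw [this, HahnSeries.coeff_single_mul_add, one_mul, PowerSeries.coeff_coe]
  split_ifs with h1 h2 h2
  · omega
  · rfl
  · congr 1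
    congr 1
    omega
  · omega

theorem polarCoeff_div_of_eval_ne_zero (a b : K[X]) {α : K} (hb : b.eval α ≠ 0) {k : ℕ}
    (hk : 1 ≤ k) :
    polarCoeff (algebraMap _ (RatFunc K) a / algebraMap _ (RatFunc K) b) k α = 0 := by
  have := polarCoeff_div a b α hb 0 k
  rw [pow_zero, one_mul] at this
  rw [this, if_neg (by omega)]

theorem polarCoeff_algebraMap (P : K[X]) (α : K) {k : ℕ} (hk : 1 ≤ k) :
    polarCoeff (algebraMap _ (RatFunc K) P) k α = 0 := by
  have := polarCoeff_div_of_eval_ne_zero P 1 (α := α) (by simp) hk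
  simpa using this

open Classical in
theorem polarCoeff_one_div_X_sub_C_pow (α β : K) (s : ℕ) {k : ℕ} (hk : 1 ≤ k) :
    polarCoeff (1 / (RatFunc.X - RatFunc.C β) ^ s) k α = if α = β ∧ k = s then 1 else 0 := by
  have e : (1 / (RatFunc.X - RatFunc.C β) ^ s : RatFunc K) =
      algebraMap _ (RatFunc K) (1 : K[X]) / algebraMap _ (RatFunc K) ((X - C β) ^ s * 1) := by
    simp
  rw [e]
  by_cases h : α = β
  · subst h
    rw [polarCoeff_div _ _ _ (by simp)]
    have h1 : (((taylor α (1 : K[X]) : K[X]) : PowerSeries K)⁻¹ : PowerSeries K) = 1 := by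
      rw [PowerSeries.inv_eq_iff_mul_eq_one] <;> simp
    rw [h1]
    simp only [taylor_one, map_one, Polynomial.coe_one, mul_one, PowerSeries.coeff_one, true_and]
    split_ifs <;> first | rfl | omega
  · rw [polarCoeff_div_of_eval_ne_zero _ _ _ hk]
    · simp [h]
    · simp [sub_eq_zero, h]

theorem exists_denom_eq (f : RatFunc K) (α : K) :
    ∃ b : K[X], f.denom = (X - C α) ^ poleOrder f α * b ∧ b.eval α ≠ 0 := by
  obtain ⟨b, hb, h⟩ := Polynomial.exists_eq_pow_rootMultiplicity_mul_and_not_dvd f.denom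
    f.denom_ne_zero α
  exact ⟨b, hb, fun h0 => h (dvd_iff_isRoot.2 h0)⟩

theorem polarCoeff_eq_zero_of_poleOrder_lt (f : RatFunc K) (α : K) {k : ℕ}
    (hk : poleOrder f α < k) : polarCoeff f k α = 0 := by
  obtain ⟨b, hb, h0⟩ := exists_denom_eq f α
  rw [← f.num_div_denom, hb, polarCoeff_div _ _ _ h0, if_neg (by omega)]

/-- The leading coefficient is `num(α) / b(α)`, and `num(α) ≠ 0` because numerator and denominator
are coprime. -/
theorem polarCoeff_poleOrder_ne_zero (f : RatFunc K) (α : K) (h : poleOrder f α ≠ 0) :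
    polarCoeff f (poleOrder f α) α ≠ 0 := by
  obtain ⟨b, hb, h0⟩ := exists_denom_eq f α
  have hnum : f.num.eval α ≠ 0 := by
    intro hn
    have hd : f.denom.eval α = 0 := by
      rw [hb]; simp [h]
    obtain ⟨u, v, huv⟩ := f.isCoprime_num_denom
    have := congrArg (Polynomial.eval α) huv
    simp [hn, hd] at this
  conv in polarCoeff f => rw [← f.num_div_denom, hb]
  rw [polarCoeff_div _ _ _ h0, if_pos le_rfl]
  rw [Nat.sub_self, PowerSeries.coeff_zero_eq_constantCoeff_apply, map_mul,
    PowerSeries.constantCoeff_inv, Polynomial.constantCoeff_coe, Polynomial.constantCoeff_coe,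
    taylor_coeff_zero, taylor_coeff_zero]
  exact mul_ne_zero hnum (inv_ne_zero h0)

theorem poleOrder_eq_zero_iff (f : RatFunc K) (α : K) :
    poleOrder f α = 0 ↔ ∀ k, 1 ≤ k → polarCoeff f k α = 0 := by
  constructor
  · intro h k hk
    exact polarCoeff_eq_zero_of_poleOrder_lt f α (by omega)
  · intro h
    by_contra h0
    exact polarCoeff_poleOrder_ne_zero f α h0 (h _ (by omega))

theorem poleOrder_eq_zero_iff_eval (f : RatFunc K) (α : K) :
    poleOrder f α = 0 ↔ f.denom.eval α ≠ 0 := by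
  rw [poleOrder, Polynomial.rootMultiplicity_eq_zero_iff]
  have := f.denom_ne_zero
  simp only [IsRoot.def]
  tauto

theorem poleOrder_le (f : RatFunc K) (α : K) : poleOrder f α ≤ f.denom.natDegree := by
  classical
  rw [poleOrder, ← Polynomial.count_roots]
  exact (Multiset.count_le_card _ _).trans (Polynomial.card_roots' _)

theorem finite_poles (f : RatFunc K) : {α : K | poleOrder f α ≠ 0}.Finite := by
  classical
  refine (f.denom.roots.toFinset.finite_toSet).subset fun α hα => ?_
  have h := (poleOrder_eq_zero_iff_eval f α).not.1 hα
  simp only [not_not] at h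
  simp [f.denom_ne_zero, h]

/-! ### The polynomial part -/

/-- The polynomial part of a rational function. -/
def polyPart (f : RatFunc K) : K[X] := f.num / f.denom

/-- `f` vanishes at infinity. -/
def IsProper (f : RatFunc K) : Prop :=
  ∃ a b : K[X], b ≠ 0 ∧ a.degree < b.degree ∧
    f = algebraMap _ (RatFunc K) a / algebraMap _ (RatFunc K) b

theorem IsProper.add {f g : RatFunc K} (hf : IsProper f) (hg : IsProper g) :
    IsProper (f + g) := by
  obtain ⟨a, b, hb, hab, rfl⟩ := hf
  obtain ⟨c, d, hd, hcd, rfl⟩ := hg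
  refine ⟨a * d + b * c, b * d, mul_ne_zero hb hd, ?_, ?_⟩
  · refine lt_of_le_of_lt (degree_add_le _ _) (max_lt ?_ ?_)
    · rw [degree_mul, degree_mul]
      exact WithBot.add_lt_add_right (degree_ne_bot.2 hd) hab
    · rw [degree_mul, degree_mul]
      exact WithBot.add_lt_add_left (degree_ne_bot.2 hb) hcd
  · rw [div_add_div _ _ (RatFunc.algebraMap_ne_zero hb) (RatFunc.algebraMap_ne_zero hd)]
    simp

theorem IsProper.C_mul {f : RatFunc K} (hf : IsProper f) (c : K) :
    IsProper (RatFunc.C c * f) := by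
  obtain ⟨a, b, hb, hab, rfl⟩ := hf
  refine ⟨C c * a, b, hb, lt_of_le_of_lt ?_ hab, ?_⟩
  · exact (degree_mul_le _ _).trans (by simpa using add_le_add_left (degree_C_le (a := c)) a.degree)
  · simp [mul_div_assoc]

theorem isProper_zero : IsProper (0 : RatFunc K) := ⟨0, 1, one_ne_zero, by simp, by simp⟩

theorem IsProper.sum {ι : Type*} {s : Finset ι} {f : ι → RatFunc K}
    (h : ∀ i ∈ s, IsProper (f i)) : IsProper (∑ i ∈ s, f i) := by
  classical
  induction s using Finset.induction_on with
  | empty => simpa using isProper_zero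
  | insert i s hi ih =>
    rw [Finset.sum_insert hi]
    exact (h i (by simp)).add (ih fun j hj => h j (by simp [hj]))

theorem isProper_one_div_X_sub_C_pow (β : K) {s : ℕ} (hs : 1 ≤ s) :
    IsProper (1 / (RatFunc.X - RatFunc.C β) ^ s) := by
  refine ⟨1, (X - C β) ^ s, pow_ne_zero _ (X_sub_C_ne_zero β), ?_, by simp⟩
  rw [degree_one, degree_pow, degree_X_sub_C]
  simp
  omega

theorem eq_zero_of_isProper_algebraMap {P : K[X]} (h : IsProper (algebraMap _ (RatFunc K) P)) :
    P = 0 := by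
  obtain ⟨a, b, hb, hab, h⟩ := h
  rw [eq_div_iff (RatFunc.algebraMap_ne_zero hb), ← map_mul] at h
  have h := RatFunc.algebraMap_injective K h
  by_contra hP
  rw [← h, degree_mul, degree_eq_natDegree hP, degree_eq_natDegree hb] at hab
  norm_cast at hab
  omega

theorem isProper_sub_polyPart (f : RatFunc K) :
    IsProper (f - algebraMap _ (RatFunc K) (polyPart f)) := by
  refine ⟨f.num % f.denom, f.denom, f.denom_ne_zero, EuclideanDomain.mod_lt _ f.denom_ne_zero, ?_⟩
  rw [eq_div_iff (RatFunc.algebraMap_ne_zero f.denom_ne_zero), sub_mul]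
  have hf : f * algebraMap _ (RatFunc K) f.denom = algebraMap _ (RatFunc K) f.num :=
    (div_eq_iff (RatFunc.algebraMap_ne_zero f.denom_ne_zero)).1 f.num_div_denom |>.symm
  rw [hf, ← map_mul, ← map_sub, polyPart]
  congr 1
  rw [sub_eq_iff_eq_add, mul_comm, add_comm]
  exact (EuclideanDomain.div_add_mod f.num f.denom).symm

/-- A polynomial that is also a proper fraction is zero. This characterisation gives the polynomial
part of sums and substitutions without computing a reduced fraction. -/
theorem polyPart_eq_of_isProper {f : RatFunc K} {P : K[X]}
    (h : IsProper (f - algebraMap _ (RatFunc K) P)) : polyPart f = P := by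
  have h1 := h.add ((isProper_sub_polyPart f).C_mul (-1))
  have h2 : polyPart f - P = 0 := by
    apply eq_zero_of_isProper_algebraMap
    convert h1 using 1
    simp
  exact sub_eq_zero.1 h2

theorem polyPart_add (f g : RatFunc K) : polyPart (f + g) = polyPart f + polyPart g := by
  apply polyPart_eq_of_isProper
  convert (isProper_sub_polyPart f).add (isProper_sub_polyPart g) using 1
  rw [map_add]; ring

theorem polyPart_C_mul (c : K) (f : RatFunc K) : polyPart (RatFunc.C c * f) = C c * polyPart f := by
  apply polyPart_eq_of_isProper
  convert (isProper_sub_polyPart f).C_mul c using 1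
  rw [map_mul, RatFunc.algebraMap_C]; ring

theorem polyPart_sub (f g : RatFunc K) : polyPart (f - g) = polyPart f - polyPart g := by
  have := polyPart_add f (RatFunc.C (-1) * g)
  rw [polyPart_C_mul] at this
  simpa [sub_eq_add_neg] using this

/-- Partial fractions read backwards; this is how `g` is built from a solution of the coefficient
systems. -/
theorem exists_ratFunc_of_data (P : K[X]) (S : Finset K) (M : ℕ) (d : ℕ → K → K) :
    ∃ g : RatFunc K, polyPart g = P ∧ (∀ k, 1 ≤ k → ∀ α ∈ S, k ≤ M → polarCoeff g k α = d k α) ∧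
      (∀ k, 1 ≤ k → ∀ α, α ∉ S ∨ M < k → polarCoeff g k α = 0) := by
  classical
  have key : ∀ k, 1 ≤ k → ∀ α, polarCoeff (algebraMap _ (RatFunc K) P + ∑ β ∈ S,
      ∑ s ∈ Finset.Icc 1 M, RatFunc.C (d s β) * (1 / (RatFunc.X - RatFunc.C β) ^ s)) k α =
      if α ∈ S ∧ k ≤ M then d k α else 0 := by
    intro k hk α
    rw [polarCoeff_add, polarCoeff_algebraMap _ _ hk, zero_add, polarCoeff_sum]
    simp_rw [polarCoeff_sum, polarCoeff_C_mul, polarCoeff_one_div_X_sub_C_pow α _ _ hk]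
    have : ∀ β ∈ S, (∑ s ∈ Finset.Icc 1 M, d s β * (if α = β ∧ k = s then (1 : K) else 0)) =
        if α = β then (if k ≤ M then d k α else 0) else 0 := by
      intro β _
      by_cases h : α = β
      · subst h
        simp [hk]
      · simp [h]
    rw [Finset.sum_congr rfl this]
    simp only [Finset.sum_ite_eq]
    split_ifs <;> first | rfl | tauto
  refine ⟨_, ?_, fun k hk α hα hM => (key k hk α).trans (if_pos ⟨hα, hM⟩), fun k hk α h =>
    (key k hk α).trans (if_neg ?_)⟩
  · apply polyPart_eq_of_isProper
    rw [add_sub_cancel_left]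
    refine IsProper.sum fun β _ => IsProper.sum fun s hs => IsProper.C_mul ?_ _
    exact isProper_one_div_X_sub_C_pow β (Finset.mem_Icc.1 hs).1
  · rintro ⟨h1, h2⟩
    rcases h with h | h
    · exact h h1
    · omega

/-- Over an algebraically closed field a nonconstant denominator has a root, hence a pole. Without
poles, `f` is its own polynomial part. -/
theorem ratFunc_eq_zero_of_parts [IsAlgClosed K] {f : RatFunc K} (h0 : polyPart f = 0)
    (h : ∀ k, 1 ≤ k → ∀ α, polarCoeff f k α = 0) : f = 0 := by
  have hd : f.denom.degree = 0 := by
    by_contra hd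
    obtain ⟨α, hα⟩ := IsAlgClosed.exists_root f.denom hd
    exact (poleOrder_eq_zero_iff_eval f α).1
      ((poleOrder_eq_zero_iff f α).2 fun k hk => h k hk α) hα
  have h1 : f.denom = 1 := (f.monic_denom).eq_one_of_isUnit (isUnit_iff_degree_eq_zero.2 hd)
  rw [polyPart, h1, EuclideanDomain.div_one] at h0
  rw [← RatFunc.num_eq_zero_iff]
  exact h0

end

section

variable {K : Type*} [Field K]

/-! ### The operator `f(x) ↦ f(x ^ q)` -/

/-- The endomorphism `f(x) ↦ f(x ^ q)` of `K(x)`, for `q ≥ 1`. -/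
def mahlerHom (q : ℕ) (hq : 0 < q) : RatFunc K →ₐ[K] RatFunc K :=
  RatFunc.mapAlgHom (Polynomial.expand K q) (by
    intro b hb
    rw [Submonoid.mem_comap, mem_nonZeroDivisors_iff_ne_zero]
    rw [mem_nonZeroDivisors_iff_ne_zero] at hb
    exact (Polynomial.expand_ne_zero hq).2 hb)

theorem mahlerHom_div (q : ℕ) (hq : 0 < q) (a b : K[X]) :
    mahlerHom q hq (algebraMap _ (RatFunc K) a / algebraMap _ (RatFunc K) b) =
      algebraMap _ (RatFunc K) (expand K q a) / algebraMap _ (RatFunc K) (expand K q b) := by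
  simp only [mahlerHom, RatFunc.coe_mapAlgHom_eq_coe_map]
  exact RatFunc.map_apply_div _ _ a b

theorem mahlerHom_algebraMap (q : ℕ) (hq : 0 < q) (a : K[X]) :
    mahlerHom q hq (algebraMap _ (RatFunc K) a) = algebraMap _ (RatFunc K) (expand K q a) := by
  simpa using mahlerHom_div q hq a 1

theorem mahlerHom_X (q : ℕ) (hq : 0 < q) : mahlerHom q hq (RatFunc.X : RatFunc K) = RatFunc.X ^ q := by
  rw [← RatFunc.algebraMap_X, mahlerHom_algebraMap]; simp

theorem mahlerHom_C (q : ℕ) (hq : 0 < q) (a : K) :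
    mahlerHom q hq (RatFunc.C a) = RatFunc.C a := by
  rw [← RatFunc.algebraMap_C, mahlerHom_algebraMap]; simp

theorem mahlerOp_eq (p : ℕ) (hp : 0 < p) (f : RatFunc K) : mahlerOp p f = mahlerHom p hp f := by
  have h : ∀ a : K[X], a.eval₂ RatFunc.C (RatFunc.X ^ p) = algebraMap _ (RatFunc K) (expand K p a) := by
    intro a
    rw [← mahlerHom_algebraMap p hp, ← mahlerHom_X p hp]
    induction a using Polynomial.induction_on' with
    | add a b ha hb => simp [ha, hb]
    | monomial n c =>
      rw [eval₂_monomial, ← C_mul_X_pow_eq_monomial, map_mul, map_mul, RatFunc.algebraMap_C,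
        mahlerHom_C, map_pow, map_pow, RatFunc.algebraMap_X]
  conv_rhs => rw [← f.num_div_denom, mahlerHom_div]
  rw [mahlerOp, RatFunc.eval, h, h]

theorem polarCoeff_mahlerHom_eq_zero (q : ℕ) (hq : 0 < q) {f : RatFunc K} {α : K}
    (hf : ∀ k, 1 ≤ k → polarCoeff f k (α ^ q) = 0) {k : ℕ} (hk : 1 ≤ k) :
    polarCoeff (mahlerHom q hq f) k α = 0 := by
  rw [← f.num_div_denom, mahlerHom_div]
  apply polarCoeff_div_of_eval_ne_zero _ _ _ hk
  rw [expand_eval]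
  exact (poleOrder_eq_zero_iff_eval f _).1 ((poleOrder_eq_zero_iff f _).2 hf)

/-- The principal part of `f(x ^ q)` at `α` only depends on the principal part of `f` at
`α ^ q`. -/
theorem polarCoeff_mahlerHom (q : ℕ) (hq : 0 < q) (f : RatFunc K) (α : K) (M : ℕ)
    (hM : ∀ k, M < k → polarCoeff f k (α ^ q) = 0) {k : ℕ} (hk : 1 ≤ k) :
    polarCoeff (mahlerHom q hq f) k α = ∑ s ∈ Finset.Icc 1 M, polarCoeff f s (α ^ q) *
      polarCoeff (1 / (RatFunc.X ^ q - RatFunc.C (α ^ q)) ^ s) k α := by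
  -- `g` is the principal part of `f` at `α ^ q`. The difference `f - g` has no pole there, so its
  -- image has no pole at `α`.
  set g : RatFunc K := ∑ s ∈ Finset.Icc 1 M, RatFunc.C (polarCoeff f s (α ^ q)) *
    (1 / (RatFunc.X - RatFunc.C (α ^ q)) ^ s) with hg
  have h1 : ∀ j, 1 ≤ j → polarCoeff (f - g) j (α ^ q) = 0 := by
    intro j hj
    rw [polarCoeff_sub, hg, polarCoeff_sum]
    simp_rw [polarCoeff_C_mul, polarCoeff_one_div_X_sub_C_pow _ _ _ hj]
    by_cases hjM : j ≤ M
    · simp [hj, hjM]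
    · rw [hM j (by omega)]
      simp [hj, hjM]
  have h2 := polarCoeff_mahlerHom_eq_zero q hq h1 hk
  rw [map_sub, polarCoeff_sub, sub_eq_zero] at h2
  rw [h2, hg, map_sum, polarCoeff_sum]
  refine Finset.sum_congr rfl fun s _ => ?_
  rw [map_mul, mahlerHom_C, polarCoeff_C_mul, map_div₀, map_one, map_pow, map_sub, mahlerHom_X,
    mahlerHom_C]

theorem polarCoeff_zero_mahlerHom (q : ℕ) (hq : 0 < q) (f : RatFunc K) {k : ℕ} (hk : 1 ≤ k) :
    polarCoeff (mahlerHom q hq f) k 0 = if q ∣ k then polarCoeff f (k / q) 0 else 0 := by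
  have h0 : (0 : K) ^ q = 0 := zero_pow hq.ne'
  -- Adding `k` to the pole order ensures that the index `k / q` lies in the range of summation.
  rw [polarCoeff_mahlerHom q hq f 0 (poleOrder f 0 + k)
    (fun j hj => polarCoeff_eq_zero_of_poleOrder_lt f _ (by rw [h0]; omega)) hk]
  have h1 : ∀ s, polarCoeff (1 / (RatFunc.X ^ q - RatFunc.C ((0 : K) ^ q)) ^ s) k 0 =
      if k = q * s then 1 else 0 := by
    intro s
    have := polarCoeff_one_div_X_sub_C_pow (0 : K) 0 (q * s) hk
    simp only [map_zero, sub_zero, true_and] at this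
    rw [h0, map_zero, sub_zero, ← pow_mul, this]
  simp_rw [h1, h0]
  split_ifs with h
  · obtain ⟨t, rfl⟩ := h
    have ht : 1 ≤ t := Nat.pos_of_ne_zero (by rintro rfl; simp at hk)
    have ht2 : t ≤ q * t := Nat.le_mul_of_pos_left t hq
    rw [Nat.mul_div_cancel_left _ hq, Finset.sum_eq_single t]
    · simp
    · intro s _ hs
      rw [if_neg, mul_zero]
      intro h
      exact hs (Nat.eq_of_mul_eq_mul_left hq h).symm
    · intro h
      exact absurd (Finset.mem_Icc.2 ⟨ht, by omega⟩) h
  · refine Finset.sum_eq_zero fun s _ => ?_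
    rw [if_neg, mul_zero]
    rintro rfl
    exact h ⟨s, rfl⟩

theorem polyPart_mahlerHom (q : ℕ) (hq : 0 < q) (f : RatFunc K) :
    polyPart (mahlerHom q hq f) = expand K q (polyPart f) := by
  apply polyPart_eq_of_isProper
  rw [← mahlerHom_algebraMap q hq, ← map_sub]
  obtain ⟨a, b, hb, hab, h⟩ := isProper_sub_polyPart f
  rw [h, mahlerHom_div]
  refine ⟨_, _, (expand_ne_zero hq).2 hb, ?_, rfl⟩
  rcases eq_or_ne a 0 with rfl | ha
  · rw [map_zero, degree_zero, bot_lt_iff_ne_bot, degree_ne_bot]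
    exact (expand_ne_zero hq).2 hb
  · rw [degree_eq_natDegree ((expand_ne_zero hq).2 ha),
      degree_eq_natDegree ((expand_ne_zero hq).2 hb), natDegree_expand, natDegree_expand]
    rw [degree_eq_natDegree ha, degree_eq_natDegree hb] at hab
    norm_cast at hab ⊢
    exact Nat.mul_lt_mul_of_pos_right hab hq

/-! ### The Laurent polynomial component -/

theorem laurentPolyCoeff_natCast (f : RatFunc K) (j : ℕ) :
    laurentPolyCoeff f (j : ℤ) = (polyPart f).coeff j := by
  simp [laurentPolyCoeff, polyPart]

theorem laurentPolyCoeff_neg (f : RatFunc K) {j : ℕ} (hj : 1 ≤ j) :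
    laurentPolyCoeff f (-(j : ℤ)) = polarCoeff f j 0 := by
  rw [laurentPolyCoeff, if_neg (by omega)]
  simp

theorem laurentPolyCoeff_sub (f g : RatFunc K) (j : ℤ) :
    laurentPolyCoeff (f - g) j = laurentPolyCoeff f j - laurentPolyCoeff g j := by
  have := polyPart_sub f g
  simp only [polyPart] at this
  rw [laurentPolyCoeff, laurentPolyCoeff, laurentPolyCoeff, this]
  split_ifs
  · simp
  · rw [polarCoeff_sub]

theorem laurentPolyCoeff_C_mul (a : K) (f : RatFunc K) (j : ℤ) :
    laurentPolyCoeff (RatFunc.C a * f) j = a * laurentPolyCoeff f j := by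
  have := polyPart_C_mul a f
  simp only [polyPart] at this
  rw [laurentPolyCoeff, laurentPolyCoeff, this]
  split_ifs
  · simp
  · rw [polarCoeff_C_mul]

theorem laurentPolyCoeff_mahlerHom (q : ℕ) (hq : 0 < q) (f : RatFunc K) (j : ℤ) :
    laurentPolyCoeff (mahlerHom q hq f) j =
      if (q : ℤ) ∣ j then laurentPolyCoeff f (j / q) else 0 := by
  rcases le_or_gt 0 j with h | h
  · lift j to ℕ using h
    rw [laurentPolyCoeff_natCast, polyPart_mahlerHom, coeff_expand hq, ← Int.natCast_div,
      laurentPolyCoeff_natCast]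
    simp only [Int.natCast_dvd_natCast]
  · obtain ⟨k, rfl⟩ : ∃ k : ℕ, j = -(k : ℤ) := ⟨j.natAbs, by omega⟩
    have hk : 1 ≤ k := by omega
    rw [laurentPolyCoeff_neg _ hk, polarCoeff_zero_mahlerHom q hq f hk]
    simp only [dvd_neg, Int.natCast_dvd_natCast]
    split_ifs with h1
    · obtain ⟨t, rfl⟩ := h1
      have ht : 1 ≤ t := Nat.pos_of_ne_zero (by rintro rfl; simp at hk)
      rw [Nat.mul_div_cancel_left _ hq, ← laurentPolyCoeff_neg _ ht]
      congr 1
      push_cast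
      rw [← mul_neg, Int.mul_ediv_cancel_left _ (by omega)]
    · rfl

theorem finite_laurentPolyCoeff (f : RatFunc K) : {j : ℤ | laurentPolyCoeff f j ≠ 0}.Finite := by
  refine (Set.finite_Icc (-(poleOrder f 0 : ℤ)) (polyPart f).natDegree).subset fun j hj => ?_
  simp only [Set.mem_ofPred_eq] at hj
  rcases le_or_gt 0 j with h | h
  · lift j to ℕ using h
    rw [laurentPolyCoeff_natCast] at hj
    have := le_natDegree_of_ne_zero hj
    simp only [Set.mem_Icc]
    omega
  · obtain ⟨k, rfl⟩ : ∃ k : ℕ, j = -(k : ℤ) := ⟨j.natAbs, by omega⟩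
    rw [laurentPolyCoeff_neg _ (by omega)] at hj
    have : k ≤ poleOrder f 0 := by
      by_contra h'
      exact hj (polarCoeff_eq_zero_of_poleOrder_lt f _ (by omega))
    simp only [Set.mem_Icc]
    omega

/-! ### Mahler coefficients -/

theorem polarCoeff_mahlerHom_pow (p : ℕ) (hp : 0 < p) (n : ℕ) (f : RatFunc K) (α : K) (M : ℕ)
    (hM : ∀ k, M < k → polarCoeff f k (α ^ p ^ n) = 0) {k : ℕ} (hk : 1 ≤ k) :
    polarCoeff (mahlerHom (p ^ n) (pow_pos hp n) f) k α =
      ∑ s ∈ Finset.Icc 1 M, mahlerCoeff p s k n α * polarCoeff f s (α ^ p ^ n) := by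
  rw [polarCoeff_mahlerHom _ _ f α M hM hk]
  exact Finset.sum_congr rfl fun s _ => mul_comm _ _

/-- `1 + (1 + X) + ⋯ + (1 + X) ^ (q - 1)`, the Taylor expansion of `1 + x + ⋯ + x ^ (q - 1)` at `1`. -/
def geomSeriesAtOne (K : Type*) [Field K] (q : ℕ) : PowerSeries K :=
  ∑ i ∈ Finset.range q, (1 + PowerSeries.X) ^ i

theorem constantCoeff_geomSeriesAtOne (q : ℕ) :
    PowerSeries.constantCoeff (geomSeriesAtOne K q) = q := by
  simp [geomSeriesAtOne]

/-- By homogeneity: `X + α = α (1 + α⁻¹ X)`, so every term acquires the same factor `α ^ (q - 1)`,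
and what is left is the expansion at `1` with `X` rescaled. -/
theorem taylor_geom_sum (α : K) (hα : α ≠ 0) (q : ℕ) :
    ((taylor α (∑ i ∈ Finset.range q, X ^ i * C α ^ (q - 1 - i)) : K[X]) : PowerSeries K) =
      PowerSeries.C (α ^ (q - 1)) * PowerSeries.rescale α⁻¹ (geomSeriesAtOne K q) := by
  rw [geomSeriesAtOne, map_sum, map_sum, Finset.mul_sum, ← Polynomial.coeToPowerSeries.ringHom_apply,
    map_sum]
  refine Finset.sum_congr rfl fun i hi => ?_
  have hi := Finset.mem_range.1 hi
  rw [Polynomial.coeToPowerSeries.ringHom_apply, taylor_mul, taylor_pow, taylor_pow, taylor_X,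
    taylor_C, map_pow (PowerSeries.rescale α⁻¹), map_add, map_one, PowerSeries.rescale_X]
  simp only [Polynomial.coe_mul, Polynomial.coe_pow, Polynomial.coe_add, Polynomial.coe_X,
    Polynomial.coe_C]
  have e1 : (PowerSeries.X + PowerSeries.C α : PowerSeries K) =
      PowerSeries.C α * (1 + PowerSeries.C α⁻¹ * PowerSeries.X) := by
    rw [mul_add, ← mul_assoc, ← map_mul, mul_inv_cancel₀ hα, map_one]; ring
  rw [e1, mul_pow, map_pow]
  have : q - 1 = i + (q - 1 - i) := by omega
  conv_rhs => rw [this, pow_add]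
  ring

variable [CharZero K]

theorem map_inv_pow_geomSeriesAtOne {q : ℕ} (hq : 0 < q) (m : ℕ) :
    PowerSeries.map (algebraMap ℚ K) ((geomSeriesAtOne ℚ q)⁻¹ ^ m) =
      (geomSeriesAtOne K q ^ m)⁻¹ := by
  have h1 : PowerSeries.map (algebraMap ℚ K) (geomSeriesAtOne ℚ q) = geomSeriesAtOne K q := by
    simp [geomSeriesAtOne]
  symm
  rw [PowerSeries.inv_eq_iff_mul_eq_one]
  · rw [← h1, ← map_pow, ← map_mul, ← mul_pow, PowerSeries.inv_mul_cancel]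
    · simp
    · rw [constantCoeff_geomSeriesAtOne]; exact_mod_cast hq.ne'
  · rw [map_pow, constantCoeff_geomSeriesAtOne]
    exact pow_ne_zero _ (by exact_mod_cast hq.ne')

/-- Write `x ^ q - α ^ q = (x - α) G`. The coefficient is the one of degree `m - k` in the expansion
of `G ^ (-m)` at `α`, and homogeneity moves `α` to `1`. The exponent is `-(q - 1) m - (m - k) = k -
m q`. -/
theorem mahlerCoeff_eq (p : ℕ) (hp : 0 < p) (m k n : ℕ) {α : K} (hα : α ≠ 0) :
    mahlerCoeff p m k n α = if k ≤ m then ((univMahlerCoeff p m k n : ℚ) : K) *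
      α ^ ((k : ℤ) - (m : ℤ) * (p : ℤ) ^ n) else 0 := by
  set q := p ^ n with hqdef
  have hq : 0 < q := pow_pos hp n
  have hq0 : (q : K) ≠ 0 := by exact_mod_cast hq.ne'
  set G : K[X] := ∑ i ∈ Finset.range q, X ^ i * C α ^ (q - 1 - i) with hG
  have hfac : (X ^ q - C (α ^ q) : K[X]) = (X - C α) * G := by
    rw [map_pow, hG, ← (Commute.all (X : K[X]) (C α)).mul_geom_sum₂]
  have hGe : G.eval α ≠ 0 := by
    have : G.eval α = q * α ^ (q - 1) := by
      rw [hG, eval_finsetSum, Finset.sum_congr rfl (g := fun _ => α ^ (q - 1))]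
      · simp
      · intro i hi
        have hi := Finset.mem_range.1 hi
        simp only [eval_mul, eval_pow, eval_X, eval_C]
        rw [← pow_add]
        congr 1
        omega
    rw [this]
    exact mul_ne_zero hq0 (pow_ne_zero _ hα)
  have e : (1 / (RatFunc.X ^ q - RatFunc.C (α ^ q)) ^ m : RatFunc K) =
      algebraMap _ (RatFunc K) (1 : K[X]) / algebraMap _ (RatFunc K) ((X - C α) ^ m * G ^ m) := by
    rw [← mul_pow, ← hfac]
    simp
  rw [mahlerCoeff, ← hqdef, e, polarCoeff_div _ _ _ (by rw [eval_pow]; exact pow_ne_zero _ hGe)]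
  by_cases hkm : k ≤ m
  swap
  · rw [if_neg hkm, if_neg hkm]
  rw [if_pos hkm, if_pos hkm]
  have hinv : (((taylor α (G ^ m) : K[X]) : PowerSeries K))⁻¹ =
      PowerSeries.C ((α ^ (q - 1))⁻¹ ^ m) *
        PowerSeries.rescale α⁻¹ ((geomSeriesAtOne K q ^ m)⁻¹) := by
    rw [PowerSeries.inv_eq_iff_mul_eq_one, taylor_pow, Polynomial.coe_pow, hG, taylor_geom_sum _ hα,
      mul_pow, ← map_pow, ← map_pow, mul_mul_mul_comm, ← map_mul, ← map_mul,
      PowerSeries.inv_mul_cancel, map_one, mul_one, ← mul_pow,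
      inv_mul_cancel₀ (pow_ne_zero _ hα), one_pow, map_one]
    · rw [map_pow, constantCoeff_geomSeriesAtOne]; exact pow_ne_zero _ hq0
    · rw [Polynomial.constantCoeff_coe, taylor_coeff_zero, eval_pow]
      exact pow_ne_zero _ hGe
  rw [hinv, taylor_one, map_one, Polynomial.coe_one, one_mul, PowerSeries.coeff_C_mul,
    PowerSeries.coeff_rescale, ← map_inv_pow_geomSeriesAtOne hq, PowerSeries.coeff_map,
    univMahlerCoeff, eq_ratCast]
  have hz : (α ^ (q - 1))⁻¹ ^ m * α⁻¹ ^ (m - k) = α ^ ((k : ℤ) - (m : ℤ) * (p : ℤ) ^ n) := by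
    rw [← inv_pow, ← pow_mul, ← pow_add, inv_pow, ← zpow_natCast, ← zpow_neg]
    congr 1
    push_cast [hkm, Nat.cast_sub hq]
    rw [hqdef]
    push_cast
    ring
  rw [← mul_assoc, hz, mul_comm]
  rfl

theorem univMahlerCoeff_self (p : ℕ) (k n : ℕ) :
    univMahlerCoeff p k k n = ((p : ℚ) ^ n)⁻¹ ^ k := by
  have := constantCoeff_geomSeriesAtOne (K := ℚ) (p ^ n)
  rw [geomSeriesAtOne] at this
  rw [univMahlerCoeff, Nat.sub_self, PowerSeries.coeff_zero_eq_constantCoeff_apply, map_pow,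
    PowerSeries.constantCoeff_inv, this]
  push_cast
  rfl

/-- The substitution `x ↦ x ^ (p ^ a)` turns the fraction for `b` at `β = α ^ (p ^ a)` into the
fraction for `a + b` at `α`; compare principal parts. -/
theorem mahlerCoeff_comp (p : ℕ) (hp : 0 < p) (a b : ℕ) {α : K} (hα : α ≠ 0) {k s : ℕ}
    (hk : 1 ≤ k) :
    mahlerCoeff p s k (a + b) α =
      ∑ j ∈ Finset.Icc k s, mahlerCoeff p j k a α * mahlerCoeff p s j b (α ^ p ^ a) := by
  set β := α ^ p ^ a with hβ
  have hβ0 : β ≠ 0 := pow_ne_zero _ hα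
  have h1 := polarCoeff_mahlerHom_pow p hp a
    (1 / (RatFunc.X ^ p ^ b - RatFunc.C (β ^ p ^ b)) ^ s) α s (fun j hj => by
      have := mahlerCoeff_eq p hp s j b hβ0
      rw [if_neg (by omega)] at this
      exact this) hk
  have e : mahlerHom (p ^ a) (pow_pos hp a)
      (1 / (RatFunc.X ^ p ^ b - RatFunc.C (β ^ p ^ b)) ^ s) =
      (1 / (RatFunc.X ^ p ^ (a + b) - RatFunc.C (α ^ p ^ (a + b))) ^ s : RatFunc K) := by
    rw [map_div₀, map_one, map_pow, map_sub, map_pow, mahlerHom_X, mahlerHom_C, ← pow_mul,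
      ← pow_add, hβ, ← pow_mul, ← pow_add]
  rw [e] at h1
  rw [mahlerCoeff, h1]
  symm
  apply Finset.sum_subset
  · exact Finset.Icc_subset_Icc_left hk
  · intro j hj hj'
    rw [mahlerCoeff_eq p hp j k a hα, if_neg, zero_mul]
    simp only [Finset.mem_Icc] at hj hj'
    omega

end

section

variable {K : Type*} [Field K]

/-! ### The twisted Mahler operator on families of polar coefficients -/

/-- The action of `(p ^ lam * σ) ^ n` on families `(d_k(α))` of polar coefficients with `d_k = 0`
for `k > M`. -/
def twist (p : ℕ) (lam : ℤ) (M n : ℕ) (d : ℕ → Kˣ → K) : ℕ → Kˣ → K := fun k α =>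
  (p : K) ^ (lam * (n : ℤ)) *
    ∑ s ∈ Finset.Icc k M, mahlerCoeff p s k n (α : K) * d s (α ^ p ^ n)

section Twist

variable (p : ℕ) (lam : ℤ) (M n : ℕ)

theorem twist_add (d d' : ℕ → Kˣ → K) (k : ℕ) (α : Kˣ) :
    twist p lam M n (d + d') k α = twist p lam M n d k α + twist p lam M n d' k α := by
  simp only [twist, Pi.add_apply, mul_add, Finset.sum_add_distrib]

theorem twist_sub (d d' : ℕ → Kˣ → K) (k : ℕ) (α : Kˣ) :
    twist p lam M n (d - d') k α = twist p lam M n d k α - twist p lam M n d' k α := by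
  simp only [twist, Pi.sub_apply, mul_sub, Finset.sum_sub_distrib]

theorem twist_smul (a : K) (d : ℕ → Kˣ → K) (k : ℕ) (α : Kˣ) :
    twist p lam M n (a • d) k α = a * twist p lam M n d k α := by
  simp only [twist, Pi.smul_apply, smul_eq_mul, Finset.mul_sum]
  exact Finset.sum_congr rfl fun s _ => by ring

theorem twist_sum {ι : Type*} (S : Finset ι) (d : ι → ℕ → Kˣ → K) (k : ℕ) (α : Kˣ) :
    twist p lam M n (∑ i ∈ S, d i) k α = ∑ i ∈ S, twist p lam M n (d i) k α := by
  simp only [twist, Finset.sum_apply, Finset.mul_sum]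
  exact Finset.sum_comm

variable {p lam M n}

theorem twist_congr {d d' : ℕ → Kˣ → K} {k : ℕ} {α : Kˣ}
    (h : ∀ s, k ≤ s → s ≤ M → d s (α ^ p ^ n) = d' s (α ^ p ^ n)) :
    twist p lam M n d k α = twist p lam M n d' k α := by
  simp only [twist]
  congr 1
  refine Finset.sum_congr rfl fun s hs => ?_
  rw [h s (Finset.mem_Icc.1 hs).1 (Finset.mem_Icc.1 hs).2]

theorem twist_eq_zero {d : ℕ → Kˣ → K} {k : ℕ} {α : Kˣ}
    (h : ∀ s, k ≤ s → s ≤ M → d s (α ^ p ^ n) = 0) : twist p lam M n d k α = 0 := by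
  rw [twist_congr (d' := 0) h]
  simp [twist]

theorem twist_of_lt {d : ℕ → Kˣ → K} {k : ℕ} {α : Kˣ} (h : M < k) :
    twist p lam M n d k α = 0 :=
  twist_eq_zero fun s h1 h2 => by omega

theorem mahlerCoeff_zero_right (s : ℕ) {k : ℕ} (hk : 1 ≤ k) (α : K) :
    mahlerCoeff p s k 0 α = if k = s then 1 else 0 := by
  have := polarCoeff_one_div_X_sub_C_pow α α s hk
  simpa [mahlerCoeff] using this

theorem twist_zero {d : ℕ → Kˣ → K} {k : ℕ} {α : Kˣ} (hk : 1 ≤ k) (hkM : k ≤ M) :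
    twist p lam M 0 d k α = d k α := by
  simp [twist, mahlerCoeff_zero_right _ hk, hkM]

theorem twist_mono {d : ℕ → Kˣ → K} {k M' : ℕ} {α : Kˣ} (hM : M ≤ M')
    (h : ∀ s, M < s → d s (α ^ p ^ n) = 0) :
    twist p lam M n d k α = twist p lam M' n d k α := by
  simp only [twist]
  congr 1
  apply Finset.sum_subset (Finset.Icc_subset_Icc_right hM)
  intro s hs hs'
  rw [h s, mul_zero]
  simp only [Finset.mem_Icc] at hs hs'
  omega

variable [CharZero K]

/-- The truncation at `M` is compatible with composition because the Mahler coefficients are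
triangular: only indices `k ≤ j ≤ s ≤ M` contribute. -/
theorem twist_twist (hp : 0 < p) (a b : ℕ) (d : ℕ → Kˣ → K) {k : ℕ} (hk : 1 ≤ k) (α : Kˣ) :
    twist p lam M a (twist p lam M b d) k α = twist p lam M (a + b) d k α := by
  have hp0 : (p : K) ≠ 0 := by exact_mod_cast hp.ne'
  simp only [twist]
  have e : (p : K) ^ (lam * ((a + b : ℕ) : ℤ)) = (p : K) ^ (lam * (a : ℤ)) * (p : K) ^ (lam * (b : ℤ)) := by
    rw [← zpow_add₀ hp0]; congr 1; push_cast; ring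
  rw [e, mul_assoc]
  congr 1
  rw [Finset.mul_sum]
  have h1 : ∀ s ∈ Finset.Icc k M, (p : K) ^ (lam * (b : ℤ)) *
      (mahlerCoeff p s k (a + b) (α : K) * d s (α ^ p ^ (a + b))) =
      ∑ j ∈ Finset.Icc k M, if j ≤ s then mahlerCoeff p j k a (α : K) * ((p : K) ^ (lam * (b : ℤ)) *
        (mahlerCoeff p s j b ((α : K) ^ p ^ a) * d s (α ^ p ^ (a + b)))) else 0 := by
    intro s hs
    rw [mahlerCoeff_comp p hp a b α.ne_zero hk, Finset.sum_mul, Finset.mul_sum,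
      ← Finset.sum_filter]
    have : Finset.filter (fun j => j ≤ s) (Finset.Icc k M) = Finset.Icc k s := by
      ext j
      simp only [Finset.mem_filter, Finset.mem_Icc] at hs ⊢
      omega
    rw [this]
    exact Finset.sum_congr rfl fun j _ => by ring
  rw [Finset.sum_congr rfl h1, Finset.sum_comm]
  refine Finset.sum_congr rfl fun j hj => ?_
  rw [← Finset.sum_filter, Finset.mul_sum, Finset.mul_sum]
  have : Finset.filter (fun s => j ≤ s) (Finset.Icc k M) = Finset.Icc j M := by
    ext s
    simp only [Finset.mem_filter, Finset.mem_Icc] at hj ⊢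
    omega
  rw [this]
  refine Finset.sum_congr rfl fun s _ => ?_
  rw [← pow_mul, ← pow_add]
  simp only [Units.val_pow_eq_pow_val]

/-- Descending induction on `k`: the system is triangular, and its diagonal entries are powers of
`p` and `α` up to sign of the exponent, hence nonzero in characteristic `0`. -/
theorem twist_injective (hp : 0 < p) {d : ℕ → Kˣ → K} {α : Kˣ}
    (h : ∀ k, 1 ≤ k → k ≤ M → twist p lam M n d k α = 0) :
    ∀ k, 1 ≤ k → k ≤ M → d k (α ^ p ^ n) = 0 := by
  have hp0 : (p : K) ≠ 0 := by exact_mod_cast hp.ne'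
  have key : ∀ i k, M - k = i → 1 ≤ k → k ≤ M → d k (α ^ p ^ n) = 0 := by
    intro i
    induction i using Nat.strong_induction_on with
    | _ i ih =>
      intro k hi hk hkM
      have h1 := h k hk hkM
      rw [twist, Finset.sum_eq_single_of_mem k (Finset.mem_Icc.2 ⟨le_rfl, hkM⟩)] at h1
      · have h2 : mahlerCoeff p k k n (α : K) ≠ 0 := by
          rw [mahlerCoeff_eq p hp _ _ _ α.ne_zero, if_pos le_rfl, univMahlerCoeff_self]
          refine mul_ne_zero ?_ (zpow_ne_zero _ α.ne_zero)
          push_cast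
          positivity
        rcases mul_eq_zero.1 h1 with h3 | h3
        · exact absurd h3 (zpow_ne_zero _ hp0)
        · exact (mul_eq_zero.1 h3).resolve_left h2
      · intro s hs hsk
        have hs := Finset.mem_Icc.1 hs
        rw [ih (M - s) (by omega) s rfl (by omega) hs.2, mul_zero]
  exact fun k => key _ k rfl

/-- The sum `∑ T ^ n (T d - d)` telescopes. -/
theorem sum_twist_of_eq (hp : 0 < p) (H : ℕ) {c d : ℕ → Kˣ → K} {α : Kˣ}
    (h : ∀ n < H, ∀ k, 1 ≤ k → k ≤ M →
      c k (α ^ p ^ n) = twist p lam M 1 d k (α ^ p ^ n) - d k (α ^ p ^ n))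
    {k : ℕ} (hk : 1 ≤ k) (hkM : k ≤ M) :
    ∑ n ∈ Finset.range H, twist p lam M n c k α = twist p lam M H d k α - d k α := by
  have h1 : ∀ n ∈ Finset.range H, twist p lam M n c k α =
      twist p lam M (n + 1) d k α - twist p lam M n d k α := by
    intro n hn
    rw [← twist_twist hp _ _ _ hk, ← twist_sub]
    exact twist_congr fun s hs hsM => h n (Finset.mem_range.1 hn) s (by omega) hsM
  rw [Finset.sum_congr rfl h1, Finset.sum_range_sub (fun n => twist p lam M n d k α),
    twist_zero hk hkM]

end Twist

/-! ### Summability in terms of coefficients -/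

section Reduction

variable {p : ℕ} {lam : ℤ}

theorem coeffVec_eq_zero_of_natDegree_lt (f : RatFunc K) {k : ℕ} (hk : f.denom.natDegree < k)
    (α : Kˣ) : coeffVec f k α = 0 :=
  polarCoeff_eq_zero_of_poleOrder_lt f _ ((poleOrder_le f _).trans_lt hk)

theorem coeffVec_mahlerHom (hp : 0 < p) (g : RatFunc K) [CharZero K] {M : ℕ}
    (hM : ∀ k α, M < k → coeffVec g k α = 0) {k : ℕ} (hk : 1 ≤ k) (α : Kˣ) :
    (p : K) ^ lam * polarCoeff (mahlerHom p hp g) k α = twist p lam M 1 (coeffVec g) k α := by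
  have h := polarCoeff_mahlerHom_pow p hp 1 g (α : K) M (fun j hj => by
    have := hM j (α ^ p ^ 1) hj
    rwa [coeffVec, Units.val_pow_eq_pow_val] at this) hk
  simp only [pow_one] at h
  rw [twist, h]
  simp only [Nat.cast_one, mul_one]
  congr 1
  rw [← Finset.sum_subset (Finset.Icc_subset_Icc_left hk)]
  · simp [coeffVec]
  · intro j hj hj'
    rw [mahlerCoeff_eq p hp j k 1 α.ne_zero, if_neg, zero_mul]
    simp only [Finset.mem_Icc] at hj hj'
    omega

theorem natCast_zpow_eq_C (p : ℕ) (lam : ℤ) : ((p : RatFunc K)) ^ lam = RatFunc.C ((p : K) ^ lam) := by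
  rw [map_zpow₀, map_natCast]

theorem finite_coeffVec (f : RatFunc K) : {α : Kˣ | ∃ k, 1 ≤ k ∧ coeffVec f k α ≠ 0}.Finite := by
  refine ((finite_poles f).preimage (f := fun α : Kˣ => (α : K)) Units.val_injective.injOn).subset ?_
  rintro α ⟨k, hk, h⟩
  simp only [Set.mem_preimage, Set.mem_ofPred_eq]
  exact fun h0 => h ((poleOrder_eq_zero_iff f _).1 h0 k hk)

variable [CharZero K]

/-- The truncation bound is left free above `M₀` so that it can later be enlarged past the pole
orders of `f` and past `lam`. -/
theorem IsMahlerSummable.exists_coeff (hp : 0 < p) {f : RatFunc K} (hf : IsMahlerSummable p lam f) :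
    (∃ a : ℤ → K, {j | a j ≠ 0}.Finite ∧ ∀ j, laurentPolyCoeff f j =
      (p : K) ^ lam * (if (p : ℤ) ∣ j then a (j / p) else 0) - a j) ∧
    ∃ (d : ℕ → Kˣ → K) (M₀ : ℕ), {α | ∃ k, 1 ≤ k ∧ d k α ≠ 0}.Finite ∧
      ∀ M, M₀ ≤ M → ∀ k α, 1 ≤ k → coeffVec f k α = twist p lam M 1 d k α - d k α := by
  obtain ⟨g, hg⟩ := hf
  rw [natCast_zpow_eq_C, mahlerOp_eq p hp] at hg
  refine ⟨⟨laurentPolyCoeff g, finite_laurentPolyCoeff g, fun j => ?_⟩,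
    coeffVec g, g.denom.natDegree, finite_coeffVec g, ?_⟩
  · rw [hg, laurentPolyCoeff_sub, laurentPolyCoeff_C_mul, laurentPolyCoeff_mahlerHom]
  · intro M hM k α hk
    rw [← coeffVec_mahlerHom hp g (fun j β hj => coeffVec_eq_zero_of_natDegree_lt g
      (hM.trans_lt hj) β) hk, ← polarCoeff_C_mul]
    conv_lhs => rw [coeffVec, hg, polarCoeff_sub]
    rfl

theorem isMahlerSummable_of_coeff [IsAlgClosed K] (hp : 0 < p) {f : RatFunc K} (a : ℤ → K)
    (ha : {j | a j ≠ 0}.Finite)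
    (haf : ∀ j, laurentPolyCoeff f j =
      (p : K) ^ lam * (if (p : ℤ) ∣ j then a (j / p) else 0) - a j)
    (d : ℕ → Kˣ → K) (M : ℕ) (hd : {α | ∃ k, 1 ≤ k ∧ d k α ≠ 0}.Finite)
    (hdM : ∀ k α, M < k → d k α = 0)
    (hdf : ∀ k α, 1 ≤ k → coeffVec f k α = twist p lam M 1 d k α - d k α) :
    IsMahlerSummable p lam f := by
  classical
  obtain ⟨N, hN⟩ : ∃ N : ℕ, ∀ j, a j ≠ 0 → j.natAbs ≤ N := by
    obtain ⟨N, hN⟩ := (ha.image Int.natAbs).bddAbove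
    exact ⟨N, fun j hj => hN ⟨j, hj, rfl⟩⟩
  -- The point `0` is included because the negative Laurent coefficients `a (-k)` are realised as
  -- polar coefficients at `0`.
  set S : Finset K := insert 0 (hd.toFinset.image (fun α : Kˣ => (α : K))) with hS
  obtain ⟨g, hgP, hg1, hg2⟩ := exists_ratFunc_of_data
    (∑ j ∈ Finset.range (N + 1), C (a j) * X ^ j) S (max M N)
    (fun k α => if h : α = 0 then a (-k) else d k (Units.mk0 α h))
  have hgc : ∀ k (α : Kˣ), 1 ≤ k → coeffVec g k α = d k α := by
    intro k α hk
    by_cases hα : (α : K) ∈ S ∧ k ≤ max M N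
    · rw [coeffVec, hg1 k hk _ hα.1 hα.2, dif_neg α.ne_zero, Units.mk0_val]
    · rw [coeffVec, hg2 k hk _ (by rwa [not_and_or, not_le] at hα)]
      by_contra h
      apply hα
      refine ⟨?_, ?_⟩
      · rw [hS]
        refine Finset.mem_insert_of_mem (Finset.mem_image_of_mem _ ?_)
        rw [Set.Finite.mem_toFinset]
        exact ⟨k, hk, fun h' => h h'.symm⟩
      · by_contra h'
        exact h (hdM k α (by omega)).symm
  have hga : ∀ j, laurentPolyCoeff g j = a j := by
    intro j
    rcases le_or_gt 0 j with h | h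
    · lift j to ℕ using h
      rw [laurentPolyCoeff_natCast, hgP]
      simp only [finsetSum_coeff, coeff_C_mul, coeff_X_pow, mul_ite, mul_one, mul_zero,
        Finset.sum_ite_eq, Finset.mem_range]
      split_ifs with h1
      · rfl
      · by_contra h2
        have := hN j (fun h => h2 h.symm)
        simp at this
        omega
    · obtain ⟨k, rfl⟩ : ∃ k : ℕ, j = -(k : ℤ) := ⟨j.natAbs, by omega⟩
      have hk : 1 ≤ k := by omega
      rw [laurentPolyCoeff_neg _ hk]
      by_cases h1 : k ≤ max M N
      · rw [hg1 k hk 0 (by simp [hS]) h1, dif_pos rfl]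
      · rw [hg2 k hk 0 (Or.inr (by omega))]
        by_contra h2
        have := hN _ (fun h => h2 h.symm)
        simp at this
        omega
  refine ⟨g, ?_⟩
  rw [natCast_zpow_eq_C, mahlerOp_eq p hp, ← sub_eq_zero]
  have hl : ∀ j, laurentPolyCoeff (f - (RatFunc.C ((p : K) ^ lam) * mahlerHom p hp g - g)) j = 0 := by
    intro j
    rw [laurentPolyCoeff_sub, laurentPolyCoeff_sub, laurentPolyCoeff_C_mul,
      laurentPolyCoeff_mahlerHom, haf, hga, hga, sub_self]
  apply ratFunc_eq_zero_of_parts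
  · ext j
    rw [← laurentPolyCoeff_natCast, hl, coeff_zero]
  · intro k hk α
    rcases eq_or_ne α 0 with rfl | hα
    · rw [← laurentPolyCoeff_neg _ hk, hl]
    · lift α to Kˣ using hα.isUnit
      rw [polarCoeff_sub, polarCoeff_sub, polarCoeff_C_mul,
        coeffVec_mahlerHom (M := max M N) hp g _ hk, sub_eq_zero]
      · have h1 := hdf k α hk
        rw [coeffVec] at h1
        rw [h1, twist_mono (le_max_left M N) (fun s hs => hdM s _ hs)]
        congr 1
        · exact twist_congr fun s hs _ => (hgc s _ (by omega)).symm
        · exact (hgc k α hk).symm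
      · intro j β hj
        rcases Nat.eq_zero_or_pos j with h0 | h0
        · omega
        · rw [hgc j β h0, hdM]
          omega

end Reduction

end

section

variable {K : Type*} [Field K]

/-! ### The residue at infinity -/

section Infinity

variable {p : ℕ} {lam : ℤ}

theorem natCast_zpow_eq_one_iff [CharZero K] (hp : 2 ≤ p) (n : ℤ) : (p : K) ^ n = 1 ↔ n = 0 := by
  have key : ∀ n : ℕ, (p : K) ^ n = 1 ↔ n = 0 := by
    intro n
    rw [← Nat.cast_pow, Nat.cast_eq_one, Nat.pow_eq_one]
    omega
  rcases Int.eq_nat_or_neg n with ⟨m, rfl | rfl⟩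
  · rw [zpow_natCast, key]; simp
  · rw [zpow_neg, inv_eq_one, zpow_natCast, key]; simp

theorem int_mul_pow_injective (hp : 2 ≤ p) {i : ℤ} (hi : i ≠ 0) :
    Function.Injective (fun n : ℕ => i * (p : ℤ) ^ n) := by
  intro a b h
  have h1 : (p : ℤ) ^ a = (p : ℤ) ^ b := mul_left_cancel₀ hi h
  exact Nat.pow_right_injective hp (by exact_mod_cast h1)

theorem bddAbove_trajectory (hp : 2 ≤ p) (f : RatFunc K) {i : ℤ} (hi : i ≠ 0) :
    BddAbove {h : ℕ | laurentPolyCoeff f (i * (p : ℤ) ^ h) ≠ 0} :=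
  ((finite_laurentPolyCoeff f).preimage (int_mul_pow_injective hp hi).injOn).bddAbove

theorem laurentPolyCoeff_of_trajHeight_lt (hp : 2 ≤ p) (f : RatFunc K) {i : ℤ} (hi : i ≠ 0) {n : ℕ}
    (hn : trajHeight p f i < n) : laurentPolyCoeff f (i * (p : ℤ) ^ n) = 0 := by
  by_contra h
  exact absurd (le_csSup (bddAbove_trajectory hp f hi) h) (not_le.2 hn)

/-- Since `p ∤ i`, the equation at `i` gives the initial value, and the equation at `i p ^ (n + 1)`
gives each value from the preceding one. -/
theorem trajectory_solution [CharZero K] (hp : 2 ≤ p) {c a : ℤ → K}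
    (h : ∀ j, j ≠ 0 → c j = (p : K) ^ lam * (if (p : ℤ) ∣ j then a (j / p) else 0) - a j)
    {i : ℤ} (hi0 : i ≠ 0) (hi : ¬ (p : ℤ) ∣ i) (n : ℕ) :
    a (i * (p : ℤ) ^ n) = - ((p : K) ^ (lam * (n : ℤ)) *
      ∑ j ∈ Finset.range (n + 1), (p : K) ^ (-(lam * (j : ℤ))) * c (i * (p : ℤ) ^ j)) := by
  have hp0 : (p : K) ≠ 0 := by exact_mod_cast (by omega : p ≠ 0)
  have hpz : (p : ℤ) ≠ 0 := by omega
  induction n with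
  | zero =>
    have := h i hi0
    rw [if_neg hi] at this
    simp [this]
  | succ n ih =>
    have h1 := h (i * (p : ℤ) ^ (n + 1)) (mul_ne_zero hi0 (pow_ne_zero _ hpz))
    have e : i * (p : ℤ) ^ (n + 1) = p * (i * (p : ℤ) ^ n) := by ring
    rw [if_pos ⟨_, e⟩, e, Int.mul_ediv_cancel_left _ hpz, ih] at h1
    rw [Finset.sum_range_succ, mul_add, ← mul_assoc _ (_ ^ _), ← zpow_add₀ hp0]
    rw [e, h1]
    have e2 : (p : K) ^ (lam * ((n + 1 : ℕ) : ℤ)) = (p : K) ^ lam * (p : K) ^ (lam * (n : ℤ)) := by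
      rw [← zpow_add₀ hp0]; congr 1; push_cast; ring
    rw [e2, add_neg_cancel, zpow_zero]
    ring

theorem exists_trajectory_solution [CharZero K] (hp : 2 ≤ p) (c : ℤ → K) (a₀ : K) :
    ∃ a : ℤ → K, a 0 = a₀ ∧ ∀ j, j ≠ 0 →
      c j = (p : K) ^ lam * (if (p : ℤ) ∣ j then a (j / p) else 0) - a j := by
  have hp0 : (p : K) ≠ 0 := by exact_mod_cast (by omega : p ≠ 0)
  have hpz : (p : ℤ) ≠ 0 := by omega
  set t : ℤ → ℕ → K := fun j n =>
    if (p : ℤ) ^ n ∣ j then (p : K) ^ (lam * (n : ℤ)) * c (j / (p : ℤ) ^ n) else 0 with ht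
  have hdvd : ∀ j : ℤ, j ≠ 0 → ∀ n : ℕ, j.natAbs ≤ n → t j n = 0 := by
    intro j hj n hn
    rw [ht]
    refine if_neg fun hd => ?_
    have h1 := Nat.le_of_dvd (Int.natAbs_pos.2 hj) (Int.natAbs_dvd_natAbs.2 hd)
    rw [Int.natAbs_pow, Int.natAbs_natCast] at h1
    have h2 : n < p ^ n := Nat.lt_pow_self (by omega)
    omega
  have hsum : ∀ j : ℤ, j ≠ 0 → ∀ B : ℕ, j.natAbs ≤ B →
      ∑ n ∈ Finset.range j.natAbs, t j n = ∑ n ∈ Finset.range B, t j n := by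
    intro j hj B hB
    apply Finset.sum_subset (Finset.range_subset_range.2 hB)
    intro n _ hn
    exact hdvd j hj n (by simpa using hn)
  -- Unrolling the recursion gives a sum over all `n` with `p ^ n ∣ j`. Cutting it at `|j|` loses
  -- nothing, since `p ^ n > n ≥ |j|` excludes divisibility.
  refine ⟨fun j => if j = 0 then a₀ else - ∑ n ∈ Finset.range j.natAbs, t j n, if_pos rfl, ?_⟩
  intro j hj
  simp only [if_neg hj]
  have hj1 : 1 ≤ j.natAbs := Int.natAbs_pos.2 hj
  obtain ⟨B, hB⟩ : ∃ B, j.natAbs = B + 1 := ⟨j.natAbs - 1, by omega⟩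
  rw [hB, Finset.sum_range_succ']
  have ht0 : t j 0 = c j := by simp [ht]
  rw [ht0]
  split_ifs with hd hj0
  · obtain ⟨i, rfl⟩ := hd
    rw [Int.mul_ediv_cancel_left _ hpz] at hj0
    simp [hj0] at hj
  · obtain ⟨i, rfl⟩ := hd
    rw [Int.mul_ediv_cancel_left _ hpz] at hj0 ⊢
    have hiB : i.natAbs ≤ B := by
      rw [Int.natAbs_mul, Int.natAbs_natCast] at hB
      have : 1 ≤ i.natAbs := Int.natAbs_pos.2 hj0
      nlinarith
    rw [hsum i hj0 B hiB]
    have e : ∀ n ∈ Finset.range B, t (p * i) (n + 1) = (p : K) ^ lam * t i n := by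
      intro n _
      simp only [ht, pow_succ' (p : ℤ) n, Int.mul_ediv_mul_of_pos _ _ (by omega : (0 : ℤ) < p),
        mul_dvd_mul_iff_left hpz]
      split_ifs
      · rw [← mul_assoc, ← zpow_add₀ hp0]
        congr 2
        push_cast
        ring
      · simp
    rw [Finset.sum_congr rfl e, ← Finset.mul_sum]
    ring
  · have : ∀ n ∈ Finset.range B, t j (n + 1) = 0 := by
      intro n _
      rw [ht]
      refine if_neg fun h => hd (dvd_trans ?_ h)
      exact dvd_pow_self _ (by omega)
    rw [Finset.sum_congr rfl this]
    simp

theorem exists_trajectory {p : ℕ} (hp : 2 ≤ p) {j : ℤ} (hj : j ≠ 0) :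
    ∃ (i : ℤ) (n : ℕ), i ≠ 0 ∧ ¬ (p : ℤ) ∣ i ∧ j = i * (p : ℤ) ^ n := by
  have hfin : FiniteMultiplicity (p : ℤ) j := by
    rw [Int.finiteMultiplicity_iff]
    simp [hj]
    omega
  obtain ⟨i, hi, hd⟩ := hfin.exists_eq_pow_mul_and_not_dvd
  exact ⟨i, _, by rintro rfl; simp at hd, hd, by rw [hi, mul_comm]⟩

theorem exists_laurentPoly_solution_iff [CharZero K] (hp : 2 ≤ p) (f : RatFunc K) :
    (∃ a : ℤ → K, {j | a j ≠ 0}.Finite ∧ ∀ j, laurentPolyCoeff f j =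
      (p : K) ^ lam * (if (p : ℤ) ∣ j then a (j / p) else 0) - a j) ↔
    residueInfty p lam f = 0 := by
  have hp0 : (p : K) ≠ 0 := by exact_mod_cast (by omega : p ≠ 0)
  have hstab : ∀ i : ℤ, i ≠ 0 → ∀ n, trajHeight p f i ≤ n →
      ∑ j ∈ Finset.range (trajHeight p f i + 1),
        (p : K) ^ (-(lam * (j : ℤ))) * laurentPolyCoeff f (i * (p : ℤ) ^ j) =
      ∑ j ∈ Finset.range (n + 1),
        (p : K) ^ (-(lam * (j : ℤ))) * laurentPolyCoeff f (i * (p : ℤ) ^ j) := by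
    intro i hi n hn
    apply Finset.sum_subset (Finset.range_subset_range.2 (by omega))
    intro j _ hj
    rw [laurentPolyCoeff_of_trajHeight_lt hp f hi (by simp at hj; omega), mul_zero]
  constructor
  · rintro ⟨a, ha, h⟩
    funext i
    rw [residueInfty, Pi.zero_apply]
    by_cases hi0 : (i : ℤ) = 0
    · rw [if_pos hi0]
      split_ifs with hl
      · have := h 0
        simpa [hl] using this
      · rfl
    · have hi := i.2.resolve_left hi0
      rw [if_neg hi0]
      obtain ⟨B, hB⟩ := (ha.preimage (f := fun n : ℕ => (i : ℤ) * (p : ℤ) ^ n)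
        (int_mul_pow_injective hp hi0).injOn).bddAbove
      -- Beyond the finite support of `a` and beyond the height of the trajectory, the formula for
      -- `a` contains the full sum of the residue.
      have h1 : a (i * (p : ℤ) ^ (max (B + 1) (trajHeight p f i))) = 0 := by
        by_contra h'
        have := hB h'
        omega
      rw [trajectory_solution hp (fun j _ => h j) hi0 hi, neg_eq_zero, mul_eq_zero,
        ← hstab i hi0 _ (le_max_right _ _)] at h1
      rw [h1.resolve_left (zpow_ne_zero _ hp0), mul_zero]
  · intro hr
    obtain ⟨a, ha0, ha⟩ := exists_trajectory_solution (lam := lam) hp (laurentPolyCoeff f)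
      -- For `lam = 0` this division by zero gives `0`, and the equation at `0` then only says `c_0
      -- = 0`.
      (laurentPolyCoeff f 0 / ((p : K) ^ lam - 1))
    refine ⟨a, ?_, fun j => ?_⟩
    · obtain ⟨B, hB⟩ := ((finite_laurentPolyCoeff f).image Int.natAbs).bddAbove
      refine (Set.finite_Icc (-(B : ℤ)) B).subset fun j hj => ?_
      rcases eq_or_ne j 0 with rfl | hj0
      · simp
      obtain ⟨i, n, hi0, hi, rfl⟩ := exists_trajectory hp hj0
      have hri := congrFun hr ⟨i, Or.inr hi⟩
      rw [residueInfty, if_neg hi0, Pi.zero_apply, mul_eq_zero] at hri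
      have hri := hri.resolve_left (zpow_ne_zero _ hp0)
      have hn : n < trajHeight p f i := by
        by_contra h'
        rw [hstab i hi0 n (by omega)] at hri
        apply hj
        rw [trajectory_solution hp ha hi0 hi, hri, mul_zero, neg_zero]
      -- The supremum is attained: were the set empty, the height would be `0`, contradicting `n <
      -- trajHeight p f i`.
      have hmem : trajHeight p f i ∈ {h : ℕ | laurentPolyCoeff f (i * (p : ℤ) ^ h) ≠ 0} := by
        apply Nat.sSup_mem _ (bddAbove_trajectory hp f hi0)
        by_contra hne
        rw [Set.not_nonempty_iff_eq_empty] at hne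
        rw [trajHeight, hne] at hn
        simp at hn
      have h1 : (i * (p : ℤ) ^ (trajHeight p f i)).natAbs ≤ B := hB ⟨_, hmem, rfl⟩
      have h2 : (i * (p : ℤ) ^ n).natAbs ≤ (i * (p : ℤ) ^ (trajHeight p f i)).natAbs := by
        rw [Int.natAbs_mul, Int.natAbs_mul, Int.natAbs_pow, Int.natAbs_pow, Int.natAbs_natCast]
        exact Nat.mul_le_mul_left _ (Nat.pow_le_pow_right (by omega) hn.le)
      rw [Set.mem_Icc]
      omega
    · rcases eq_or_ne j 0 with rfl | hj
      · rw [if_pos (dvd_zero _), Int.zero_ediv, ha0]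
        by_cases hl : lam = 0
        · have := congrFun hr ⟨0, Or.inl rfl⟩
          simp [residueInfty, hl] at this
          simp [this]
        · have : (p : K) ^ lam - 1 ≠ 0 := by
            rw [sub_ne_zero]
            exact fun h => hl ((natCast_zpow_eq_one_iff hp lam).1 h)
          field_simp
      · exact ha j hj

end Infinity

end

section

variable {K : Type*} [Field K] {p : ℕ}

/-! ### Trees -/

theorem pow_mem_elems {τ : MahlerTree K p} {α : Kˣ} (hα : α ∈ elems τ) (n : ℕ) :
    α ^ p ^ n ∈ elems τ := by
  rw [← (show Quotient.mk (treeSetoid K p) α = τ from hα)]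
  exact Quotient.sound ⟨0, n, by simp⟩

theorem mem_elems_of_pow {τ : MahlerTree K p} {α : Kˣ} {n : ℕ} (hα : α ^ p ^ n ∈ elems τ) :
    α ∈ elems τ := by
  rw [← (show Quotient.mk (treeSetoid K p) (α ^ p ^ n) = τ from hα)]
  exact Quotient.sound ⟨n, 0, by simp⟩

theorem exists_pow_eq_pow {τ : MahlerTree K p} {α β : Kˣ} (hα : α ∈ elems τ) (hβ : β ∈ elems τ) :
    ∃ r s : ℕ, α ^ p ^ r = β ^ p ^ s :=
  Quotient.exact ((show Quotient.mk (treeSetoid K p) α = τ from hα).trans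
    (show Quotient.mk (treeSetoid K p) β = τ from hβ).symm)

theorem pow_pow_add {α : Kˣ} (a b : ℕ) : α ^ p ^ (a + b) = (α ^ p ^ a) ^ p ^ b := by
  rw [← pow_mul, ← pow_add]

theorem exists_units_pow_eq [IsAlgClosed K] (hp : 0 < p) (α : Kˣ) : ∃ β : Kˣ, β ^ p = α := by
  obtain ⟨z, hz⟩ := IsAlgClosed.exists_pow_nat_eq (α : K) hp
  have hz0 : z ≠ 0 := by
    rintro rfl
    rw [zero_pow hp.ne'] at hz
    exact α.ne_zero hz.symm
  exact ⟨Units.mk0 z hz0, Units.ext (by simpa using hz)⟩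

theorem finite_units_pow_eq {n : ℕ} (hn : 0 < n) (α : Kˣ) : {β : Kˣ | β ^ n = α}.Finite := by
  classical
  refine (((nthRoots n (α : K)).toFinset.finite_toSet).preimage
    (f := fun β : Kˣ => (β : K)) Units.val_injective.injOn).subset fun β hβ => ?_
  simp only [Set.mem_preimage, Finset.mem_coe, Multiset.mem_toFinset, mem_nthRoots hn]
  rw [← (show β ^ n = α from hβ)]
  simp

theorem finite_units_pow_mem {n : ℕ} (hn : 0 < n) {F : Set Kˣ} (hF : F.Finite) :
    {β : Kˣ | β ^ n ∈ F}.Finite := by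
  have : {β : Kˣ | β ^ n ∈ F} = ⋃ α ∈ F, {β : Kˣ | β ^ n = α} := by
    ext β; simp
  rw [this]
  exact hF.biUnion fun α _ => finite_units_pow_eq hn α

/-- The smallest `n` with `α ^ (p ^ n) ∈ S`. -/
def heightTo (p : ℕ) (S : Set Kˣ) (α : Kˣ) : ℕ := sInf {n : ℕ | α ^ p ^ n ∈ S}

/-! ### Heights above a set stable under `x ↦ x ^ p` -/

section Height

variable {S : Set Kˣ}

theorem heightTo_le {α : Kˣ} {n : ℕ} (h : α ^ p ^ n ∈ S) : heightTo p S α ≤ n := Nat.sInf_le h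

theorem heightTo_spec {α : Kˣ} (h : ∃ n, α ^ p ^ n ∈ S) : α ^ p ^ heightTo p S α ∈ S :=
  Nat.sInf_mem (s := {n : ℕ | α ^ p ^ n ∈ S}) h

theorem heightTo_of_mem {α : Kˣ} (h : α ∈ S) : heightTo p S α = 0 :=
  Nat.le_zero.1 (heightTo_le (by simpa using h))

theorem mem_of_heightTo_eq_zero {α : Kˣ} (h : ∃ n, α ^ p ^ n ∈ S) (h0 : heightTo p S α = 0) :
    α ∈ S := by
  have := heightTo_spec h
  rw [h0] at this
  simpa using this

theorem pow_pow_mem (hS : ∀ γ ∈ S, γ ^ p ∈ S) {γ : Kˣ} (hγ : γ ∈ S) (n : ℕ) : γ ^ p ^ n ∈ S := by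
  induction n with
  | zero => simpa using hγ
  | succ n ih =>
    rw [pow_succ, pow_mul]
    exact hS _ ih

theorem heightTo_pow {α : Kˣ} {n : ℕ} (h : heightTo p S α = n + 1) : heightTo p S (α ^ p) = n := by
  -- An element that never enters `S` has height `sInf ∅ = 0`, so a positive height guarantees
  -- entry.
  have hne : ∃ n, α ^ p ^ n ∈ S := by
    by_contra hne
    have : {n : ℕ | α ^ p ^ n ∈ S} = ∅ := by
      ext n; simp only [Set.mem_ofPred_eq, Set.mem_empty_iff_false, iff_false]
      exact fun h => hne ⟨n, h⟩
    rw [heightTo, this, Nat.sInf_empty] at h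
    omega
  have h1 := heightTo_spec hne
  rw [h, pow_succ', pow_mul] at h1
  have h2 := heightTo_le h1
  have h3 := heightTo_spec (p := p) (S := S) ⟨n, h1⟩
  rw [← pow_mul, ← pow_succ'] at h3
  have := heightTo_le h3
  omega

theorem heightTo_root {α β : Kˣ} (h : ∃ n, α ^ p ^ n ∈ S)
    (hβ : β ^ p = α) (hβS : β ∉ S) : heightTo p S β = heightTo p S α + 1 := by
  have hb : ∃ n, β ^ p ^ n ∈ S := by
    obtain ⟨n, hn⟩ := h
    exact ⟨n + 1, by rw [pow_succ', pow_mul, hβ]; exact hn⟩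
  obtain ⟨m, hm⟩ : ∃ m, heightTo p S β = m + 1 :=
    Nat.exists_eq_succ_of_ne_zero fun h0 => hβS (mem_of_heightTo_eq_zero hb h0)
  have := heightTo_pow hm
  rw [hβ] at this
  omega

end Height

/-! ### Extending solutions from an absorbing subset of a tree -/

section Extension

variable {lam : ℤ} {M : ℕ} {τ : MahlerTree K p} {S : Set Kˣ} [CharZero K]

/-- A solution on an absorbing subset `S` of a tree extends to the whole tree, with finite support
as soon as it vanishes at one height. -/
theorem exists_extension (hp : 0 < p) (hS : ∀ γ ∈ S, γ ^ p ∈ S)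
    (hτ : ∀ α ∈ elems τ, ∃ n, α ^ p ^ n ∈ S) {c dS : ℕ → Kˣ → K}
    (hc : {α | α ∈ elems τ ∧ ∃ k, 1 ≤ k ∧ c k α ≠ 0}.Finite)
    (hcM : ∀ k, M < k → ∀ α ∈ elems τ, c k α = 0)
    (hd : {γ | γ ∈ S ∧ ∃ k, 1 ≤ k ∧ dS k γ ≠ 0}.Finite)
    (hdS : ∀ γ ∈ S, γ ∈ elems τ → ∀ k, 1 ≤ k → k ≤ M →
      c k γ = twist p lam M 1 dS k γ - dS k γ)
    (H : ℕ)
    (hH : ∀ α ∈ elems τ, heightTo p S α = H → ∀ k, 1 ≤ k → k ≤ M →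
      twist p lam M H dS k α - ∑ n ∈ Finset.range H, twist p lam M n c k α = 0)
    (hcH : ∀ α ∈ elems τ, H < heightTo p S α → ∀ k, 1 ≤ k → c k α = 0) :
    ∃ d : ℕ → Kˣ → K, {α | α ∈ elems τ ∧ ∃ k, 1 ≤ k ∧ d k α ≠ 0}.Finite ∧
      (∀ k, M < k → ∀ α, d k α = 0) ∧
      ∀ α ∈ elems τ, ∀ k, 1 ≤ k → c k α = twist p lam M 1 d k α - d k α := by
  -- This is forced: iterating `d = T d - c` until `S` is reached leaves only values of `dS` and
  -- `c`.
  set e : ℕ → Kˣ → K := fun k α => twist p lam M (heightTo p S α) dS k α -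
    ∑ n ∈ Finset.range (heightTo p S α), twist p lam M n c k α with he
  have heS : ∀ γ ∈ S, ∀ k, 1 ≤ k → k ≤ M → e k γ = dS k γ := by
    intro γ hγ k hk hkM
    simp only [he, heightTo_of_mem hγ, Finset.range_zero, Finset.sum_empty, sub_zero]
    exact twist_zero hk hkM
  have heq : ∀ α ∈ elems τ, ∀ k, 1 ≤ k → k ≤ M → c k α = twist p lam M 1 e k α - e k α := by
    intro α hα k hk hkM
    rcases Nat.eq_zero_or_pos (heightTo p S α) with h0 | h0
    · have hαS := mem_of_heightTo_eq_zero (hτ α hα) h0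
      rw [hdS α hαS hα k hk hkM, heS α hαS k hk hkM]
      congr 1
      refine twist_congr fun s hs hsM => (heS _ ?_ s (by omega) hsM).symm
      rw [pow_one]
      exact hS α hαS
    · obtain ⟨n, hn⟩ : ∃ n, heightTo p S α = n + 1 := ⟨_, (Nat.succ_pred_eq_of_pos h0).symm⟩
      have h1 : twist p lam M 1 e k α = twist p lam M 1 (twist p lam M n dS -
          ∑ j ∈ Finset.range n, twist p lam M j c) k α := by
        refine twist_congr fun s hs hsM => ?_
        simp only [he, pow_one, heightTo_pow hn, Pi.sub_apply, Finset.sum_apply]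
      rw [h1, twist_sub, twist_sum, twist_twist hp _ _ _ hk]
      simp only [twist_twist hp _ _ _ hk, he, hn]
      rw [Finset.sum_range_succ', twist_zero hk hkM, add_comm 1 n]
      simp only [add_comm 1]
      ring
  -- Vanishing propagates upwards from height `H`: in `d = T d - c`, the term `c` is zero above `H`
  -- and `T d` only involves one height less.
  have hezero : ∀ i, ∀ α ∈ elems τ, heightTo p S α = H + i → ∀ k, 1 ≤ k → k ≤ M → e k α = 0 := by
    intro i
    induction i with
    | zero =>
      intro α hα h k hk hkM
      simp only [he, h]
      exact hH α hα h k hk hkM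
    | succ i ih =>
      intro α hα h k hk hkM
      have h1 := heq α hα k hk hkM
      rw [hcH α hα (by omega) k hk, twist_eq_zero] at h1
      · simpa using h1.symm
      · intro s hs hsM
        refine ih _ (pow_mem_elems hα 1) ?_ s (by omega) hsM
        rw [pow_one]
        exact heightTo_pow (by omega)
  set F : Set Kˣ := {α | α ∈ elems τ ∧ ∃ k, 1 ≤ k ∧ c k α ≠ 0} ∪
    {γ | γ ∈ S ∧ ∃ k, 1 ≤ k ∧ dS k γ ≠ 0} with hF
  have hFfin : F.Finite := hc.union hd
  refine ⟨fun k α => if k ≤ M then e k α else 0, ?_, fun k hk α => if_neg (by omega), ?_⟩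
  · refine (Set.Finite.biUnion (Set.finite_Iic H) (t := fun n => {α : Kˣ | α ^ p ^ n ∈ F})
      fun n _ => finite_units_pow_mem (pow_pos hp n) hFfin).subset ?_
    rintro α ⟨hα, k, hk, h⟩
    simp only [ne_eq, ite_eq_right_iff, Classical.not_imp] at h
    obtain ⟨hkM, h⟩ := h
    have hlt : heightTo p S α < H := by
      by_contra h'
      exact h (hezero (heightTo p S α - H) α hα (by omega) k hk hkM)
    by_contra hnot
    simp only [Set.mem_iUnion, Set.mem_Iic, not_exists, Set.mem_ofPred_eq] at hnot
    apply h
    simp only [he]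
    rw [twist_eq_zero, Finset.sum_eq_zero, sub_zero]
    · intro n hn
      have hn := Finset.mem_range.1 hn
      refine twist_eq_zero fun s hs hsM => ?_
      by_contra h'
      exact hnot n (by omega) (Or.inl ⟨pow_mem_elems hα n, s, by omega, h'⟩)
    · intro s hs hsM
      by_contra h'
      exact hnot _ hlt.le (Or.inr ⟨heightTo_spec (hτ α hα), s, by omega, h'⟩)
  · intro α hα k hk
    by_cases hkM : k ≤ M
    · rw [heq α hα k hk hkM]
      simp only [if_pos hkM]
      congr 1
      exact twist_congr fun s hs hsM => (if_pos hsM).symm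
    · rw [hcM k (by omega) α hα, twist_of_lt (by omega)]
      simp [hkM]

/-- A finitely supported solution vanishes at and above the maximal height of the right-hand
side. -/
theorem solution_eq_zero [IsAlgClosed K] (hp : 0 < p) (hS : ∀ γ ∈ S, γ ^ p ∈ S)
    (hτ : ∀ α ∈ elems τ, ∃ n, α ^ p ^ n ∈ S) {c d : ℕ → Kˣ → K}
    (hd : {α | ∃ k, 1 ≤ k ∧ d k α ≠ 0}.Finite)
    (hcd : ∀ α ∈ elems τ, ∀ k, 1 ≤ k → c k α = twist p lam M 1 d k α - d k α)
    (H : ℕ) (hH1 : 1 ≤ H)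
    (hcH : ∀ α ∈ elems τ, H < heightTo p S α → ∀ k, 1 ≤ k → c k α = 0) :
    ∀ α ∈ elems τ, H ≤ heightTo p S α → ∀ k, 1 ≤ k → k ≤ M → d k α = 0 := by
  obtain ⟨B, hB⟩ := (hd.image (heightTo p S)).bddAbove
  -- Descending induction on the height, starting above the bound `B` for the support of `d`.
  have key : ∀ j, ∀ α ∈ elems τ, H ≤ heightTo p S α → B + 1 ≤ heightTo p S α + j →
      ∀ k, 1 ≤ k → k ≤ M → d k α = 0 := by
    intro j
    induction j with
    | zero =>
      intro α hα _ h k hk _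
      by_contra h'
      have := hB ⟨α, ⟨k, hk, h'⟩, rfl⟩
      omega
    | succ j ih =>
      intro α hα hHα h
      obtain ⟨β, hβ⟩ := exists_units_pow_eq hp α
      have hβS : β ∉ S := by
        intro hβS
        have := heightTo_of_mem (p := p) (hS β hβS)
        rw [hβ] at this
        omega
      have hht := heightTo_root (hτ α hα) hβ hβS
      have hβτ : β ∈ elems τ := mem_elems_of_pow (n := 1) (by rw [pow_one, hβ]; exact hα)
      -- At the root `β`, one level higher, both `c` and `d` vanish. Hence `T d` vanishes at `β`,
      -- and injectivity carries this to `β ^ p = α`.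
      have h1 : ∀ k, 1 ≤ k → k ≤ M → twist p lam M 1 d k β = 0 := by
        intro k hk hkM
        have h2 := hcd β hβτ k hk
        rw [hcH β hβτ (by omega) k hk, ih β hβτ (by omega) (by omega) k hk hkM, sub_zero] at h2
        exact h2.symm
      have := twist_injective hp h1
      rwa [pow_one, hβ] at this
  intro α hα hHα
  exact key (B + 1) α hα hHα (by omega)

theorem sum_twist_eq_of_solution [IsAlgClosed K] (hp : 0 < p) (hS : ∀ γ ∈ S, γ ^ p ∈ S)
    (hτ : ∀ α ∈ elems τ, ∃ n, α ^ p ^ n ∈ S) {c d : ℕ → Kˣ → K}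
    (hd : {α | ∃ k, 1 ≤ k ∧ d k α ≠ 0}.Finite)
    (hcd : ∀ α ∈ elems τ, ∀ k, 1 ≤ k → c k α = twist p lam M 1 d k α - d k α)
    (H : ℕ) (hH1 : 1 ≤ H)
    (hcH : ∀ α ∈ elems τ, H < heightTo p S α → ∀ k, 1 ≤ k → c k α = 0) :
    ∀ α ∈ elems τ, heightTo p S α = H → ∀ k, 1 ≤ k → k ≤ M →
      ∑ n ∈ Finset.range H, twist p lam M n c k α = twist p lam M H d k α := by
  intro α hα h k hk hkM
  rw [sum_twist_of_eq hp H (fun n _ s hs _ => hcd _ (pow_mem_elems hα n) s hs) hk hkM,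
    solution_eq_zero hp hS hτ hd hcd H hH1 hcH α hα h.ge k hk hkM, sub_zero]

end Extension

/-! ### Poles in a tree -/

section Poles

variable (f : RatFunc K) (τ : MahlerTree K p)

theorem mem_sing_iff {α : Kˣ} : α ∈ sing f τ ↔ α ∈ elems τ ∧ ∃ k, 1 ≤ k ∧ coeffVec f k α ≠ 0 := by
  refine and_congr_right fun _ => ?_
  have h := (poleOrder_eq_zero_iff f (α : K)).not
  rw [ne_eq, h]
  simp only [coeffVec, not_forall, exists_prop, ne_eq]

theorem finite_sing : (sing f τ).Finite :=
  (finite_coeffVec f).subset fun _ hα => ((mem_sing_iff f τ).1 hα).2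

theorem poleOrder_le_treeOrder {α : Kˣ} (hα : α ∈ elems τ) :
    poleOrder f (α : K) ≤ treeOrder f τ := by
  by_cases h : poleOrder f (α : K) = 0
  · omega
  · exact le_csSup ((finite_sing f τ).image _).bddAbove ⟨α, ⟨hα, h⟩, rfl⟩

theorem coeffVec_of_treeOrder_lt {k : ℕ} (hk : treeOrder f τ < k) {α : Kˣ} (hα : α ∈ elems τ) :
    coeffVec f k α = 0 :=
  polarCoeff_eq_zero_of_poleOrder_lt f _ ((poleOrder_le_treeOrder f τ hα).trans_lt hk)

variable {f τ}

theorem coeffVec_of_not_mem_sing {α : Kˣ} (hα : α ∈ elems τ) (h : α ∉ sing f τ) {k : ℕ}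
    (hk : 1 ≤ k) : coeffVec f k α = 0 := by
  by_contra h'
  exact h ((mem_sing_iff f τ).2 ⟨hα, k, hk, h'⟩)

/-- The sums over `s ≤ m` in the definition of the residues are values of the twisted Mahler
operator. -/
theorem sum_Icc_treeOrder_eq_twist {lam : ℤ} {M : ℕ} (hM : treeOrder f τ ≤ M) (H : ℕ) {α : Kˣ}
    (hα : α ∈ elems τ) (k : ℕ) :
    ∑ s ∈ Finset.Icc k (treeOrder f τ), ∑ n ∈ Finset.range H,
        (p : K) ^ (lam * (n : ℤ)) * mahlerCoeff p s k n (α : K) * coeffVec f s (α ^ p ^ n) =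
      ∑ n ∈ Finset.range H, twist p lam M n (coeffVec f) k α := by
  rw [Finset.sum_comm]
  refine Finset.sum_congr rfl fun n _ => ?_
  rw [← twist_mono hM fun s hs => coeffVec_of_treeOrder_lt f τ hs (pow_mem_elems hα n)]
  rw [twist, Finset.mul_sum]
  exact Finset.sum_congr rfl fun s _ => by ring

end Poles

end

section

variable {K : Type*} [Field K] {p : ℕ}

/-! ### Non-torsion trees -/

section NonTorsion

variable {τ : MahlerTree K p}

/-- The order of `δ` divides `p ^ n - 1`, which is coprime to `p`. Consequently a tree without a
cycle has no periodic point. -/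
theorem mem_cycle_of_pow_eq (hp : 2 ≤ p) {δ : Kˣ} (hδ : δ ∈ elems τ) {n : ℕ} (hn : 1 ≤ n)
    (h : δ ^ p ^ n = δ) : δ ∈ cycle τ := by
  have hpn : 2 ≤ p ^ n := hp.trans (Nat.le_self_pow (by omega) p)
  have h1 : δ ^ (p ^ n - 1) = 1 := by
    rw [← mul_left_inj δ, ← pow_succ, Nat.sub_add_cancel (by omega), h, one_mul]
  refine ⟨hδ, isOfFinOrder_iff_pow_eq_one.2 ⟨_, by omega, h1⟩, ?_⟩
  refine Nat.Coprime.coprime_dvd_left (orderOf_dvd_of_pow_eq_one h1) ?_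
  have h2 : Nat.Coprime (p ^ n - 1) (p ^ n) := by
    have := Nat.coprime_self_add_right (m := p ^ n - 1) (n := 1)
    rw [Nat.sub_add_cancel (by omega)] at this
    exact this.2 (Nat.coprime_one_right _)
  exact Nat.Coprime.coprime_dvd_right (dvd_pow_self p (by omega)) h2

theorem pow_pow_injective (hp : 2 ≤ p) (hτ : ¬ (cycle τ).Nonempty) {α : Kˣ} (hα : α ∈ elems τ) :
    Function.Injective (fun n : ℕ => α ^ p ^ n) := by
  have key : ∀ a b, a < b → α ^ p ^ a ≠ α ^ p ^ b := by
    intro a b hab h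
    refine hτ ⟨α ^ p ^ a, mem_cycle_of_pow_eq hp (pow_mem_elems hα a) (n := b - a) (by omega) ?_⟩
    rw [← pow_pow_add, h]
    congr 2
    omega
  intro a b h
  rcases lt_trichotomy a b with hab | hab | hab
  · exact absurd h (key a b hab)
  · exact hab
  · exact absurd h.symm (key b a hab)

/-- The orbit of each of the finitely many poles merges with that of a fixed `β`; a sufficiently
high power of `β` serves all of them. -/
theorem exists_isBouquetRoot (f : RatFunc K) (τ : MahlerTree K p) : ∃ γ, IsBouquetRoot f τ γ := by
  have hne : {h : ℕ | ∃ γ ∈ elems τ, sing f τ ⊆ bouquet τ h γ}.Nonempty := by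
    obtain ⟨β, hβ⟩ := Quotient.exists_rep τ
    have hβ : β ∈ elems τ := hβ
    have : ∀ α : sing f τ, ∃ r s : ℕ, (α : Kˣ) ^ p ^ r = β ^ p ^ s :=
      fun α => exists_pow_eq_pow α.2.1 hβ
    choose r s hrs using this
    have : Finite (sing f τ) := finite_sing f τ
    obtain ⟨R, hR⟩ := (Set.finite_range r).bddAbove
    obtain ⟨T, hT⟩ := (Set.finite_range s).bddAbove
    refine ⟨R + T, β ^ p ^ T, pow_mem_elems hβ T, fun α hα => ⟨hα.1, r ⟨α, hα⟩ + (T - s ⟨α, hα⟩), ?_, ?_⟩⟩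
    · have := hR ⟨⟨α, hα⟩, rfl⟩
      omega
    · rw [pow_pow_add, hrs ⟨α, hα⟩, ← pow_pow_add]
      congr 2
      have := hT ⟨⟨α, hα⟩, rfl⟩
      omega
  exact Nat.sInf_mem hne

/-- The forward orbit of `γ`, without `γ`. -/
def forwardOrbit (p : ℕ) (γ : Kˣ) : Set Kˣ := {δ | ∃ j : ℕ, δ = γ ^ p ^ (j + 1)}

theorem forwardOrbit_pow (γ : Kˣ) : ∀ δ ∈ forwardOrbit p γ, δ ^ p ∈ forwardOrbit p γ := by
  rintro _ ⟨j, rfl⟩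
  exact ⟨j + 1, by rw [← pow_mul, ← pow_succ]⟩

theorem exists_pow_mem_forwardOrbit {γ : Kˣ} (hγ : γ ∈ elems τ) :
    ∀ α ∈ elems τ, ∃ n, α ^ p ^ n ∈ forwardOrbit p γ := by
  intro α hα
  obtain ⟨r, s, h⟩ := exists_pow_eq_pow hα hγ
  exact ⟨r + 1, s, by rw [pow_pow_add, h, ← pow_pow_add]⟩

section Root

variable {f : RatFunc K} {γ : Kˣ} (hp : 2 ≤ p) (hτ : ¬ (cycle τ).Nonempty)
  (hγ : IsBouquetRoot f τ γ)

include hγ in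
theorem coeffVec_of_bouquetHeight_lt {α : Kˣ} (hα : α ∈ elems τ)
    (h : bouquetHeight f τ + 1 < heightTo p (forwardOrbit p γ) α) {k : ℕ} (hk : 1 ≤ k) :
    coeffVec f k α = 0 := by
  refine coeffVec_of_not_mem_sing hα (fun hs => ?_) hk
  obtain ⟨-, n, hn, hnγ⟩ := hγ.2 hs
  have : α ^ p ^ (n + 1) ∈ forwardOrbit p γ := ⟨0, by rw [pow_pow_add, hnγ]⟩
  have := heightTo_le this
  omega

include hp hτ hγ in
-- A pole in the strict forward orbit would return to `γ`, which would then be periodic. The root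
-- `γ` may itself be a pole, which is why this orbit omits it.
theorem coeffVec_forwardOrbit {δ : Kˣ} (hδ : δ ∈ forwardOrbit p γ) {k : ℕ} (hk : 1 ≤ k) :
    coeffVec f k δ = 0 := by
  obtain ⟨j, rfl⟩ := hδ
  refine coeffVec_of_not_mem_sing (pow_mem_elems hγ.1 _) (fun hs => ?_) hk
  obtain ⟨-, n, hn, hnγ⟩ := hγ.2 hs
  rw [← pow_pow_add] at hnγ
  have := pow_pow_injective hp hτ hγ.1 (a₁ := j + 1 + n) (a₂ := 0) (by simpa using hnγ)
  omega

variable {lam : ℤ} [CharZero K]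

include hp hτ in
-- Relative to the strict forward orbit of the root, the residue sits at height `bouquetHeight f τ +
-- 1`. It equals the iterated twist of `d` there, which only involves values of `d` on that orbit.
theorem nonTorsionResidue_eq_zero [IsAlgClosed K] {M : ℕ} {d : ℕ → Kˣ → K}
    (hM : treeOrder f τ ≤ M) (hd : {α | ∃ k, 1 ≤ k ∧ d k α ≠ 0}.Finite)
    (hdf : ∀ α ∈ elems τ, ∀ k, 1 ≤ k → coeffVec f k α = twist p lam M 1 d k α - d k α)
    {k : ℕ} (hk : 1 ≤ k) : nonTorsionResidue lam f τ k = 0 := by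
  funext α
  obtain ⟨α, hα⟩ := α
  rw [nonTorsionResidue, Pi.zero_apply]
  split_ifs with h1 hγ
  · rfl
  · simp only at hγ
    have hkM : k ≤ M := by omega
    have := sum_Icc_treeOrder_eq_twist (f := f) (lam := lam) hM (bouquetHeight f τ + 1) hα k
    rw [show (∑ s ∈ Finset.Icc k (treeOrder f τ), ∑ n ∈ Finset.range (bouquetHeight f τ + 1),
        (p : K) ^ (lam * (n : ℤ)) * mahlerCoeff p s k n (α : K) * polarCoeff f s ((α : K) ^ p ^ n)) =
        _ from by simpa only [coeffVec, Units.val_pow_eq_pow_val] using this]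
    set γ := α ^ p ^ bouquetHeight f τ with hγdef
    have hmem : α ^ p ^ (bouquetHeight f τ + 1) ∈ forwardOrbit p γ := ⟨0, by rw [hγdef, ← pow_pow_add]⟩
    have hht : heightTo p (forwardOrbit p γ) α = bouquetHeight f τ + 1 := by
      refine le_antisymm (heightTo_le hmem) ?_
      obtain ⟨j, hj⟩ := heightTo_spec (p := p) ⟨_, hmem⟩
      rw [hγdef, ← pow_pow_add] at hj
      have : heightTo p (forwardOrbit p γ) α = bouquetHeight f τ + (j + 1) :=
        pow_pow_injective hp hτ hα hj
      omega
    rw [sum_twist_eq_of_solution (by omega) (forwardOrbit_pow γ) (exists_pow_mem_forwardOrbit hγ.1)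
      hd hdf _ (by omega) (fun β hβ h k hk => coeffVec_of_bouquetHeight_lt hγ hβ h hk) α hα hht k hk hkM]
    obtain ⟨B, hB⟩ := (hd.preimage (f := fun n : ℕ => γ ^ p ^ n)
      (pow_pow_injective hp hτ hγ.1).injOn).bddAbove
    -- Along the pole-free orbit the equation reads `d = T d`. The support is finite and the orbit
    -- infinite, so zeros far along it come back to its beginning.
    have hzero : ∀ i j, B + 1 ≤ i + j → 1 ≤ j → ∀ s, 1 ≤ s → s ≤ M → d s (γ ^ p ^ j) = 0 := by
      intro i
      induction i with
      | zero =>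
        intro j hj _ s hs _
        by_contra h'
        have := hB (a := j) ⟨s, hs, h'⟩
        omega
      | succ i ih =>
        intro j hj hj1 s hs hsM
        have h2 := hdf (γ ^ p ^ j) (pow_mem_elems hγ.1 j) s hs
        rw [coeffVec_forwardOrbit hp hτ hγ ⟨j - 1, by congr 2; omega⟩ hs, twist_eq_zero] at h2
        · simpa using h2.symm
        · intro t ht htM
          rw [← pow_pow_add]
          exact ih (j + 1) (by omega) (by omega) t (by omega) htM
    refine twist_eq_zero fun s hs hsM => ?_
    rw [pow_pow_add, ← hγdef]
    exact hzero B 1 (by omega) le_rfl s (by omega) hsM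
  · rfl

include hp hτ in
theorem exists_solution_of_nonTorsionResidue (f : RatFunc K)
    (hres : ∀ k, 1 ≤ k → nonTorsionResidue lam f τ k = 0) {M : ℕ} (hM : treeOrder f τ ≤ M) :
    ∃ d : ℕ → Kˣ → K, {α | α ∈ elems τ ∧ ∃ k, 1 ≤ k ∧ d k α ≠ 0}.Finite ∧
      (∀ k, M < k → ∀ α, d k α = 0) ∧
      ∀ α ∈ elems τ, ∀ k, 1 ≤ k → coeffVec f k α = twist p lam M 1 d k α - d k α := by
  obtain ⟨γ, hγ⟩ := exists_isBouquetRoot f τ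
  have habs := exists_pow_mem_forwardOrbit hγ.1
  refine exists_extension (S := forwardOrbit p γ) (dS := 0) (by omega) (forwardOrbit_pow γ) habs
    ((finite_coeffVec f).subset fun α hα => hα.2)
    (fun k hk α hα => coeffVec_of_treeOrder_lt f τ (by omega) hα) (by simp)
    (fun δ hδ _ k hk hkM => ?_) (bouquetHeight f τ + 1) (fun α hα hht k hk hkM => ?_)
    (fun α hα h k hk => coeffVec_of_bouquetHeight_lt hγ hα h hk)
  · rw [coeffVec_forwardOrbit hp hτ hγ hδ hk, twist_eq_zero fun _ _ _ => rfl]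
    simp
  · rw [twist_eq_zero fun _ _ _ => rfl, zero_sub, neg_eq_zero]
    by_cases hkm : treeOrder f τ < k
    · refine Finset.sum_eq_zero fun n _ => twist_eq_zero fun s hs _ => ?_
      exact coeffVec_of_treeOrder_lt f τ (by omega) (pow_mem_elems hα n)
    by_cases hs : sing f τ = ∅
    · refine Finset.sum_eq_zero fun n _ => twist_eq_zero fun s hks _ => ?_
      exact coeffVec_of_not_mem_sing (pow_mem_elems hα n) (by simp [hs]) (by omega)
    by_cases hαγ : α ^ p ^ bouquetHeight f τ = γ
    · have h := congrFun (hres k hk) ⟨α, hα⟩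
      rw [nonTorsionResidue, if_neg (by tauto), Pi.zero_apply] at h
      simp only at h
      rw [if_pos (by rw [hαγ]; exact hγ)] at h
      rw [← sum_Icc_treeOrder_eq_twist hM _ hα, ← h]
      simp only [coeffVec, Units.val_pow_eq_pow_val]
    -- If an iterate of `α` were a pole, the path of `α` would pass through `γ`. Its height being
    -- `bouquetHeight f τ + 1`, it would do so exactly at step `bouquetHeight f τ`, which is
    -- excluded here.
    · refine Finset.sum_eq_zero fun n hn => twist_eq_zero fun s hks _ => ?_
      refine coeffVec_of_not_mem_sing (pow_mem_elems hα n) (fun hns => hαγ ?_) (by omega)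
      obtain ⟨-, n', hn', hnγ⟩ := hγ.2 hns
      rw [← pow_pow_add] at hnγ
      have h1 : α ^ p ^ (n + n' + 1) ∈ forwardOrbit p γ := ⟨0, by rw [pow_pow_add, hnγ]⟩
      have h1 := heightTo_le h1
      obtain ⟨j, hj⟩ := heightTo_spec (habs α hα)
      rw [hht, ← hnγ, ← pow_pow_add] at hj
      have hj := pow_pow_injective hp hτ hα hj
      rw [← hnγ]
      congr 2
      omega

end Root

end NonTorsion

end

section

variable {K : Type*} [Field K] {p : ℕ}

/-! ### Cycles -/

section Cycle

variable {τ : MahlerTree K p}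

theorem cycle_pow : ∀ γ ∈ cycle τ, γ ^ p ∈ cycle τ := by
  rintro γ ⟨h1, h2, h3⟩
  refine ⟨by simpa using pow_mem_elems h1 1, h2.pow, ?_⟩
  exact Nat.Coprime.coprime_dvd_left (orderOf_pow_dvd p) h3

/-- Euler's theorem for `p` modulo the order of `γ`. -/
theorem exists_period {γ : Kˣ} (hγ : γ ∈ cycle τ) : ∃ t, 1 ≤ t ∧ γ ^ p ^ t = γ := by
  obtain ⟨-, h2, h3⟩ := hγ
  refine ⟨Nat.totient (orderOf γ), Nat.totient_pos.2 (orderOf_pos_iff.2 h2), ?_⟩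
  have := (pow_eq_pow_iff_modEq (x := γ)).2 (Nat.ModEq.pow_totient h3.symm)
  simpa using this

theorem exists_pow_mem_cycle (hC : (cycle τ).Nonempty) :
    ∀ α ∈ elems τ, ∃ n, α ^ p ^ n ∈ cycle τ := by
  obtain ⟨γ, hγ⟩ := hC
  intro α hα
  obtain ⟨r, s, h⟩ := exists_pow_eq_pow hα hγ.1
  exact ⟨r, by rw [h]; exact pow_pow_mem cycle_pow hγ s⟩

theorem pow_period_mul {γ : Kˣ} {t : ℕ} (h : γ ^ p ^ t = γ) (n : ℕ) : γ ^ p ^ (t * n) = γ := by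
  induction n with
  | zero => simp
  | succ n ih => rw [Nat.mul_succ, pow_pow_add, ih, h]

/-- The orbits of `γ` and `δ` meet; following the orbit of `δ` further, to a multiple of its period,
leads back to `δ`. So the cycle is a single orbit. -/
theorem exists_eq_pow_of_mem_cycle {γ δ : Kˣ} (hγ : γ ∈ cycle τ) (hδ : δ ∈ cycle τ) :
    ∃ j, δ = γ ^ p ^ j := by
  obtain ⟨r, s, h⟩ := exists_pow_eq_pow hδ.1 hγ.1
  obtain ⟨t, ht, hper⟩ := exists_period hδ
  refine ⟨s + (t * r - r), ?_⟩
  rw [pow_pow_add, ← h, ← pow_pow_add, Nat.add_sub_cancel' (Nat.le_mul_of_pos_left r ht),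
    pow_period_mul hper]

theorem iterate_pow_eq (n : ℕ) (γ : Kˣ) : (fun x : Kˣ => x ^ p)^[n] γ = γ ^ p ^ n := by
  induction n with
  | zero => simp
  | succ n ih => rw [Function.iterate_succ_apply', ih, pow_succ, pow_mul]

theorem cycle_eq_image {γ : Kˣ} (hγ : γ ∈ cycle τ) :
    1 ≤ cycleLength τ ∧ γ ^ p ^ cycleLength τ = γ ∧
      cycle τ = (fun j : ℕ => γ ^ p ^ j) '' Set.Iio (cycleLength τ) := by
  set φ : Kˣ → Kˣ := fun x => x ^ p with hφ
  set t := Function.minimalPeriod φ γ with ht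
  obtain ⟨n, hn, hper⟩ := exists_period hγ
  have hpp : γ ∈ Function.periodicPts φ := by
    refine Function.mk_mem_periodicPts (n := n) (by omega) ?_
    rw [Function.IsPeriodicPt, Function.IsFixedPt, iterate_pow_eq, hper]
  have htpos : 0 < t := Function.minimalPeriod_pos_of_mem_periodicPts hpp
  have himg : cycle τ = (fun j : ℕ => γ ^ p ^ j) '' Set.Iio t := by
    ext δ
    constructor
    · intro hδ
      obtain ⟨j, rfl⟩ := exists_eq_pow_of_mem_cycle hγ hδ
      refine ⟨j % t, Nat.mod_lt _ htpos, ?_⟩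
      simp only
      rw [← iterate_pow_eq, ← iterate_pow_eq]
      exact Function.iterate_mod_minimalPeriod_eq
    · rintro ⟨j, -, rfl⟩
      exact pow_pow_mem cycle_pow hγ j
  have hinj : Set.InjOn (fun j : ℕ => γ ^ p ^ j) (Set.Iio t) := by
    have := Function.iterate_injOn_Iio_minimalPeriod (f := φ) (x := γ)
    intro a ha b hb hab
    refine this ha hb ?_
    simp only [hφ, iterate_pow_eq]
    exact hab
  have hlen : cycleLength τ = t := by
    rw [cycleLength, himg, hinj.ncard_image]
    simp
  rw [hlen]
  refine ⟨htpos, ?_, himg⟩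
  rw [← iterate_pow_eq]
  exact Function.isPeriodicPt_minimalPeriod φ γ

theorem one_le_cycleLength (hC : (cycle τ).Nonempty) : 1 ≤ cycleLength τ :=
  (cycle_eq_image hC.choose_spec).1

theorem pow_cycleLength {γ : Kˣ} (hγ : γ ∈ cycle τ) : γ ^ p ^ cycleLength τ = γ :=
  (cycle_eq_image hγ).2.1

theorem finite_cycle : (cycle τ).Finite := by
  rcases (cycle τ).eq_empty_or_nonempty with h | ⟨γ, hγ⟩
  · rw [h]; exact Set.finite_empty
  · rw [(cycle_eq_image hγ).2.2]
    exact (Set.finite_Iio _).image _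

end Cycle

/-! ### Linear systems along a cycle -/

section Solve

/-- Telescoping around the cycle. Dividing by `q ^ e - 1` solves `q v(γ ^ p) - v(γ) = β γ`. -/
theorem geometric_cyclic_solution (q : K) (e : ℕ) (β : Kˣ → K) {γ : Kˣ} (hγ : γ ^ p ^ e = γ) :
    q * ∑ j ∈ Finset.range e, q ^ j * β ((γ ^ p) ^ p ^ j) -
      ∑ j ∈ Finset.range e, q ^ j * β (γ ^ p ^ j) = (q ^ e - 1) * β γ := by
  have h1 : ∀ j, (γ ^ p) ^ p ^ j = γ ^ p ^ (j + 1) := fun j => by rw [← pow_mul, ← pow_succ']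
  simp_rw [h1]
  rw [Finset.mul_sum, ← Finset.sum_sub_distrib]
  have h2 := Finset.sum_range_sub (fun j => q ^ j * β (γ ^ p ^ j)) e
  rw [hγ] at h2
  simp only [pow_zero, pow_one, one_mul] at h2
  rw [sub_mul, one_mul, ← h2]
  exact Finset.sum_congr rfl fun j _ => by rw [pow_succ]; ring

/-- The degenerate case `q = 1`: linear weights replace geometric ones, and the equation is solved
only up to the average of `β`. -/
theorem arithmetic_cyclic_solution (e : ℕ) (β : Kˣ → K) (γ : Kˣ) :
    ∑ j ∈ Finset.range e, ((j : K) + 1 - e) * β ((γ ^ p) ^ p ^ j) -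
      ∑ j ∈ Finset.range e, ((j : K) + 1 - e) * β (γ ^ p ^ j) =
      e * β γ - ∑ j ∈ Finset.range e, β (γ ^ p ^ j) := by
  have h1 : ∀ j, (γ ^ p) ^ p ^ j = γ ^ p ^ (j + 1) := fun j => by rw [← pow_mul, ← pow_succ']
  simp_rw [h1]
  -- The weight `j - e` vanishes at the upper end `j = e`, so only the term `e β γ` survives.
  have h2 := Finset.sum_range_sub (fun j : ℕ => ((j : K) - e) * β (γ ^ p ^ j)) e
  simp only [pow_zero, pow_one, sub_self, zero_mul, Nat.cast_zero, zero_sub] at h2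
  have h3 : (e : K) * β γ = ∑ j ∈ Finset.range e,
      (((j + 1 : ℕ) : K) - e) * β (γ ^ p ^ (j + 1)) -
      ∑ j ∈ Finset.range e, ((j : K) - e) * β (γ ^ p ^ j) := by
    rw [← Finset.sum_sub_distrib, h2]; ring
  rw [h3, ← Finset.sum_sub_distrib, ← Finset.sum_sub_distrib, ← Finset.sum_sub_distrib]
  exact Finset.sum_congr rfl fun j _ => by push_cast; ring

theorem sum_cyclic_shift (e : ℕ) (β : Kˣ → K) {γ : Kˣ} (hγ : γ ^ p ^ e = γ) :
    ∑ j ∈ Finset.range e, β ((γ ^ p) ^ p ^ j) = ∑ j ∈ Finset.range e, β (γ ^ p ^ j) := by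
  have := geometric_cyclic_solution 1 e β hγ
  simp only [one_pow, one_mul, sub_self, zero_mul] at this
  exact sub_eq_zero.1 this

variable {lam : ℤ} {M : ℕ}

theorem zpow_neg_mul_pow (γ : Kˣ) (k : ℤ) (j : ℕ) :
    (γ : K) ^ (-(k * (p : ℤ) ^ j)) = ((γ ^ p ^ j : Kˣ) : K) ^ (-k) := by
  rw [Units.val_pow_eq_pow_val, ← zpow_natCast, ← zpow_mul]
  congr 1
  push_cast
  ring

theorem sum_fin_eq_sum_Icc {M k : ℕ} (F : ℕ → K) :
    ∑ i : Fin (M - k), F (k + 1 + i) = ∑ s ∈ Finset.Icc (k + 1) M, F s := by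
  rw [Fin.sum_univ_eq_sum_range (fun i => F (k + 1 + i)), ← Finset.Ico_add_one_right_eq_Icc,
    Finset.sum_Ico_eq_sum_range]
  congr 2
  omega

theorem cycleMap_eq_twist {d : ℕ → Kˣ → K} {k : ℕ} {γ : Kˣ} (h : ∀ s, M < s → d s (γ ^ p) = 0) :
    cycleMap p lam d k γ = twist p lam M 1 d k γ - d k γ := by
  have h1 : (∑ᶠ (s : ℕ) (_ : k ≤ s), mahlerCoeff p s k 1 (γ : K) * d s (γ ^ p)) =
      ∑ s ∈ Finset.Icc k M, mahlerCoeff p s k 1 (γ : K) * d s (γ ^ p) := by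
    simp_rw [finsum_eq_if]
    rw [finsum_eq_sum_of_support_subset (s := Finset.Icc k M)]
    · refine Finset.sum_congr rfl fun s hs => ?_
      rw [if_pos (Finset.mem_Icc.1 hs).1]
    · intro s hs
      simp only [Function.mem_support, ne_eq, ite_eq_right_iff, Classical.not_imp] at hs
      rw [Finset.coe_Icc, Set.mem_Icc]
      refine ⟨hs.1, ?_⟩
      by_contra h'
      exact hs.2 (by rw [h s (by omega), mul_zero])
  rw [cycleMap, h1, twist]
  simp only [Nat.cast_one, mul_one, pow_one]
  ring

variable [CharZero K]

/-- Splits off the diagonal term `s = k`. For the normalised unknown `γ ^ (-k) d_k(γ)` the operator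
becomes multiplication by `p ^ (lam - k)` along the cycle, plus terms from higher degrees. -/
theorem twist_one_eq (hp : 0 < p) {d : ℕ → Kˣ → K} {k : ℕ} (hkM : k ≤ M) (γ : Kˣ) :
    twist p lam M 1 d k γ =
      (γ : K) ^ (k : ℤ) * ((p : K) ^ (lam - k) * (((γ ^ p : Kˣ) : K) ^ (-(k : ℤ)) * d k (γ ^ p))) +
      (p : K) ^ lam * ∑ s ∈ Finset.Icc (k + 1) M, mahlerCoeff p s k 1 (γ : K) * d s (γ ^ p) := by
  have hp0 : (p : K) ≠ 0 := by exact_mod_cast hp.ne'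
  have h1 : Finset.Icc k M = insert k (Finset.Icc (k + 1) M) :=
    (Finset.insert_Icc_add_one_left_eq_Icc hkM).symm
  rw [twist, h1, Finset.sum_insert (by simp), mahlerCoeff_eq p hp k k 1 γ.ne_zero, if_pos le_rfl,
    univMahlerCoeff_self]
  have h2 : (((((p : ℚ) ^ 1)⁻¹ ^ k : ℚ)) : K) * (γ : K) ^ ((k : ℤ) - (k : ℤ) * (p : ℤ) ^ 1) =
      (p : K) ^ (-(k : ℤ)) * ((γ : K) ^ (k : ℤ) * ((γ ^ p : Kˣ) : K) ^ (-(k : ℤ))) := by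
    rw [Units.val_pow_eq_pow_val, ← zpow_natCast (γ : K) p, ← zpow_mul, ← zpow_add₀ γ.ne_zero]
    congr 1
    · rw [zpow_neg, zpow_natCast]
      push_cast
      rw [pow_one, inv_pow]
    · congr 1
      ring
  rw [h2, sub_eq_add_neg, zpow_add₀ hp0]
  simp only [Nat.cast_one, mul_one, pow_one]
  ring

theorem solution_of_geometric_formula (hp : 0 < p) {c d : ℕ → Kˣ → K} {k e : ℕ} (hkM : k ≤ M)
    (hq : (p : K) ^ ((lam - k) * (e : ℤ)) ≠ 1)
    (hd : ∀ γ, d k γ = (γ : K) ^ (k : ℤ) / ((p : K) ^ ((lam - k) * (e : ℤ)) - 1) *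
      ∑ j ∈ Finset.range e, (p : K) ^ ((lam - k) * (j : ℤ)) *
        (((γ ^ p ^ j : Kˣ) : K) ^ (-(k : ℤ)) * (c k (γ ^ p ^ j) - (p : K) ^ lam *
          ∑ s ∈ Finset.Icc (k + 1) M,
            mahlerCoeff p s k 1 ((γ ^ p ^ j : Kˣ) : K) * d s ((γ ^ p ^ j) ^ p))))
    {γ : Kˣ} (hγ : γ ^ p ^ e = γ) :
    twist p lam M 1 d k γ - d k γ = c k γ := by
  set β : Kˣ → K := fun γ => (γ : K) ^ (-(k : ℤ)) * (c k γ - (p : K) ^ lam *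
    ∑ s ∈ Finset.Icc (k + 1) M, mahlerCoeff p s k 1 (γ : K) * d s (γ ^ p)) with hβ
  set q : K := (p : K) ^ (lam - k) with hqdef
  have hqpow : ∀ j : ℕ, (p : K) ^ ((lam - k) * (j : ℤ)) = q ^ j := fun j => by
    rw [hqdef, zpow_mul, zpow_natCast]
  simp_rw [hqpow] at hd hq
  have hne : q ^ e - 1 ≠ 0 := sub_ne_zero.2 hq
  have h1 : ∀ γ : Kˣ, (γ : K) ^ (-(k : ℤ)) * d k γ =
      (q ^ e - 1)⁻¹ * ∑ j ∈ Finset.range e, q ^ j * β (γ ^ p ^ j) := by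
    intro γ
    rw [hd γ]
    have : (γ : K) ^ (-(k : ℤ)) * (γ : K) ^ (k : ℤ) = 1 := by
      rw [← zpow_add₀ γ.ne_zero]; simp
    rw [div_eq_mul_inv, mul_assoc, ← mul_assoc, this, one_mul]
  have hdk : d k γ = (γ : K) ^ (k : ℤ) * ((γ : K) ^ (-(k : ℤ)) * d k γ) := by
    rw [← mul_assoc, ← zpow_add₀ γ.ne_zero]; simp
  have hsol : q * ((q ^ e - 1)⁻¹ * ∑ j ∈ Finset.range e, q ^ j * β ((γ ^ p) ^ p ^ j)) -
      (q ^ e - 1)⁻¹ * ∑ j ∈ Finset.range e, q ^ j * β (γ ^ p ^ j) = β γ := by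
    have := geometric_cyclic_solution q e β hγ
    rw [mul_left_comm, ← mul_sub, this, inv_mul_cancel_left₀ hne]
  have hβγ : (γ : K) ^ (k : ℤ) * β γ = c k γ - (p : K) ^ lam *
      ∑ s ∈ Finset.Icc (k + 1) M, mahlerCoeff p s k 1 (γ : K) * d s (γ ^ p) := by
    rw [hβ, ← mul_assoc, ← zpow_add₀ γ.ne_zero]; simp
  rw [twist_one_eq hp hkM, hdk, h1, h1]
  linear_combination (γ : K) ^ (k : ℤ) * hsol + hβγ

/-- In degree `lam` the multiplier is `1`. The defect `A` is the average of the normalised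
right-hand side over the orbit, hence constant along it. -/
theorem solution_of_arithmetic_formula (hp : 0 < p) {c d : ℕ → Kˣ → K} {k e : ℕ} (hkM : k ≤ M)
    (he : 1 ≤ e) (hk : (k : ℤ) = lam)
    (hd : ∀ γ, d k γ = (γ : K) ^ (k : ℤ) / (e : K) *
      ∑ j ∈ Finset.range e, ((j : K) + 1 - (e : K)) *
        (((γ ^ p ^ j : Kˣ) : K) ^ (-(k : ℤ)) * (c k (γ ^ p ^ j) - (p : K) ^ lam *
          ∑ s ∈ Finset.Icc (k + 1) M,
            mahlerCoeff p s k 1 ((γ ^ p ^ j : Kˣ) : K) * d s ((γ ^ p ^ j) ^ p)))) :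
    ∃ A : Kˣ → K, ∀ γ : Kˣ, γ ^ p ^ e = γ → A (γ ^ p) = A γ ∧
      twist p lam M 1 d k γ - d k γ = c k γ - (γ : K) ^ (k : ℤ) * A γ := by
  set β : Kˣ → K := fun γ => (γ : K) ^ (-(k : ℤ)) * (c k γ - (p : K) ^ lam *
    ∑ s ∈ Finset.Icc (k + 1) M, mahlerCoeff p s k 1 (γ : K) * d s (γ ^ p)) with hβ
  have he0 : (e : K) ≠ 0 := by exact_mod_cast (by omega : e ≠ 0)
  subst hk
  refine ⟨fun γ => (e : K)⁻¹ * ∑ j ∈ Finset.range e, β (γ ^ p ^ j), fun γ hγ => ⟨?_, ?_⟩⟩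
  · simp only [sum_cyclic_shift e β hγ]
  have h1 : ∀ γ : Kˣ, (γ : K) ^ (-(k : ℤ)) * d k γ =
      (e : K)⁻¹ * ∑ j ∈ Finset.range e, ((j : K) + 1 - (e : K)) * β (γ ^ p ^ j) := by
    intro γ
    rw [hd γ]
    have : (γ : K) ^ (-(k : ℤ)) * (γ : K) ^ (k : ℤ) = 1 := by
      rw [← zpow_add₀ γ.ne_zero]; simp
    rw [div_eq_mul_inv, mul_assoc, ← mul_assoc, this, one_mul]
  have hdk : d k γ = (γ : K) ^ (k : ℤ) * ((γ : K) ^ (-(k : ℤ)) * d k γ) := by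
    rw [← mul_assoc, ← zpow_add₀ γ.ne_zero]; simp
  have hsol : (e : K)⁻¹ * ∑ j ∈ Finset.range e, ((j : K) + 1 - (e : K)) * β ((γ ^ p) ^ p ^ j) -
      (e : K)⁻¹ * ∑ j ∈ Finset.range e, ((j : K) + 1 - (e : K)) * β (γ ^ p ^ j) =
      β γ - (e : K)⁻¹ * ∑ j ∈ Finset.range e, β (γ ^ p ^ j) := by
    have := arithmetic_cyclic_solution (p := p) e β γ
    rw [← mul_sub, this, mul_sub, inv_mul_cancel_left₀ he0]
  have hβγ : (γ : K) ^ (k : ℤ) * β γ = c k γ - (p : K) ^ (k : ℤ) *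
      ∑ s ∈ Finset.Icc (k + 1) M, mahlerCoeff p s k 1 (γ : K) * d s (γ ^ p) := by
    rw [hβ, ← mul_assoc, ← zpow_add₀ γ.ne_zero]; simp
  rw [twist_one_eq hp hkM, hdk, h1, h1, sub_self, zpow_zero]
  linear_combination (γ : K) ^ (k : ℤ) * hsol + hβγ

end Solve

end

section

variable {K : Type*} [Field K] {p : ℕ} {lam : ℤ} {M e : ℕ}

/-! ### Sections of the cycle map -/

section Sections

theorem zeroSectionAux_of_lt {c : ℕ → Kˣ → K} {k : ℕ} (hk : M < k) (γ : Kˣ) :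
    zeroSectionAux p lam e M c k γ = 0 := by
  rw [zeroSectionAux, if_pos hk]

theorem kernelVec_of_lt {k : ℕ} (hk : lam < k) (γ : Kˣ) : kernelVec p lam e k γ = 0 := by
  rw [kernelVec, if_pos hk]

theorem kernelVec_self {k : ℕ} (hk : (k : ℤ) = lam) (γ : Kˣ) :
    kernelVec p lam e k γ = (γ : K) ^ (k : ℤ) := by
  rw [kernelVec, if_neg (by omega), if_pos hk, hk]

variable [CharZero K]

theorem zpow_mul_ne_one (hp : 2 ≤ p) (he : 1 ≤ e) {k : ℕ} (hk : (k : ℤ) ≠ lam) :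
    (p : K) ^ ((lam - k) * (e : ℤ)) ≠ 1 := by
  rw [ne_eq, natCast_zpow_eq_one_iff hp, mul_eq_zero, not_or]
  omega

theorem twist_zeroSectionAux_of_ne (hp : 2 ≤ p) (he : 1 ≤ e) (c : ℕ → Kˣ → K) {k : ℕ}
    (hkM : k ≤ M) (hk : (k : ℤ) ≠ lam) {γ : Kˣ} (hγ : γ ^ p ^ e = γ) :
    twist p lam M 1 (zeroSectionAux p lam e M c) k γ - zeroSectionAux p lam e M c k γ = c k γ := by
  refine solution_of_geometric_formula (by omega) hkM (zpow_mul_ne_one hp he hk) (fun γ => ?_) hγ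
  conv_lhs => rw [zeroSectionAux, if_neg (by omega), if_pos hk]
  congr 1
  refine Finset.sum_congr rfl fun j _ => ?_
  rw [mul_assoc, zpow_neg_mul_pow, ← pow_mul, ← pow_succ, Units.val_pow_eq_pow_val,
    ← sum_fin_eq_sum_Icc (M := M)
      (fun s => mahlerCoeff p s k 1 ((γ : K) ^ p ^ j) * zeroSectionAux p lam e M c s (γ ^ p ^ (j + 1)))]

theorem twist_zeroSectionAux_of_eq (hp : 2 ≤ p) (he : 1 ≤ e) (c : ℕ → Kˣ → K) {k : ℕ}
    (hkM : k ≤ M) (hk : (k : ℤ) = lam) :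
    ∃ A : Kˣ → K, ∀ γ : Kˣ, γ ^ p ^ e = γ → A (γ ^ p) = A γ ∧
      twist p lam M 1 (zeroSectionAux p lam e M c) k γ - zeroSectionAux p lam e M c k γ =
        c k γ - (γ : K) ^ (k : ℤ) * A γ := by
  refine solution_of_arithmetic_formula (by omega) hkM he hk (fun γ => ?_)
  conv_lhs => rw [zeroSectionAux, if_neg (by omega), if_neg (not_not.2 hk), ← hk]
  subst hk
  congr 1
  refine Finset.sum_congr rfl fun j _ => ?_
  rw [mul_assoc, zpow_neg_mul_pow, ← pow_mul, ← pow_succ, Units.val_pow_eq_pow_val,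
    ← sum_fin_eq_sum_Icc (M := M)
      (fun s => mahlerCoeff p s k 1 ((γ : K) ^ p ^ j) * zeroSectionAux p k e M c s (γ ^ p ^ (j + 1)))]

/-- Below degree `lam` the recursion for `w` is the geometric formula with zero right-hand side. In
degree `lam` the multiplier is `1` and the normalised entry is the constant `1`. -/
theorem twist_kernelVec (hp : 2 ≤ p) (he : 1 ≤ e) (hM : lam.toNat ≤ M) (k : ℕ)
    {γ : Kˣ} (hγ : γ ^ p ^ e = γ) :
    twist p lam M 1 (kernelVec p lam e) k γ - kernelVec p lam e k γ = 0 := by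
  have hp0 : (p : K) ≠ 0 := by exact_mod_cast (by omega : p ≠ 0)
  rw [← twist_mono hM fun s hs => kernelVec_of_lt (by omega) _]
  rcases lt_trichotomy (k : ℤ) lam with hk | hk | hk
  · refine (solution_of_geometric_formula (c := 0) (by omega) (by omega)
      (zpow_mul_ne_one hp he hk.ne) (fun γ => ?_) hγ)
    conv_lhs => rw [kernelVec, if_neg (by omega), if_neg hk.ne]
    have hne : (p : K) ^ ((lam - k) * (e : ℤ)) - 1 ≠ 0 := sub_ne_zero.2 (zpow_mul_ne_one hp he hk.ne)
    have e1 : (p : K) ^ lam * (γ : K) ^ (k : ℤ) / (1 - (p : K) ^ ((lam - k) * (e : ℤ))) =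
        (γ : K) ^ (k : ℤ) / ((p : K) ^ ((lam - k) * (e : ℤ)) - 1) * (-(p : K) ^ lam) := by
      rw [← neg_sub, div_neg]
      field_simp
    rw [e1, mul_assoc, Finset.mul_sum]
    congr 1
    refine Finset.sum_congr rfl fun j _ => ?_
    rw [← sum_fin_eq_sum_Icc (M := lam.toNat)
      (fun s => mahlerCoeff p s k 1 ((γ ^ p ^ j : Kˣ) : K) * kernelVec p lam e s ((γ ^ p ^ j) ^ p))]
    simp only [Pi.zero_apply, zero_sub, Finset.mul_sum, mul_neg, neg_mul, Finset.sum_neg_distrib]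
    congr 1
    refine Finset.sum_congr rfl fun i _ => ?_
    rw [mahlerCoeff_eq p (by omega) _ _ _ (Units.ne_zero _), if_pos (by omega), ← pow_mul, ← pow_succ,
      zpow_neg_mul_pow]
    have e2 : ((γ ^ p ^ j : Kˣ) : K) ^ (-(k : ℤ)) *
        ((γ ^ p ^ j : Kˣ) : K) ^ ((k : ℤ) - ((k + 1 + (i : ℕ) : ℕ) : ℤ) * (p : ℤ) ^ 1) =
        ((γ ^ p ^ (j + 1) : Kˣ) : K) ^ (-((k + 1 + (i : ℕ) : ℕ) : ℤ)) := by
      rw [← zpow_add₀ (Units.ne_zero _), pow_pow_add, Units.val_pow_eq_pow_val (γ ^ p ^ j),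
        ← zpow_natCast (_ : K) (p ^ 1), ← zpow_mul]
      congr 1
      push_cast
      ring
    rw [← e2]
    ring
  · rw [twist_one_eq (by omega) (by omega), Finset.sum_eq_zero]
    · rw [kernelVec_self hk, kernelVec_self hk, ← zpow_add₀ (Units.ne_zero _), hk]
      simp
    · intro s hs
      have := Finset.mem_Icc.1 hs
      rw [kernelVec_of_lt (by omega), mul_zero]
  · rw [twist_eq_zero, kernelVec_of_lt (by omega), sub_zero]
    intro s hs _
    exact kernelVec_of_lt (by omega) _

/-- Away from degree `lam`, a solution of the homogeneous system on a cycle vanishes as soon as it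
vanishes in higher degrees. -/
theorem eq_zero_of_twist_eq (hp : 2 ≤ p) (he : 1 ≤ e) {d : ℕ → Kˣ → K} {k : ℕ} (hkM : k ≤ M)
    (hk : (k : ℤ) ≠ lam) {S : Set Kˣ} (hS : ∀ γ ∈ S, γ ^ p ∈ S) (hSe : ∀ γ ∈ S, γ ^ p ^ e = γ)
    (hd : ∀ γ ∈ S, twist p lam M 1 d k γ - d k γ = 0)
    (hds : ∀ s, k < s → s ≤ M → ∀ γ ∈ S, d s γ = 0) : ∀ γ ∈ S, d k γ = 0 := by
  have hstep : ∀ γ ∈ S, (γ : K) ^ (-(k : ℤ)) * d k γ =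
      (p : K) ^ (lam - k) * (((γ ^ p : Kˣ) : K) ^ (-(k : ℤ)) * d k (γ ^ p)) := by
    intro γ hγ
    have h1 := hd γ hγ
    rw [twist_one_eq (by omega) hkM, Finset.sum_eq_zero, mul_zero, add_zero, sub_eq_zero] at h1
    · rw [← h1, ← mul_assoc, ← zpow_add₀ γ.ne_zero]
      simp
    · intro s hs
      have := Finset.mem_Icc.1 hs
      rw [hds s (by omega) (by omega) _ (hS γ hγ), mul_zero]
  -- One full turn around the cycle multiplies the normalised entry by `p ^ ((lam - k) e) ≠ 1`.
  have hiter : ∀ n : ℕ, ∀ γ ∈ S, (γ : K) ^ (-(k : ℤ)) * d k γ =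
      ((p : K) ^ (lam - k)) ^ n * (((γ ^ p ^ n : Kˣ) : K) ^ (-(k : ℤ)) * d k (γ ^ p ^ n)) := by
    intro n
    induction n with
    | zero => simp
    | succ n ih =>
      intro γ hγ
      rw [ih γ hγ, hstep _ (pow_pow_mem hS hγ n), ← pow_mul, ← pow_succ]
      ring
  intro γ hγ
  have h1 := hiter e γ hγ
  rw [hSe γ hγ, ← zpow_natCast, ← zpow_mul] at h1
  have h2 : ((p : K) ^ ((lam - k) * (e : ℤ)) - 1) * ((γ : K) ^ (-(k : ℤ)) * d k γ) = 0 := by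
    rw [sub_mul, one_mul, ← h1, sub_self]
  rcases mul_eq_zero.1 h2 with h3 | h3
  · exact absurd (sub_eq_zero.1 h3) (zpow_mul_ne_one hp he hk)
  · exact (mul_eq_zero.1 h3).resolve_left (zpow_ne_zero _ γ.ne_zero)

end Sections

end

section

variable {K : Type*} [Field K] {p : ℕ} {lam : ℤ} {M : ℕ}

/-! ### Torsion trees -/

section Univ

/-- The action of `(p ^ lam * σ) ^ n` on polar coefficients, in the form normalised by powers of
the poles: `η` stands for the `p ^ n`-th power of the pole. -/
def univTwist (p : ℕ) (lam : ℤ) (M n : ℕ) (d : ℕ → Kˣ → K) (k : ℕ) (η : Kˣ) : K :=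
  (p : K) ^ (lam * (n : ℤ)) * ∑ s ∈ Finset.Icc k M,
    ((univMahlerCoeff p s k n : ℚ) : K) * (η : K) ^ (-(s : ℤ)) * d s η

theorem univTwist_mono {n M' : ℕ} {d : ℕ → Kˣ → K} {k : ℕ} {η : Kˣ} (hM : M ≤ M')
    (h : ∀ s, M < s → d s η = 0) : univTwist p lam M n d k η = univTwist p lam M' n d k η := by
  simp only [univTwist]
  congr 1
  apply Finset.sum_subset (Finset.Icc_subset_Icc_right hM)
  intro s hs hs'
  rw [h s, mul_zero]
  simp only [Finset.mem_Icc] at hs hs'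
  omega

variable [CharZero K]

/-- Since `V^s_{k,n}(ξ)` is `𝕍^s_{k,n} ξ ^ (k - s p ^ n)`, apart from the factor `ξ ^ k` only `ξ ^
(p ^ n)` matters. Values can therefore be compared at different roots of one element. -/
theorem twist_eq_univTwist (hp : 0 < p) (n : ℕ) (d : ℕ → Kˣ → K) (k : ℕ) (ξ : Kˣ) :
    twist p lam M n d k ξ = (ξ : K) ^ (k : ℤ) * univTwist p lam M n d k (ξ ^ p ^ n) := by
  rw [twist, univTwist, mul_left_comm]
  congr 1
  rw [Finset.mul_sum]
  refine Finset.sum_congr rfl fun s hs => ?_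
  rw [mahlerCoeff_eq p hp _ _ _ ξ.ne_zero, if_pos (Finset.mem_Icc.1 hs).1,
    ← zpow_neg_mul_pow, sub_eq_add_neg, zpow_add₀ ξ.ne_zero]
  ring

theorem univTwist_eq_twist (hp : 0 < p) (n : ℕ) (d : ℕ → Kˣ → K) (k : ℕ) (ξ : Kˣ) :
    univTwist p lam M n d k (ξ ^ p ^ n) = (ξ : K) ^ (-(k : ℤ)) * twist p lam M n d k ξ := by
  rw [twist_eq_univTwist hp, ← mul_assoc, ← zpow_add₀ ξ.ne_zero]
  simp

theorem univTwist_twist (hp : 0 < p) (n : ℕ) (d : ℕ → Kˣ → K) {k : ℕ} (hk : 1 ≤ k) (ξ : Kˣ) :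
    univTwist p lam M n (twist p lam M 1 d) k (ξ ^ p ^ n) =
      univTwist p lam M (n + 1) d k (ξ ^ p ^ (n + 1)) := by
  rw [univTwist_eq_twist hp, univTwist_eq_twist hp, twist_twist hp _ _ _ hk]

/-- Only `s = lam` contributes, and there the powers of `p` and of `η` cancel. This makes the
multiple of `w` visible in an average. -/
theorem univTwist_kernelVec (hp : 0 < p) (e n : ℕ) {l : ℕ} (hl : (l : ℤ) = lam) (hlM : l ≤ M)
    (η : Kˣ) : univTwist p lam M n (kernelVec p lam e) l η = 1 := by
  have hp0 : (p : K) ≠ 0 := by exact_mod_cast hp.ne'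
  rw [univTwist, Finset.sum_eq_single_of_mem l (Finset.mem_Icc.2 ⟨le_rfl, hlM⟩)]
  · rw [univMahlerCoeff_self, kernelVec_self hl, mul_assoc, ← zpow_add₀ η.ne_zero, neg_add_cancel,
      zpow_zero, mul_one, ← hl]
    have : (p : K) ^ ((l : ℤ) * (n : ℤ)) = ((p : K) ^ n) ^ l := by
      rw [← pow_mul, ← zpow_natCast]
      congr 1
      push_cast
      ring
    rw [this]
    push_cast
    rw [← mul_pow, mul_inv_cancel₀ (pow_ne_zero _ hp0), one_pow]
  · intro s hs hsl
    have := Finset.mem_Icc.1 hs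
    rw [kernelVec_of_lt (by omega), mul_zero]

end Univ

/-! ### Fibres of the power maps over a cycle -/

section Fibers

variable {τ : MahlerTree K p}

theorem cycle_pow_injective {δ ε : Kˣ} (hδ : δ ∈ cycle τ) (hε : ε ∈ cycle τ)
    (h : δ ^ p = ε ^ p) : δ = ε := by
  have he := one_le_cycleLength ⟨δ, hδ⟩
  have key : ∀ γ ∈ cycle τ, (γ ^ p) ^ p ^ (cycleLength τ - 1) = γ := by
    intro γ hγ
    rw [← pow_mul, ← pow_succ', Nat.sub_add_cancel he, pow_cycleLength hγ]
  rw [← key δ hδ, h, key ε hε]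

theorem exists_cycle_root {γ : Kˣ} (hγ : γ ∈ cycle τ) : ∃ γ' ∈ cycle τ, γ' ^ p = γ := by
  have he := one_le_cycleLength ⟨γ, hγ⟩
  refine ⟨γ ^ p ^ (cycleLength τ - 1), pow_pow_mem cycle_pow hγ _, ?_⟩
  rw [← pow_mul, ← pow_succ, Nat.sub_add_cancel he, pow_cycleLength hγ]

theorem pow_mem_cycle_of_le {α : Kˣ} {n m : ℕ} (h : α ^ p ^ n ∈ cycle τ) (hnm : n ≤ m) :
    α ^ p ^ m ∈ cycle τ := by
  obtain ⟨i, rfl⟩ := Nat.exists_eq_add_of_le hnm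
  rw [pow_pow_add]
  exact pow_pow_mem cycle_pow h i

theorem pow_mem_cycle_of_torsionHeight (hC : (cycle τ).Nonempty) {α : Kˣ} (hα : α ∈ elems τ)
    {h : ℕ} (hh : torsionHeight τ α = h) : α ^ p ^ h ∈ cycle τ := by
  rw [← hh]
  exact heightTo_spec (exists_pow_mem_cycle hC α hα)

variable [CharZero K] [IsAlgClosed K]

theorem ncard_units_pow_eq {n : ℕ} (hn : 0 < n) (γ : Kˣ) : {α : Kˣ | α ^ n = γ}.ncard = n := by
  have : NeZero n := ⟨hn.ne'⟩
  have : NeZero (n : K) := ⟨by exact_mod_cast hn.ne'⟩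
  obtain ⟨β, hβ⟩ := exists_units_pow_eq hn γ
  have h1 : {α : Kˣ | α ^ n = γ} = (fun α => α * β) '' (rootsOfUnity n K : Set Kˣ) := by
    ext α
    simp only [Set.mem_ofPred_eq, Set.mem_image, SetLike.mem_coe, mem_rootsOfUnity]
    constructor
    · intro h
      exact ⟨α * β⁻¹, by rw [mul_pow, inv_pow, h, hβ, mul_inv_cancel], by simp⟩
    · rintro ⟨ζ, hζ, rfl⟩
      rw [mul_pow, hζ, hβ, one_mul]
  rw [h1, (mul_left_injective β).injOn.ncard_image]
  exact HasEnoughRootsOfUnity.natCard_rootsOfUnity K n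

/-- There are `p ≥ 2` roots, and only one can lie in the cycle, where `x ↦ x ^ p` is injective. -/
theorem exists_root_not_mem_cycle (hp : 2 ≤ p) {γ : Kˣ} (hγ : γ ∈ cycle τ) :
    ∃ β, β ^ p = γ ∧ β ∉ cycle τ := by
  by_contra! h
  obtain ⟨γ', hγ', hr⟩ := exists_cycle_root hγ
  have h1 : {α : Kˣ | α ^ p = γ} ⊆ {γ'} := fun β hβ =>
    cycle_pow_injective (h β hβ) hγ' ((show β ^ p = γ from hβ).trans hr.symm)
  have h2 := Set.ncard_le_ncard h1 (Set.finite_singleton _)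
  rw [ncard_units_pow_eq (by omega), Set.ncard_singleton] at h2
  omega

/-- Among the `p ^ h` roots of `γ`, those of smaller height are the `p ^ (h - 1)` ones lying over
the root `γ'` of `γ` in the cycle. This count is the normalising constant in `ω`. -/
theorem ncard_level_fiber (hp : 2 ≤ p) {h : ℕ} (hh : 1 ≤ h) {γ : Kˣ} (hγ : γ ∈ cycle τ) :
    {α | α ∈ level τ h ∧ α ^ p ^ h = γ}.ncard = p ^ h - p ^ (h - 1) := by
  have hp0 : 0 < p := by omega
  obtain ⟨γ', hγ', hr⟩ := exists_cycle_root hγ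
  have hsucc : ∀ α : Kˣ, α ^ p ^ h = (α ^ p ^ (h - 1)) ^ p := fun α => by
    rw [← pow_mul, ← pow_succ, Nat.sub_add_cancel hh]
  have h1 : {α | α ∈ level τ h ∧ α ^ p ^ h = γ} =
      {α : Kˣ | α ^ p ^ h = γ} \ {α : Kˣ | α ^ p ^ (h - 1) = γ'} := by
    ext α
    simp only [level, Set.mem_ofPred_eq, Set.mem_sdiff]
    constructor
    · rintro ⟨⟨hα, hht⟩, hαγ⟩
      refine ⟨hαγ, fun h' => ?_⟩
      have : torsionHeight τ α ≤ h - 1 := heightTo_le (S := cycle τ) (by rw [h']; exact hγ')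
      omega
    · rintro ⟨hαγ, hne⟩
      have hαC : α ^ p ^ h ∈ cycle τ := by rw [hαγ]; exact hγ
      refine ⟨⟨mem_elems_of_pow hαC.1, ?_⟩, hαγ⟩
      refine le_antisymm (heightTo_le hαC) ?_
      by_contra hlt
      have h2 : α ^ p ^ (h - 1) ∈ cycle τ :=
        pow_mem_cycle_of_le (heightTo_spec (p := p) ⟨h, hαC⟩) (by rw [torsionHeight] at hlt; rw [heightTo]; omega)
      exact hne (cycle_pow_injective h2 hγ' (by rw [← hsucc, hαγ, hr]))
  have hsub : {α : Kˣ | α ^ p ^ (h - 1) = γ'} ⊆ {α : Kˣ | α ^ p ^ h = γ} := by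
    intro α hα
    simp only [Set.mem_ofPred_eq] at hα ⊢
    rw [hsucc, hα, hr]
  rw [h1, Set.ncard_sdiff hsub (finite_units_pow_eq (pow_pos hp0 _) _),
    ncard_units_pow_eq (pow_pos hp0 _), ncard_units_pow_eq (pow_pos hp0 _)]

omit [CharZero K] [IsAlgClosed K] in
theorem finite_level (hp : 0 < p) (hC : (cycle τ).Nonempty) (h : ℕ) : (level τ h).Finite :=
  (finite_units_pow_mem (pow_pos hp h) (finite_cycle (τ := τ))).subset fun _ hα =>
    pow_mem_cycle_of_torsionHeight hC hα.1 hα.2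

theorem finsum_level_eq (hp : 2 ≤ p) (hC : (cycle τ).Nonempty) {h : ℕ} (hh : 1 ≤ h) (g : Kˣ → K) :
    ∑ᶠ α ∈ level τ h, g (α ^ p ^ h) =
      ((p : K) ^ h - (p : K) ^ (h - 1)) * ∑ᶠ γ ∈ cycle τ, g γ := by
  classical
  have hfin := finite_level (τ := τ) (by omega) hC h
  rw [finsum_mem_eq_finite_toFinset_sum _ hfin, finsum_mem_eq_finite_toFinset_sum _ finite_cycle,
    ← Finset.sum_fiberwise_of_maps_to (t := (finite_cycle (τ := τ)).toFinset)
      (g := fun α => α ^ p ^ h), Finset.mul_sum]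
  · refine Finset.sum_congr rfl fun γ hγ => ?_
    have hγ : γ ∈ cycle τ := by simpa using hγ
    rw [Finset.sum_congr rfl (g := fun _ => g γ)
      (fun α hα => by rw [(Finset.mem_filter.1 hα).2]), Finset.sum_const, nsmul_eq_mul]
    congr 1
    have h1 := ncard_level_fiber hp hh hγ
    have h2 : {α | α ∈ level τ h ∧ α ^ p ^ h = γ} =
        ((hfin.toFinset.filter fun α => α ^ p ^ h = γ : Finset Kˣ) : Set Kˣ) := by
      ext α; simp
    rw [h2, Set.ncard_coe_finset] at h1
    rw [h1, Nat.cast_sub (Nat.pow_le_pow_right (by omega) (by omega))]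
    push_cast
    rfl
  · intro α hα
    have hα : α ∈ level τ h := by simpa using hα
    simpa using pow_mem_cycle_of_torsionHeight hC hα.1 hα.2

omit [CharZero K] [IsAlgClosed K] in
theorem finsum_cycle_pow (g : Kˣ → K) :
    ∑ᶠ γ ∈ cycle τ, g (γ ^ p) = ∑ᶠ γ ∈ cycle τ, g γ := by
  refine finsum_mem_eq_of_bijOn (fun γ => γ ^ p) ⟨fun γ hγ => cycle_pow γ hγ, fun γ hγ δ hδ h =>
    cycle_pow_injective hγ hδ h, fun γ hγ => ?_⟩ fun _ _ => rfl
  obtain ⟨γ', h1, h2⟩ := exists_cycle_root hγ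
  exact ⟨γ', h1, h2⟩

end Fibers

/-! ### Sections of the cycle map attached to `f` -/

section Sections

variable {τ : MahlerTree K p} (f : RatFunc K)

theorem sSup_cycle_order_le :
    sSup {k : ℕ | 1 ≤ k ∧ ∃ γ ∈ cycle τ, coeffVec f k γ ≠ 0} ≤ treeOrder f τ := by
  refine csSup_le' ?_
  rintro k ⟨-, γ, hγ, h⟩
  by_contra h'
  exact h (coeffVec_of_treeOrder_lt f τ (by omega) hγ.1)

theorem coeffVec_of_sSup_cycle_order_lt {k : ℕ} (hk1 : 1 ≤ k)
    (hk : sSup {k : ℕ | 1 ≤ k ∧ ∃ γ ∈ cycle τ, coeffVec f k γ ≠ 0} < k) {γ : Kˣ}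
    (hγ : γ ∈ cycle τ) : coeffVec f k γ = 0 := by
  by_contra h
  have hmem : k ∈ {k : ℕ | 1 ≤ k ∧ ∃ γ ∈ cycle τ, coeffVec f k γ ≠ 0} := ⟨hk1, γ, hγ, h⟩
  refine absurd (le_csSup ⟨treeOrder f τ, ?_⟩ hmem) (not_le.2 hk)
  rintro k ⟨-, γ, hγ, h⟩
  by_contra h'
  exact h (coeffVec_of_treeOrder_lt f τ (by omega) hγ.1)

theorem zeroSection_of_lt {k : ℕ} (hk : treeOrder f τ < k) (γ : Kˣ) :
    zeroSection lam τ (coeffVec f) k γ = 0 :=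
  zeroSectionAux_of_lt ((sSup_cycle_order_le f).trans_lt hk) γ

theorem omegaSection_eq (w : K) {k : ℕ} (hk : 1 ≤ k) (γ : Kˣ) :
    omegaSection lam τ w (coeffVec f) k γ =
      zeroSection lam τ (coeffVec f) k γ + w * kernelVec p lam (cycleLength τ) k γ := by
  rw [omegaSection]
  split_ifs with h
  · rw [kernelVec_of_lt (by omega), mul_zero, add_zero]
  · rfl

theorem residualAverage_eq_zero (h : (treeOrder f τ : ℤ) < lam) : residualAverage lam f τ = 0 := by
  have : Finset.Icc lam.toNat (treeOrder f τ) = ∅ := Finset.Icc_eq_empty (by omega)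
  simp [residualAverage, this]

/-- The kernel vector has no entries above degree `lam`. If `lam` exceeds the order of `f`, the sums
defining `ω` are empty and `ω = 0`. -/
theorem omegaSection_of_lt {k : ℕ} (hk : treeOrder f τ < k) (γ : Kˣ) :
    omegaSection lam τ (residualAverage lam f τ) (coeffVec f) k γ = 0 := by
  rw [omegaSection_eq f _ (by omega), zeroSection_of_lt f hk, zero_add]
  rcases le_or_gt lam (treeOrder f τ) with h | h
  · rw [kernelVec_of_lt (by omega), mul_zero]
  · rw [residualAverage_eq_zero f h, zero_mul]

variable [CharZero K]

theorem twist_zeroSection_of_ne (hp : 2 ≤ p) (hM : treeOrder f τ ≤ M) {k : ℕ} (hk1 : 1 ≤ k)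
    (hk : (k : ℤ) ≠ lam) {γ : Kˣ} (hγ : γ ∈ cycle τ) :
    twist p lam M 1 (zeroSection lam τ (coeffVec f)) k γ - zeroSection lam τ (coeffVec f) k γ =
      coeffVec f k γ := by
  rw [zeroSection, ← twist_mono ((sSup_cycle_order_le f).trans hM)
    (fun s hs => zeroSectionAux_of_lt hs _)]
  by_cases hkM : k ≤ sSup {k : ℕ | 1 ≤ k ∧ ∃ γ ∈ cycle τ, coeffVec f k γ ≠ 0}
  · exact twist_zeroSectionAux_of_ne hp (one_le_cycleLength ⟨γ, hγ⟩) _ hkM hk (pow_cycleLength hγ)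
  · rw [twist_of_lt (by omega), zeroSectionAux_of_lt (by omega), sub_zero,
      coeffVec_of_sSup_cycle_order_lt f hk1 (by omega) hγ]

theorem twist_zeroSection_of_eq (hp : 2 ≤ p) (hM : treeOrder f τ ≤ M) {k : ℕ} (hk1 : 1 ≤ k)
    (hk : (k : ℤ) = lam) : ∃ A : Kˣ → K, ∀ γ ∈ cycle τ, A (γ ^ p) = A γ ∧
    twist p lam M 1 (zeroSection lam τ (coeffVec f)) k γ - zeroSection lam τ (coeffVec f) k γ =
      coeffVec f k γ - (γ : K) ^ (k : ℤ) * A γ := by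
  simp_rw [zeroSection, ← twist_mono ((sSup_cycle_order_le f).trans hM)
    (fun s hs => zeroSectionAux_of_lt hs _)]
  rcases (cycle τ).eq_empty_or_nonempty with h0 | hC
  · exact ⟨0, by simp [h0]⟩
  by_cases hkM : k ≤ sSup {k : ℕ | 1 ≤ k ∧ ∃ γ ∈ cycle τ, coeffVec f k γ ≠ 0}
  · obtain ⟨A, hA⟩ := twist_zeroSectionAux_of_eq hp (one_le_cycleLength hC) (coeffVec f) hkM hk
    exact ⟨A, fun γ hγ => hA γ (pow_cycleLength hγ)⟩
  · refine ⟨0, fun γ hγ => ⟨rfl, ?_⟩⟩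
    rw [twist_of_lt (by omega), zeroSectionAux_of_lt (by omega),
      coeffVec_of_sSup_cycle_order_lt f hk1 (by omega) hγ]
    simp

theorem twist_omegaSection (hp : 2 ≤ p) (hM : treeOrder f τ ≤ M) {k : ℕ} (hk1 : 1 ≤ k)
    {γ : Kˣ} (hγ : γ ∈ cycle τ) :
    twist p lam M 1 (omegaSection lam τ (residualAverage lam f τ) (coeffVec f)) k γ -
        omegaSection lam τ (residualAverage lam f τ) (coeffVec f) k γ =
      twist p lam M 1 (zeroSection lam τ (coeffVec f)) k γ -
        zeroSection lam τ (coeffVec f) k γ := by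
  -- The kernel equation needs a truncation bound of at least `lam`.
  have hMM : M ≤ max M lam.toNat := le_max_left _ _
  rw [twist_mono hMM (fun s hs => omegaSection_of_lt f (by omega) _),
    twist_mono hMM (fun s hs => zeroSection_of_lt f (by omega) _),
    twist_congr (d' := zeroSection lam τ (coeffVec f) +
      residualAverage lam f τ • kernelVec p lam (cycleLength τ))
      (fun s hs _ => by rw [omegaSection_eq f _ (by omega)]; rfl),
    twist_add, twist_smul, omegaSection_eq f _ hk1]
  linear_combination (residualAverage lam f τ) * twist_kernelVec (K := K) (M := max M lam.toNat)
    hp (one_le_cycleLength ⟨γ, hγ⟩) (le_max_right _ _) k (pow_cycleLength hγ)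

end Sections

end

section

variable {K : Type*} [Field K] {p : ℕ} {lam : ℤ} {M : ℕ}

/-! ### Residues at torsion trees and solvability -/

section TorsionResidue

variable {τ : MahlerTree K p} {f : RatFunc K}

theorem coeffVec_of_funHeight_lt {α : Kˣ} (hα : α ∈ elems τ)
    (h : funHeight f τ < torsionHeight τ α) {k : ℕ} (hk : 1 ≤ k) : coeffVec f k α = 0 := by
  refine coeffVec_of_not_mem_sing hα (fun hs => ?_) hk
  exact absurd (le_csSup ((finite_sing f τ).image _).bddAbove ⟨α, hs, rfl⟩) (not_le.2 h)

variable [CharZero K]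

/-- Solutions of the homogeneous system on a cycle vanish in a range of degrees not containing
`lam`, if they vanish in higher degrees. -/
theorem eq_zero_of_twist_eq_of_range {δ : ℕ → Kˣ → K} (hp : 2 ≤ p) (b B : ℕ) (hB : B ≤ M)
    (hlam : ∀ k : ℕ, b ≤ k → k ≤ B → (k : ℤ) ≠ lam)
    (hδ : ∀ k, b ≤ k → k ≤ B → ∀ γ ∈ cycle τ, twist p lam M 1 δ k γ - δ k γ = 0)
    (hδB : ∀ k, B < k → k ≤ M → ∀ γ ∈ cycle τ, δ k γ = 0) :
    ∀ k, b ≤ k → k ≤ B → ∀ γ ∈ cycle τ, δ k γ = 0 := by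
  have key : ∀ i k, B - k = i → b ≤ k → k ≤ B → ∀ γ ∈ cycle τ, δ k γ = 0 := by
    intro i
    induction i using Nat.strong_induction_on with
    | _ i ih =>
      intro k hi hbk hkB γ hγ
      refine eq_zero_of_twist_eq hp (one_le_cycleLength ⟨γ, hγ⟩) (hkB.trans hB) (hlam k hbk hkB)
        cycle_pow (fun γ hγ => pow_cycleLength hγ) (hδ k hbk hkB) (fun s hs hsM => ?_) γ hγ
      by_cases hsB : s ≤ B
      · exact ih (B - s) (by omega) s rfl (by omega) hsB
      · exact hδB s (by omega) hsM
  exact fun k => key _ k rfl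

/-- On a cycle, every solution differs from the `0`-section by a multiple of the kernel vector. -/
theorem exists_eq_zeroSection_add (hp : 2 ≤ p) (hC : (cycle τ).Nonempty)
    (hM : treeOrder f τ ≤ M) (hMl : lam.toNat ≤ M) {d : ℕ → Kˣ → K}
    (hd : ∀ γ ∈ cycle τ, ∀ k, 1 ≤ k → coeffVec f k γ = twist p lam M 1 d k γ - d k γ) :
    ∃ w : K, ∀ γ ∈ cycle τ, ∀ k, 1 ≤ k → k ≤ M →
      d k γ = zeroSection lam τ (coeffVec f) k γ + w * kernelVec p lam (cycleLength τ) k γ := by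
  have he := one_le_cycleLength hC
  set d₀ := zeroSection lam τ (coeffVec f) with hd₀
  have hne : ∀ k : ℕ, 1 ≤ k → (k : ℤ) ≠ lam → ∀ γ ∈ cycle τ,
      twist p lam M 1 (d - d₀) k γ - (d - d₀) k γ = 0 := by
    intro k hk hkl γ hγ
    have h1 := twist_zeroSection_of_ne f hp hM hk hkl hγ
    rw [hd γ hγ k hk] at h1
    rw [twist_sub, Pi.sub_apply, Pi.sub_apply]
    linear_combination -h1
  have hhigh : ∀ k, lam.toNat + 1 ≤ k → k ≤ M → ∀ γ ∈ cycle τ, (d - d₀) k γ = 0 :=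
    eq_zero_of_twist_eq_of_range hp (lam.toNat + 1) M le_rfl (fun k h1 _ => by omega)
      (fun k h1 _ => hne k (by omega) (by omega)) (fun k h1 h2 => by omega)
  rcases le_or_gt lam 0 with hl | hl
  · refine ⟨0, fun γ hγ k hk hkM => ?_⟩
    have := hhigh k (by omega) hkM γ hγ
    rw [Pi.sub_apply, Pi.sub_apply, sub_eq_zero] at this
    rw [this, zero_mul, add_zero]
  obtain ⟨l, rfl⟩ : ∃ l : ℕ, lam = l := ⟨lam.toNat, by omega⟩
  simp only [Int.toNat_natCast] at hMl hhigh
  have hl1 : 1 ≤ l := by omega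
  obtain ⟨A, hA⟩ := twist_zeroSection_of_eq (lam := (l : ℤ)) f hp hM hl1 rfl (τ := τ)
  -- In degree `lam` the normalised difference of two solutions changes by the defect `A` at each
  -- step of the cycle.
  set v : Kˣ → K := fun γ => (γ : K) ^ (-(l : ℤ)) * (d - d₀) l γ with hv
  have hvd : ∀ γ : Kˣ, (d - d₀) l γ = (γ : K) ^ (l : ℤ) * v γ := by
    intro γ
    rw [hv, ← mul_assoc, ← zpow_add₀ γ.ne_zero]
    simp
  have hstep : ∀ γ ∈ cycle τ, v (γ ^ p) - v γ = A γ := by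
    intro γ hγ
    have h1 := (hA γ hγ).2
    rw [hd γ hγ l hl1] at h1
    have h2 : twist p l M 1 (d - d₀) l γ - (d - d₀) l γ = (γ : K) ^ (l : ℤ) * A γ := by
      rw [twist_sub, Pi.sub_apply, Pi.sub_apply]
      linear_combination -h1
    rw [twist_one_eq (by omega) hMl, Finset.sum_eq_zero, hvd γ, sub_self, zpow_zero, one_mul,
      mul_zero, add_zero, ← mul_sub] at h2
    · exact mul_left_cancel₀ (zpow_ne_zero _ γ.ne_zero) h2
    · intro s hs
      have := Finset.mem_Icc.1 hs
      rw [hhigh s (by omega) this.2 _ (cycle_pow γ hγ), mul_zero]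
  have hAiter : ∀ γ ∈ cycle τ, ∀ j : ℕ, A (γ ^ p ^ j) = A γ := by
    intro γ hγ j
    induction j with
    | zero => simp
    | succ j ih => rw [pow_succ, pow_mul, (hA _ (pow_pow_mem cycle_pow hγ j)).1, ih]
  -- Summing the increments once around the cycle gives `e A = 0`.
  have hA0 : ∀ γ ∈ cycle τ, A γ = 0 := by
    intro γ hγ
    have h1 := Finset.sum_range_sub (fun j : ℕ => v (γ ^ p ^ j)) (cycleLength τ)
    rw [pow_cycleLength hγ, Finset.sum_congr rfl (g := fun _ => A γ), Finset.sum_const,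
      Finset.card_range, nsmul_eq_mul] at h1
    · simp only [pow_zero, pow_one, sub_self, mul_eq_zero, Nat.cast_eq_zero] at h1
      exact h1.resolve_left (by omega)
    · intro j _
      have := hstep _ (pow_pow_mem cycle_pow hγ j)
      rw [← pow_mul, ← pow_succ, hAiter γ hγ] at this
      exact this
  obtain ⟨γ₀, hγ₀⟩ := hC
  have hvconst : ∀ γ ∈ cycle τ, v γ = v γ₀ := by
    intro γ hγ
    obtain ⟨j, rfl⟩ := exists_eq_pow_of_mem_cycle hγ₀ hγ
    clear hγ
    induction j with
    | zero => simp
    | succ j ih =>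
      have hj := pow_pow_mem cycle_pow hγ₀ j
      have := hstep _ hj
      rw [hA0 _ hj, ← pow_mul, ← pow_succ, ih, sub_eq_zero] at this
      exact this
  -- Now `v` is constant, so subtracting this multiple of the kernel vector kills degree `lam`; the
  -- lower degrees follow because they are uniquely solvable.
  set δ : ℕ → Kˣ → K := (d - d₀) - v γ₀ • kernelVec p l (cycleLength τ) with hδ
  have hδe : ∀ k γ, δ k γ = (d - d₀) k γ - v γ₀ * kernelVec p l (cycleLength τ) k γ :=
    fun _ _ => rfl
  have hδhigh : ∀ k, l - 1 < k → k ≤ M → ∀ γ ∈ cycle τ, δ k γ = 0 := by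
    intro k hk hkM γ hγ
    rw [hδe]
    rcases (show l = k ∨ l < k by omega) with rfl | h
    · rw [kernelVec_self rfl, hvd, hvconst γ hγ]
      ring
    · rw [hhigh k h hkM γ hγ, kernelVec_of_lt (by omega), mul_zero, sub_zero]
  have hδlow := eq_zero_of_twist_eq_of_range (τ := τ) (lam := (l : ℤ)) (M := M) (δ := δ) hp 1 (l - 1)
    (by omega) (fun k h1 h2 => by omega) (fun k h1 h2 γ hγ => by
      have h3 := hne k h1 (by omega) γ hγ
      have h4 := twist_kernelVec (K := K) (M := M) (lam := (l : ℤ)) hp he (by simpa using hMl) k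
        (pow_cycleLength hγ)
      rw [hδe, hδ, twist_sub, twist_smul]
      linear_combination h3 - v γ₀ * h4) hδhigh
  refine ⟨v γ₀, fun γ hγ k hk hkM => ?_⟩
  have h5 : δ k γ = 0 := by
    by_cases h : k ≤ l - 1
    · exact hδlow k hk h γ hγ
    · exact hδhigh k (by omega) hkM γ hγ
  rw [hδe, Pi.sub_apply, Pi.sub_apply] at h5
  linear_combination h5

/-- The correction term in the residue at a torsion tree is the value of a power of the twisted
Mahler operator on a vector supported on the cycle. -/
theorem correction_eq_twist (hp : 2 ≤ p) (hM : treeOrder f τ ≤ M) {h : ℕ} (hh : 1 ≤ h)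
    {d : ℕ → Kˣ → K} (hd : ∀ k, treeOrder f τ < k → ∀ γ, d k γ = 0) {α : Kˣ}
    (hα : α ^ p ^ h ∈ cycle τ) {k : ℕ} (hk : 1 ≤ k) :
    (p : K) ^ (lam * ((h : ℤ) - 1)) * ∑ s ∈ Finset.Icc k (treeOrder f τ),
      ((univMahlerCoeff p s k (h - 1) : ℚ) : K) *
        (α : K) ^ ((k : ℤ) - (s : ℤ) * (p : ℤ) ^ (h + cycleLength τ - 1)) *
        (cycleMap p lam d s (α ^ p ^ (h + cycleLength τ - 1)) +
          d s (α ^ p ^ (h + cycleLength τ - 1))) =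
      twist p lam M h d k α := by
  set e := cycleLength τ with he
  -- `ζ` is the element of the cycle whose `p`-th power is `α ^ (p ^ h)`. Passing from `α` to `ξ`
  -- keeps the `p ^ h`-th power and makes the `p ^ (h - 1)`-th power equal to `ζ`, which explains
  -- the exponent `h + e - 1`.
  set ξ := α ^ p ^ e with hξ
  set ζ := α ^ p ^ (h + e - 1) with hζ
  have hξζ : ξ ^ p ^ (h - 1) = ζ := by
    rw [hξ, ← pow_pow_add, hζ]
    congr 2
    omega
  have hξα : ξ ^ p ^ h = α ^ p ^ h := by
    rw [hξ, ← pow_pow_add, add_comm, pow_pow_add, pow_cycleLength hα]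
  have hcast : ((h : ℤ) - 1) = ((h - 1 : ℕ) : ℤ) := by omega
  have h1 : ∀ s, cycleMap p lam d s ζ + d s ζ = twist p lam (treeOrder f τ) 1 d s ζ := by
    intro s
    rw [cycleMap_eq_twist (fun s hs => hd s hs _)]
    ring
  rw [← twist_mono hM (fun s hs => hd s hs _), twist_eq_univTwist (by omega), ← hξα,
    show ξ ^ p ^ h = ξ ^ p ^ (h - 1 + 1) by rw [Nat.sub_add_cancel hh],
    show univTwist p lam (treeOrder f τ) h d k (ξ ^ p ^ (h - 1 + 1)) =
      univTwist p lam (treeOrder f τ) (h - 1 + 1) d k (ξ ^ p ^ (h - 1 + 1)) by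
        rw [Nat.sub_add_cancel hh],
    ← univTwist_twist (by omega) _ _ hk, hξζ, univTwist, hcast, mul_left_comm]
  congr 1
  rw [Finset.mul_sum]
  refine Finset.sum_congr rfl fun s _ => ?_
  rw [h1, sub_eq_add_neg, zpow_add₀ α.ne_zero, zpow_neg_mul_pow]
  ring

/-- Up to sign this is the value that the extension of the section from the cycle takes at maximal
height. -/
theorem torsionResidue_eq (hp : 2 ≤ p) (hM : treeOrder f τ ≤ M) (hh : funHeight f τ ≠ 0)
    (hs : sing f τ ≠ ∅) {k : ℕ} (hk : 1 ≤ k) (hkm : k ≤ treeOrder f τ) {α : Kˣ}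
    (hC : (cycle τ).Nonempty) (hα : α ∈ elems τ) (hht : torsionHeight τ α = funHeight f τ) :
    torsionResidue lam f τ k ⟨α, hα⟩ =
      ∑ n ∈ Finset.range (funHeight f τ), twist p lam M n (coeffVec f) k α -
        twist p lam M (funHeight f τ)
          (omegaSection lam τ (residualAverage lam f τ) (coeffVec f)) k α := by
  simp only [torsionResidue]
  rw [if_neg (by simp [hs]; omega), if_neg hh, if_pos hht,
    sum_Icc_treeOrder_eq_twist hM _ hα,
    correction_eq_twist hp hM (by omega) (fun k hk γ => omegaSection_of_lt f hk γ)
      (pow_mem_cycle_of_torsionHeight hC hα hht) hk]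

theorem exists_solution_of_torsionResidue (hp : 2 ≤ p) (hC : (cycle τ).Nonempty) (f : RatFunc K)
    (hres : ∀ k, 1 ≤ k → torsionResidue lam f τ k = 0) (hM : treeOrder f τ ≤ M) :
    ∃ d : ℕ → Kˣ → K, {α | α ∈ elems τ ∧ ∃ k, 1 ≤ k ∧ d k α ≠ 0}.Finite ∧
      (∀ k, M < k → ∀ α, d k α = 0) ∧
      ∀ α ∈ elems τ, ∀ k, 1 ≤ k → coeffVec f k α = twist p lam M 1 d k α - d k α := by
  have hp0 : 0 < p := by omega
  have hzero : (∀ α ∈ elems τ, ∀ k, 1 ≤ k → k ≤ treeOrder f τ → coeffVec f k α = 0) →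
      ∃ d : ℕ → Kˣ → K, {α | α ∈ elems τ ∧ ∃ k, 1 ≤ k ∧ d k α ≠ 0}.Finite ∧
      (∀ k, M < k → ∀ α, d k α = 0) ∧
      ∀ α ∈ elems τ, ∀ k, 1 ≤ k → coeffVec f k α = twist p lam M 1 d k α - d k α := by
    intro h
    refine ⟨0, by simp, by simp, fun α hα k hk => ?_⟩
    rw [twist_eq_zero fun _ _ _ => rfl, Pi.zero_apply, Pi.zero_apply, sub_zero]
    by_cases hkm : k ≤ treeOrder f τ
    · exact h α hα k hk hkm
    · exact coeffVec_of_treeOrder_lt f τ (by omega) hα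
  by_cases hs : sing f τ = ∅
  · exact hzero fun α hα k hk _ => coeffVec_of_not_mem_sing hα (by simp [hs]) hk
  by_cases hh : funHeight f τ = 0
  · refine hzero fun α hα k hk hkm => ?_
    by_cases hαC : α ∈ cycle τ
    · have h1 := congrFun (hres k hk) ⟨α, hα⟩
      simp only [torsionResidue] at h1
      rwa [if_neg (by simp [hs]; omega), if_pos hh, if_pos hαC] at h1
    · refine coeffVec_of_funHeight_lt hα ?_ hk
      rw [hh]
      exact Nat.pos_of_ne_zero fun h0 =>
        hαC (mem_of_heightTo_eq_zero (exists_pow_mem_cycle hC α hα) h0)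
  set d := omegaSection lam τ (residualAverage lam f τ) (coeffVec f) with hd
  have hdm : ∀ k, treeOrder f τ < k → ∀ γ, d k γ = 0 := fun k hk γ => omegaSection_of_lt f hk γ
  refine exists_extension (S := cycle τ) (dS := d) hp0 cycle_pow (exists_pow_mem_cycle hC)
    ((finite_coeffVec f).subset fun α hα => hα.2)
    (fun k hk α hα => coeffVec_of_treeOrder_lt f τ (by omega) hα)
    (finite_cycle.subset fun γ hγ => hγ.1) (fun γ hγ hγτ k hk hkM => ?_) (funHeight f τ)
    (fun α hα hht k hk hkM => ?_) (fun α hα h k hk => coeffVec_of_funHeight_lt hα h hk)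
  · by_cases hkm : k ≤ treeOrder f τ
    -- In degree `lam` the cycle component of the residue is exactly the equation on the cycle; in
    -- the other degrees the section satisfies it automatically.
    · by_cases hkl : (k : ℤ) = lam
      · have h1 := congrFun (hres k hk) ⟨γ, hγτ⟩
        simp only [torsionResidue] at h1
        have h0 : torsionHeight τ γ = 0 := heightTo_of_mem hγ
        rw [if_neg (by simp [hs]; omega), if_neg hh, if_neg (by omega), if_pos ⟨hkl, hγ⟩,
          Pi.zero_apply, sub_eq_zero, cycleMap_eq_twist (M := M) (fun s hs => hdm s (by omega) _)] at h1
        exact h1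
      · rw [hd, twist_omegaSection f hp hM hk hγ, twist_zeroSection_of_ne f hp hM hk hkl hγ]
    · rw [coeffVec_of_treeOrder_lt f τ (by omega) hγτ, hdm k (by omega), twist_eq_zero, sub_zero]
      exact fun s hs _ => hdm s (by omega) _
  · by_cases hkm : k ≤ treeOrder f τ
    · have h1 := congrFun (hres k hk) ⟨α, hα⟩
      rw [torsionResidue_eq hp hM hh hs hk hkm hC hα hht, Pi.zero_apply] at h1
      linear_combination -h1
    · rw [twist_eq_zero fun s hs _ => hdm s (by omega) _, zero_sub, neg_eq_zero]
      exact Finset.sum_eq_zero fun n _ => twist_eq_zero fun s hs _ =>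
        coeffVec_of_treeOrder_lt f τ (by omega) (pow_mem_elems hα n)

variable [IsAlgClosed K]

/-- At height `h` the hypothesis, multiplied by `α ^ (-lam)`, gives `G γ + w` with `γ = α ^ (p ^
h)`. After summation over the level, the first term of `ω` is the average of `G + w` over the cycle
and the second is the average of `G`. -/
theorem residualAverage_eq (hp : 2 ≤ p) (hC : (cycle τ).Nonempty) (hh : 1 ≤ funHeight f τ)
    (hM : treeOrder f τ ≤ M) (hl : 1 ≤ lam) (hMl : lam.toNat ≤ M) {d : ℕ → Kˣ → K} {w : K}
    (hd : ∀ α ∈ level τ (funHeight f τ), ∀ k, 1 ≤ k → k ≤ M →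
      ∑ n ∈ Finset.range (funHeight f τ), twist p lam M n (coeffVec f) k α =
        twist p lam M (funHeight f τ) d k α)
    (hw : ∀ γ ∈ cycle τ, ∀ k, 1 ≤ k → k ≤ M →
      d k γ = zeroSection lam τ (coeffVec f) k γ + w * kernelVec p lam (cycleLength τ) k γ) :
    residualAverage lam f τ = w := by
  obtain ⟨l, rfl⟩ : ∃ l : ℕ, lam = l := ⟨lam.toNat, by omega⟩
  have hp0 : 0 < p := by omega
  simp only [Int.toNat_natCast] at hMl
  have he := one_le_cycleLength hC
  have heK : (cycleLength τ : K) ≠ 0 := by exact_mod_cast (by omega : cycleLength τ ≠ 0)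
  set h := funHeight f τ with hhdef
  set d₀ := zeroSection (l : ℤ) τ (coeffVec f) with hd₀
  set G : Kˣ → K := univTwist p l M h d₀ l with hG
  have hfirst : ∑ᶠ α ∈ level τ h, ∑ s ∈ Finset.Icc l (treeOrder f τ), ∑ n ∈ Finset.range h,
      (p : K) ^ ((l : ℤ) * (n : ℤ)) * ((univMahlerCoeff p s l n : ℚ) : K) *
        (α : K) ^ (-((s : ℤ) * (p : ℤ) ^ n)) * coeffVec f s (α ^ p ^ n) =
      ((p : K) ^ h - (p : K) ^ (h - 1)) * ∑ᶠ γ ∈ cycle τ, (G γ + w) := by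
    rw [← finsum_level_eq hp hC hh]
    refine finsum_mem_congr rfl fun α hα => ?_
    have h1 : ∑ s ∈ Finset.Icc l (treeOrder f τ), ∑ n ∈ Finset.range h,
        (p : K) ^ ((l : ℤ) * (n : ℤ)) * ((univMahlerCoeff p s l n : ℚ) : K) *
          (α : K) ^ (-((s : ℤ) * (p : ℤ) ^ n)) * coeffVec f s (α ^ p ^ n) =
        (α : K) ^ (-(l : ℤ)) * ∑ n ∈ Finset.range h, twist p l M n (coeffVec f) l α := by
      rw [Finset.sum_comm, Finset.mul_sum]
      refine Finset.sum_congr rfl fun n _ => ?_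
      rw [← univTwist_eq_twist hp0, ← univTwist_mono hM
        (fun s hs => coeffVec_of_treeOrder_lt f τ hs (pow_mem_elems hα.1 n)), univTwist,
        Finset.mul_sum]
      exact Finset.sum_congr rfl fun s _ => by rw [zpow_neg_mul_pow]; ring
    have hαC := pow_mem_cycle_of_torsionHeight hC hα.1 hα.2
    rw [h1, hd α hα l (by omega) hMl, ← univTwist_eq_twist hp0]
    have h2 : twist p l M h d l α = twist p l M h (d₀ + w • kernelVec p l (cycleLength τ)) l α :=
      twist_congr fun s hs hsM => hw _ hαC s (by omega) hsM
    rw [univTwist_eq_twist hp0, h2, twist_add, twist_smul, mul_add, mul_left_comm,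
      ← univTwist_eq_twist hp0, ← univTwist_eq_twist hp0, univTwist_kernelVec hp0 _ _ rfl hMl,
      mul_one]
  have hsecond : (p : K) ^ ((l : ℤ) * ((h : ℤ) - 1)) / (cycleLength τ : K) *
      (∑ᶠ γ ∈ cycle τ, ∑ s ∈ Finset.Icc l (treeOrder f τ),
        ((univMahlerCoeff p s l (h - 1) : ℚ) : K) * (γ : K) ^ (-(s : ℤ)) *
          (cycleMap p l d₀ s γ + d₀ s γ)) = (cycleLength τ : K)⁻¹ * ∑ᶠ γ ∈ cycle τ, G γ := by
    rw [← finsum_cycle_pow G, mul_finsum_mem, mul_finsum_mem]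
    refine finsum_mem_congr rfl fun γ _ => ?_
    -- The auxiliary root `ξ` gives access to the semigroup law: `D(d₀) + d₀ = T d₀`, so each
    -- summand is a value of `G` at `γ ^ p`, and `x ↦ x ^ p` permutes the cycle.
    obtain ⟨ξ, hξ⟩ := exists_units_pow_eq (pow_pos hp0 (h - 1)) γ
    have hξp : ξ ^ p ^ (h - 1 + 1) = γ ^ p := by rw [pow_pow_add, hξ, pow_one]
    have h1 := univTwist_twist (lam := (l : ℤ)) (M := treeOrder f τ) hp0 (h - 1) d₀
      (k := l) (by omega) ξ
    rw [hξ, hξp, Nat.sub_add_cancel hh,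
      univTwist_mono hM (fun s hs => zeroSection_of_lt f hs _)] at h1
    rw [hG, ← h1, univTwist, show ((h - 1 : ℕ) : ℤ) = (h : ℤ) - 1 by omega, div_eq_inv_mul, mul_assoc]
    congr 2
    refine Finset.sum_congr rfl fun s _ => ?_
    rw [cycleMap_eq_twist (fun s hs => zeroSection_of_lt f hs _)]
    ring
  have hsum : ∑ᶠ γ ∈ cycle τ, (G γ + w) = ∑ᶠ γ ∈ cycle τ, G γ + cycleLength τ * w := by
    rw [finsum_mem_eq_finite_toFinset_sum _ finite_cycle,
      finsum_mem_eq_finite_toFinset_sum _ finite_cycle, Finset.sum_add_distrib, Finset.sum_const,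
      nsmul_eq_mul, ← Set.ncard_eq_toFinset_card _ finite_cycle, cycleLength]
  have hN : (p : K) ^ h - (p : K) ^ (h - 1) ≠ 0 := by
    rw [sub_ne_zero]
    intro h'
    have := Nat.pow_right_injective hp (by exact_mod_cast h')
    omega
  simp only [residualAverage]
  rw [if_neg (by omega)]
  simp only [Int.toNat_natCast, ← hhdef]
  rw [hfirst, hsecond, hsum]
  field_simp
  ring

theorem torsionResidue_eq_zero (hp : 2 ≤ p) (hC : (cycle τ).Nonempty)
    (hM : treeOrder f τ ≤ M) (hMl : lam.toNat ≤ M) {d : ℕ → Kˣ → K}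
    (hd : {α | ∃ k, 1 ≤ k ∧ d k α ≠ 0}.Finite)
    (hdf : ∀ α ∈ elems τ, ∀ k, 1 ≤ k → coeffVec f k α = twist p lam M 1 d k α - d k α)
    {k : ℕ} (hk : 1 ≤ k) : torsionResidue lam f τ k = 0 := by
  have hp0 : 0 < p := by omega
  have habs := exists_pow_mem_cycle hC
  funext ⟨α, hα⟩
  rw [Pi.zero_apply]
  by_cases hs : sing f τ = ∅ ∨ treeOrder f τ < k
  · simp only [torsionResidue]
    rw [if_pos hs]
  rw [not_or, not_lt] at hs
  obtain ⟨hs, hkm⟩ := hs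
  have hcH : ∀ H, funHeight f τ ≤ H → ∀ α ∈ elems τ, H < heightTo p (cycle τ) α →
      ∀ k, 1 ≤ k → coeffVec f k α = 0 := fun H hH α hα h k hk =>
    coeffVec_of_funHeight_lt hα (lt_of_le_of_lt hH h) hk
  by_cases hh : funHeight f τ = 0
  -- When all poles lie on the cycle, a root `β` of `γ` off the cycle has height `1`. There `c` and
  -- `d` vanish, so `d` vanishes on the cycle, and then so does `c`.
  · have hdC : ∀ γ ∈ cycle τ, ∀ k, 1 ≤ k → k ≤ M → d k γ = 0 := by
      intro γ hγ
      obtain ⟨β, hβ, hβC⟩ := exists_root_not_mem_cycle hp hγ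
      have hht : heightTo p (cycle τ) β = 1 := by
        rw [heightTo_root (habs γ hγ.1) hβ hβC, heightTo_of_mem hγ]
      have hβτ : β ∈ elems τ := mem_elems_of_pow (n := 1) (by rw [pow_one, hβ]; exact hγ.1)
      have h1 : ∀ k, 1 ≤ k → k ≤ M → twist p lam M 1 d k β = 0 := by
        intro k hk hkM
        have h2 := hdf β hβτ k hk
        rw [hcH 0 hh.le β hβτ (by omega) k hk, solution_eq_zero hp0 cycle_pow habs hd hdf 1 le_rfl
          (hcH 1 (by omega)) β hβτ hht.ge k hk hkM, sub_zero] at h2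
        exact h2.symm
      have := twist_injective hp0 h1
      rwa [pow_one, hβ] at this
    simp only [torsionResidue]
    rw [if_neg (by simp [hs]; omega), if_pos hh]
    split_ifs with hαC
    · rw [hdf α hα k hk, hdC α hαC k hk (by omega), sub_zero]
      refine twist_eq_zero fun s hks hsM => hdC _ ?_ s (by omega) hsM
      rw [pow_one]
      exact cycle_pow α hαC
    · rfl
  · obtain ⟨w, hw⟩ := exists_eq_zeroSection_add hp hC hM hMl (fun γ hγ => hdf γ hγ.1)
    have hsum := sum_twist_eq_of_solution hp0 cycle_pow habs hd hdf (funHeight f τ) (by omega)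
      (hcH _ le_rfl)
    have homega : ∀ γ ∈ cycle τ, ∀ k, 1 ≤ k → k ≤ M →
        omegaSection lam τ (residualAverage lam f τ) (coeffVec f) k γ = d k γ := by
      intro γ hγ k hk hkM
      rw [omegaSection_eq f _ hk, hw γ hγ k hk hkM]
      rcases le_or_gt lam 0 with hl | hl
      · rw [kernelVec_of_lt (by omega), mul_zero, mul_zero]
      · rw [residualAverage_eq hp hC (by omega) hM (by omega) hMl
          (fun α hα k hk hkM => hsum α hα.1 hα.2 k hk hkM) hw]
    by_cases hht : torsionHeight τ α = funHeight f τ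
    · rw [torsionResidue_eq hp hM hh hs hk hkm hC hα hht, hsum α hα hht k hk (by omega), sub_eq_zero]
      exact twist_congr fun s hks hsM =>
        (homega _ (pow_mem_cycle_of_torsionHeight hC hα hht) s (by omega) hsM).symm
    · simp only [torsionResidue]
      rw [if_neg (by simp [hs]; omega), if_neg hh, if_neg hht]
      split_ifs with hαC
      · rw [cycleMap_eq_twist (M := M) (fun s hs => omegaSection_of_lt f (by omega) _),
          hdf α hα k hk, homega α hαC.2 k hk (by omega), sub_eq_zero]
        congr 1
        refine twist_congr fun s hks hsM => (homega _ ?_ s (by omega) hsM).symm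
        rw [pow_one]
        exact cycle_pow α hαC.2
      · rfl

end TorsionResidue

/-! ### From single trees to the whole of `Kˣ` -/

section Main

variable {τ : MahlerTree K p} {f : RatFunc K}

theorem residueTree_eq_zero [CharZero K] [IsAlgClosed K] (hp : 2 ≤ p)
    (hM : treeOrder f τ ≤ M) (hMl : lam.toNat ≤ M) {d : ℕ → Kˣ → K}
    (hd : {α | ∃ k, 1 ≤ k ∧ d k α ≠ 0}.Finite)
    (hdf : ∀ α ∈ elems τ, ∀ k, 1 ≤ k → coeffVec f k α = twist p lam M 1 d k α - d k α)
    {k : ℕ} (hk : 1 ≤ k) : residueTree lam f τ k = 0 := by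
  rw [residueTree]
  split_ifs with hC
  · exact torsionResidue_eq_zero hp hC hM hMl hd hdf hk
  · exact nonTorsionResidue_eq_zero hp hC hM hd hdf hk

theorem exists_solution_of_residueTree [CharZero K] (hp : 2 ≤ p) (f : RatFunc K)
    (hres : ∀ k, 1 ≤ k → residueTree lam f τ k = 0) (hM : treeOrder f τ ≤ M) :
    ∃ d : ℕ → Kˣ → K, {α | α ∈ elems τ ∧ ∃ k, 1 ≤ k ∧ d k α ≠ 0}.Finite ∧
      (∀ k, M < k → ∀ α, d k α = 0) ∧
      ∀ α ∈ elems τ, ∀ k, 1 ≤ k → coeffVec f k α = twist p lam M 1 d k α - d k α := by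
  by_cases hC : (cycle τ).Nonempty
  · exact exists_solution_of_torsionResidue hp hC f
      (fun k hk => by simpa only [residueTree, if_pos hC] using hres k hk) hM
  · exact exists_solution_of_nonTorsionResidue hp hC f
      (fun k hk => by simpa only [residueTree, if_neg hC] using hres k hk) hM

theorem treeOrder_le_natDegree (f : RatFunc K) (τ : MahlerTree K p) :
    treeOrder f τ ≤ f.denom.natDegree := by
  refine csSup_le' ?_
  rintro _ ⟨α, -, rfl⟩
  exact poleOrder_le f _

/-- Solutions on the individual trees can be glued. -/
theorem exists_global_solution (f : RatFunc K)
    (h : ∀ τ : MahlerTree K p,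
      ∃ d : ℕ → Kˣ → K, {α | α ∈ elems τ ∧ ∃ k, 1 ≤ k ∧ d k α ≠ 0}.Finite ∧
      (∀ k, M < k → ∀ α, d k α = 0) ∧
      ∀ α ∈ elems τ, ∀ k, 1 ≤ k → coeffVec f k α = twist p lam M 1 d k α - d k α) :
    ∃ d : ℕ → Kˣ → K, {α | ∃ k, 1 ≤ k ∧ d k α ≠ 0}.Finite ∧ (∀ k α, M < k → d k α = 0) ∧
      ∀ k α, 1 ≤ k → coeffVec f k α = twist p lam M 1 d k α - d k α := by
  classical
  choose d hfin hdM hdf using h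
  set T : Set (MahlerTree K p) := {τ | (sing f τ).Nonempty} with hT
  have hTfin : T.Finite := by
    refine ((finite_coeffVec f).image (fun α => Quotient.mk (treeSetoid K p) α)).subset ?_
    rintro τ ⟨α, hα⟩
    exact ⟨α, ((mem_sing_iff f τ).1 hα).2, hα.1⟩
  -- The chosen solution on a tree without poles need not be zero. Replacing it by `0` there leaves
  -- finitely many trees and hence finite support.
  set d' : MahlerTree K p → ℕ → Kˣ → K := fun τ => if τ ∈ T then d τ else 0 with hd'
  have hdf' : ∀ τ, ∀ α ∈ elems τ, ∀ k, 1 ≤ k →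
      coeffVec f k α = twist p lam M 1 (d' τ) k α - d' τ k α := by
    intro τ α hα k hk
    by_cases hτ : τ ∈ T
    · simp only [hd', if_pos hτ]
      exact hdf τ α hα k hk
    · simp only [hd', if_neg hτ]
      rw [twist_eq_zero fun _ _ _ => rfl, coeffVec_of_not_mem_sing hα (fun hs => hτ ⟨α, hs⟩) hk]
      simp
  refine ⟨fun k α => d' (Quotient.mk (treeSetoid K p) α) k α, ?_, fun k α hk => ?_,
    fun k α hk => ?_⟩
  · refine (hTfin.biUnion fun τ _ => hfin τ).subset ?_
    rintro α ⟨k, hk, h⟩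
    by_cases hτ : Quotient.mk (treeSetoid K p) α ∈ T
    · simp only [hd', if_pos hτ] at h
      exact Set.mem_biUnion hτ ⟨rfl, k, hk, h⟩
    · simp only [hd', if_neg hτ] at h
      simp at h
  · by_cases hτ : Quotient.mk (treeSetoid K p) α ∈ T
    · simp only [hd', if_pos hτ]
      exact hdM _ k hk α
    · simp only [hd', if_neg hτ]
      rfl
  · rw [hdf' (Quotient.mk (treeSetoid K p) α) α rfl k hk]
    congr 1
    refine twist_congr fun s _ _ => ?_
    rw [show Quotient.mk (treeSetoid K p) (α ^ p ^ 1) = Quotient.mk (treeSetoid K p) α from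
      pow_mem_elems (τ := Quotient.mk (treeSetoid K p) α) rfl 1]

end Main

end

end Mahler

end


theorem theorem1p1 {K : Type*} [Field K] [IsAlgClosed K] [CharZero K] (p : ℕ) (hp : 2 ≤ p)
    (lam : ℤ) (f : RatFunc K) :
    Mahler.IsMahlerSummable p lam f ↔
      Mahler.residueInfty p lam f = 0 ∧
        ∀ τ : Mahler.MahlerTree K p, ∀ k : ℕ, 1 ≤ k → Mahler.residueTree lam f τ k = 0 := by
  have hp0 : 0 < p := by omega
  rw [← Mahler.exists_laurentPoly_solution_iff hp]
  constructor
  · intro hf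
    obtain ⟨ha, d, M₀, hd, hdf⟩ := hf.exists_coeff hp0
    refine ⟨ha, fun τ k hk => ?_⟩
    -- The bound has to dominate the pole orders of `g` (through `M₀`) and of `f`, and also `lam`.
    exact Mahler.residueTree_eq_zero (M := max M₀ (max f.denom.natDegree lam.toNat)) hp
      ((Mahler.treeOrder_le_natDegree f τ).trans ((le_max_left _ _).trans (le_max_right _ _)))
      ((le_max_right _ _).trans (le_max_right _ _)) hd
      (fun α _ k hk => hdf _ (le_max_left _ _) k α hk) hk
  · rintro ⟨⟨a, ha, haf⟩, hres⟩
    obtain ⟨d, hd, hdM, hdf⟩ := Mahler.exists_global_solution f fun τ =>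
      Mahler.exists_solution_of_residueTree hp f (hres τ) (Mahler.treeOrder_le_natDegree f τ)
    exact Mahler.isMahlerSummable_of_coeff hp0 a ha haf d _ hd hdM hdf
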